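/- Conventions. $C^*$-algebras are complex and need not be unital; ideals are closed and two-sided. A projection $p\neq 0$ of a $C^*$-algebra $\mathcal B$ is minimal if $p\mathcal Bp=\mathbb Cp$, and $\mathcal I^{At}(\mathcal B)$ denotes the $C^*$-subalgebra of $\mathcal B$ generated by its minimal projections. A $C^*$-algebra $\mathcal A$ is scattered if $\mathcal I^{At}(\mathcal B)\neq\{0\}$ for every nonzero $C^*$-subalgebra $\mathcal B\subseteq\mathcal A$. The Cantor–Bendixson sequence of a scattered $\mathcal A$ is the sequence of ideals $(\mathcal I_\alpha)_{\alpha\le ht(\mathcal A)}$, indexed by the ordinals up to some ordinal $ht(\mathcal A)$ (the height of $\mathcal A$), which is strictly increasing, continuous (i.e. $\mathcal I_\lambda=\overline{\bigcup_{\alpha<\lambda}\mathcal I_\alpha}$ for limit $\lambda\le ht(\mathcal A)$) and satisfies $\mathcal I_0=\{0\}$, $\mathcal I_{ht(\mathcal A)}=\mathcal A$ and $\mathcal I^{At}(\mathcal A/\mathcal I_\alpha)=\{a+\mathcal I_\alpha : a\in\mathcal I_{\alpha+1}\}$ for all $\alpha<ht(\mathcal A)$; such a height and sequence exist and are unique.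 $\mathcal K(\ell_2)$ is the algebra of compact operators on $\ell_2=\ell_2(\mathbb N)$, $\mathcal A\otimes\mathcal K(\ell_2)$ is the $C^*$-tensor product (unique, since $\mathcal K(\ell_2)$ is nuclear; concretely, the completion of the algebraic tensor product in its largest $C^*$-norm), and for an ideal $\mathcal I$ of $\mathcal A$, $\mathcal I\otimes\mathcal K(\ell_2)$ is regarded as the ideal of $\mathcal A\otimes\mathcal K(\ell_2)$ which is the closed linear span of $\{x\otimes k : x\in\mathcal I,\ k\in\mathcal K(\ell_2)\}$. Proposition. Let $\mathcal A$ be a scattered $C^*$-algebra with Cantor–Bendixson sequence $(\mathcal I_\alpha)_{\alpha\le ht(\mathcal A)}$. Then $\mathcal A\otimes\mathcal K(\ell_2)$ is a scattered $C^*$-algebra, $ht(\mathcal A\otimes\mathcal K(\ell_2))=ht(\mathcal A)$, and its Cantor–Bendixson sequence $(\mathcal J_\alpha)_{\alpha\le ht(\mathcal A)}$ satisfies $\mathcal J_\alpha=\mathcal I_\alpha\otimes\mathcal K(\ell_2)$ for every $\alpha\le ht(\mathcal A)$. In particular, $\mathcal J_{\alpha+1}/\mathcal J_\alpha$ is $*$-isomorphic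 to $(\mathcal I_{\alpha+1}/\mathcal I_\alpha)\otimes\mathcal K(\ell_2)$ for every $\alpha<ht(\mathcal A)$. -/

import Mathlib

open scoped TensorProduct

universe u v

namespace ScatteredCStar

/-! ### Minimal projections and scattered algebras -/

section Atoms

variable {A : Type u} [NonUnitalCStarAlgebra A]

/-- A minimal projection of a C⋆-algebra: a nonzero projection `p` with `pAp = ℂp`. -/
structure IsMinimalProjection (p : A) : Prop where
  isStarProjection : IsStarProjection p
  ne_zero : p ≠ 0
  corner_eq : Set.range (fun a : A => p * a * p) = Set.range (fun c : ℂ => c • p)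

variable (A) in
/-- The C⋆-subalgebra `𝓘ᴬᵗ(A)` generated by the minimal projections of `A`. -/
noncomputable def atomicPart : NonUnitalStarSubalgebra ℂ A :=
  (NonUnitalStarAlgebra.adjoin ℂ {p : A | IsMinimalProjection p}).topologicalClosure

variable (A) in
/-- A C⋆-algebra is scattered if `𝓘ᴬᵗ(B) ≠ 0` for each of its nonzero C⋆-subalgebras `B`. -/
def IsScattered : Prop :=
  ∀ (B : NonUnitalStarSubalgebra ℂ A) [IsClosed (B : Set A)], B ≠ ⊥ → atomicPart B ≠ ⊥

end Atoms

/-! ### Closed ideals and quotients -/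

/-- A closed two-sided ideal of a C⋆-algebra. (Closed two-sided ideals of C⋆-algebras are
automatically self-adjoint linear subspaces; these properties are recorded as fields.) -/
structure ClosedIdeal (A : Type u) [NonUnitalCStarAlgebra A] extends Submodule ℂ A where
  mul_mem_left' : ∀ (a : A) {x : A}, x ∈ carrier → a * x ∈ carrier
  mul_mem_right' : ∀ (a : A) {x : A}, x ∈ carrier → x * a ∈ carrier
  star_mem' : ∀ {x : A}, x ∈ carrier → star x ∈ carrier
  isClosed' : IsClosed carrier

namespace ClosedIdeal

variable {A : Type u} [NonUnitalCStarAlgebra A]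

instance : SetLike (ClosedIdeal A) A where
  coe I := I.carrier
  coe_injective I J h := by
    cases I; cases J; congr; exact SetLike.coe_injective h

instance : NonUnitalSubringClass (ClosedIdeal A) A where
  add_mem {I} := I.add_mem'
  zero_mem I := I.zero_mem'
  neg_mem {I} _ hx := I.toSubmodule.neg_mem hx
  mul_mem {I} _ _ _ hy := I.mul_mem_left' _ hy

instance : SMulMemClass (ClosedIdeal A) ℂ A where
  smul_mem {I} c _ hx := I.smul_mem' c hx

instance : StarMemClass (ClosedIdeal A) A where
  star_mem {I} _ hx := I.star_mem' hx

instance (I : ClosedIdeal A) : IsClosed (I : Set A) := I.isClosed'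

instance (I : ClosedIdeal A) : IsClosed (I.toSubmodule : Set A) := I.isClosed'

/-- The quotient `A / I`, with the quotient norm. -/
def Quotient (I : ClosedIdeal A) : Type u := A ⧸ I.toSubmodule

variable (I : ClosedIdeal A)

noncomputable instance : NormedAddCommGroup I.Quotient :=
  inferInstanceAs (NormedAddCommGroup (A ⧸ I.toSubmodule))

noncomputable instance : NormedSpace ℂ I.Quotient :=
  inferInstanceAs (NormedSpace ℂ (A ⧸ I.toSubmodule))

instance : CompleteSpace I.Quotient :=
  inferInstanceAs (CompleteSpace (A ⧸ I.toSubmodule))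

/-- The quotient map `a ↦ [a]`. -/
def proj : A →ₗ[ℂ] I.Quotient := I.toSubmodule.mkQ

lemma proj_surjective : Function.Surjective I.proj := I.toSubmodule.mkQ_surjective

lemma proj_eq_proj_iff {a b : A} : I.proj a = I.proj b ↔ a - b ∈ I :=
  Submodule.Quotient.eq I.toSubmodule

lemma norm_proj_le (a : A) : ‖I.proj a‖ ≤ ‖a‖ := Submodule.Quotient.norm_mk_le _ a

lemma exists_norm_lt (x : I.Quotient) {ε : ℝ} (hε : 0 < ε) :
    ∃ a, I.proj a = x ∧ ‖a‖ < ‖x‖ + ε :=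
  Submodule.Quotient.norm_mk_lt (S := I.toSubmodule) x hε

noncomputable instance : Mul I.Quotient where
  mul := Quotient.map₂ (sa := I.toSubmodule.quotientRel) (sb := I.toSubmodule.quotientRel)
    (sc := I.toSubmodule.quotientRel) (· * ·) fun a a' h b b' h' => by
      change I.toSubmodule.quotientRel a a' at h
      change I.toSubmodule.quotientRel b b' at h'
      change I.toSubmodule.quotientRel (a * b) (a' * b')
      rw [Submodule.quotientRel_def] at h h' ⊢
      have : a * b - a' * b' = a * (b - b') + (a - a') * b' := by noncomm_ring
      rw [this]
      exact I.add_mem' (I.mul_mem_left' _ h') (I.mul_mem_right' _ h)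

lemma proj_mul (a b : A) : I.proj (a * b) = I.proj a * I.proj b := rfl

noncomputable instance : Star I.Quotient where
  star := Quotient.map (sa := I.toSubmodule.quotientRel) (sb := I.toSubmodule.quotientRel)
    star fun a a' h => by
      change I.toSubmodule.quotientRel a a' at h
      change I.toSubmodule.quotientRel (star a) (star a')
      rw [Submodule.quotientRel_def] at h ⊢
      rw [← star_sub]
      exact I.star_mem' h

lemma proj_star (a : A) : I.proj (star a) = star (I.proj a) := rfl

noncomputable instance : NonUnitalNormedRing I.Quotient where
  __ := (inferInstance : NormedAddCommGroup I.Quotient)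
  left_distrib x y z := by
    obtain ⟨x, rfl⟩ := I.proj_surjective x
    obtain ⟨y, rfl⟩ := I.proj_surjective y
    obtain ⟨z, rfl⟩ := I.proj_surjective z
    simp only [← proj_mul, ← map_add, mul_add]
  right_distrib x y z := by
    obtain ⟨x, rfl⟩ := I.proj_surjective x
    obtain ⟨y, rfl⟩ := I.proj_surjective y
    obtain ⟨z, rfl⟩ := I.proj_surjective z
    simp only [← proj_mul, ← map_add, add_mul]
  zero_mul x := by
    obtain ⟨x, rfl⟩ := I.proj_surjective x
    rw [← map_zero I.proj, ← proj_mul, zero_mul]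
  mul_zero x := by
    obtain ⟨x, rfl⟩ := I.proj_surjective x
    rw [← map_zero I.proj, ← proj_mul, mul_zero]
  mul_assoc x y z := by
    obtain ⟨x, rfl⟩ := I.proj_surjective x
    obtain ⟨y, rfl⟩ := I.proj_surjective y
    obtain ⟨z, rfl⟩ := I.proj_surjective z
    simp only [← proj_mul, mul_assoc]
  norm_mul_le x y := by
    refine ge_of_tendsto (x := nhdsWithin (0 : ℝ) (Set.Ioi 0))
      (f := fun ε : ℝ => (‖x‖ + ε) * (‖y‖ + ε)) ?_ ?_
    · have : Filter.Tendsto (fun ε : ℝ => (‖x‖ + ε) * (‖y‖ + ε)) (nhds 0)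
          (nhds ((‖x‖ + 0) * (‖y‖ + 0))) := by
        apply Continuous.tendsto; fun_prop
      simp only [add_zero] at this
      exact this.mono_left nhdsWithin_le_nhds
    · filter_upwards [self_mem_nhdsWithin] with ε hε
      obtain ⟨a, rfl, ha⟩ := I.exists_norm_lt x hε
      obtain ⟨b, rfl, hb⟩ := I.exists_norm_lt y hε
      rw [← proj_mul]
      refine (I.norm_proj_le _).trans ((norm_mul_le a b).trans ?_)
      exact mul_le_mul ha.le hb.le (norm_nonneg _) ((norm_nonneg a).trans ha.le)

noncomputable instance : StarRing I.Quotient where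
  star_involutive x := by
    obtain ⟨x, rfl⟩ := I.proj_surjective x
    simp only [← proj_star, star_star]
  star_mul x y := by
    obtain ⟨x, rfl⟩ := I.proj_surjective x
    obtain ⟨y, rfl⟩ := I.proj_surjective y
    simp only [← proj_star, ← proj_mul, star_mul]
  star_add x y := by
    obtain ⟨x, rfl⟩ := I.proj_surjective x
    obtain ⟨y, rfl⟩ := I.proj_surjective y
    simp only [← proj_star, ← map_add, star_add]

instance : IsScalarTower ℂ I.Quotient I.Quotient where
  smul_assoc c x y := by
    obtain ⟨x, rfl⟩ := I.proj_surjective x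
    obtain ⟨y, rfl⟩ := I.proj_surjective y
    simp only [smul_eq_mul, ← proj_mul, ← map_smul, smul_mul_assoc]

instance : SMulCommClass ℂ I.Quotient I.Quotient where
  smul_comm c x y := by
    obtain ⟨x, rfl⟩ := I.proj_surjective x
    obtain ⟨y, rfl⟩ := I.proj_surjective y
    simp only [smul_eq_mul, ← proj_mul, ← map_smul, mul_smul_comm]

instance : StarModule ℂ I.Quotient where
  star_smul c x := by
    obtain ⟨x, rfl⟩ := I.proj_surjective x
    simp only [← proj_star, ← map_smul, star_smul]

open Filter Topology in
/-- The key estimate for the C⋆-identity in the quotient. -/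
lemma norm_proj_mul_self_le (a b : A) (hb : b ∈ I) :
    ‖I.proj a‖ * ‖I.proj a‖ ≤ ‖star a * a + b‖ := by
  let _ := CStarAlgebra.spectralOrder I
  have _ := CStarAlgebra.spectralOrderedRing I
  let _ := CStarAlgebra.spectralOrder (Unitization ℂ A)
  have _ := CStarAlgebra.spectralOrderedRing (Unitization ℂ A)
  have hl := CStarAlgebra.increasingApproximateUnit I
  have hne : (CStarAlgebra.approximateUnit I).NeBot := hl.neBot
  set b' : I := ⟨b, hb⟩ with hb'
  have ht : Tendsto (fun e : I => ‖star a * a + b‖ + ‖b' - e * b'‖)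
      (CStarAlgebra.approximateUnit I) (𝓝 (‖star a * a + b‖ + ‖b' - b'‖)) :=
    tendsto_const_nhds.add ((tendsto_const_nhds.sub (hl.tendsto_mul_right b')).norm)
  rw [sub_self, norm_zero, add_zero] at ht
  refine ge_of_tendsto ht ?_
  filter_upwards [hl.eventually_nonneg, hl.eventually_norm] with e he₀ he₁
  have hstar : star (e : A) = e := congrArg Subtype.val (IsSelfAdjoint.of_nonneg he₀).star_eq
  obtain ⟨c, hc⟩ := CStarAlgebra.nonneg_iff_eq_star_mul_self.mp he₀
  let E : Unitization ℂ A := ((e : A) : Unitization ℂ A)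
  let B : Unitization ℂ A := ((b : A) : Unitization ℂ A)
  let a' : Unitization ℂ A := ((a : A) : Unitization ℂ A)
  have hE₀ : 0 ≤ E := by
    have : E = star (((c : A) : Unitization ℂ A)) * ((c : A) : Unitization ℂ A) := by
      simp only [E, hc]
      rw [← Unitization.inr_star, ← Unitization.inr_mul]
      rfl
    rw [this]
    exact star_mul_self_nonneg _
  have hE₁ : ‖E‖ ≤ 1 := by
    simp only [E]
    rw [Unitization.norm_inr]
    exact he₁
  have hE : 1 - E ∈ Set.Icc 0 1 :=
    Set.sub_mem_Icc_zero_iff_right.mpr (CStarAlgebra.mem_Icc_iff_norm_le_one.mpr ⟨hE₀, hE₁⟩)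
  have hE' : ‖1 - E‖ ≤ 1 := (CStarAlgebra.mem_Icc_iff_norm_le_one.mp hE).2
  have hEs : star (1 - E) = 1 - E := (IsSelfAdjoint.of_nonneg hE.1).star_eq
  have h1 : ‖I.proj a‖ ≤ ‖a' * (1 - E)‖ := by
    have : I.proj a = I.proj (a - a * e) := by
      rw [proj_eq_proj_iff]
      rw [sub_sub_cancel]
      exact I.mul_mem_left' a e.2
    rw [this]
    refine (I.norm_proj_le _).trans_eq ?_
    rw [← Unitization.norm_inr (𝕜 := ℂ)]
    congr 1
    simp [a', E, mul_sub]
  have h2 : ‖(1 - E) * B‖ = ‖b' - e * b'‖ := by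
    have : (1 - E) * B = ((b - e * b : A) : Unitization ℂ A) := by
      simp [E, B, sub_mul]
    rw [this, Unitization.norm_inr]
    rfl
  have h3 : ‖star a' * a' + B‖ = ‖star a * a + b‖ := by
    have : star a' * a' + B = ((star a * a + b : A) : Unitization ℂ A) := by
      simp [a', B]
    rw [this, Unitization.norm_inr]
  have h4 : star (a' * (1 - E)) * (a' * (1 - E)) =
      (1 - E) * (star a' * a' + B) * (1 - E) - (1 - E) * B * (1 - E) := by
    rw [star_mul, hEs]
    noncomm_ring
  calc ‖I.proj a‖ * ‖I.proj a‖ ≤ ‖a' * (1 - E)‖ * ‖a' * (1 - E)‖ := by gcongr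
    _ = ‖(1 - E) * (star a' * a' + B) * (1 - E) - (1 - E) * B * (1 - E)‖ := by
      rw [← CStarRing.norm_star_mul_self, h4]
    _ ≤ ‖(1 - E) * (star a' * a' + B) * (1 - E)‖ + ‖(1 - E) * B * (1 - E)‖ := norm_sub_le _ _
    _ ≤ 1 * ‖star a' * a' + B‖ * 1 + ‖(1 - E) * B‖ * 1 := by
      gcongr
      · refine (norm_mul_le _ _).trans ?_
        gcongr
        refine (norm_mul_le _ _).trans ?_
        gcongr
      · refine (norm_mul_le _ _).trans ?_
        gcongr
    _ = ‖star a * a + b‖ + ‖b' - e * b'‖ := by rw [h2, h3, one_mul, mul_one, mul_one]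

instance : CStarRing I.Quotient where
  norm_mul_self_le x := by
    obtain ⟨a, rfl⟩ := I.proj_surjective x
    refine le_of_forall_pos_le_add fun ε hε => ?_
    obtain ⟨d, hd, hlt⟩ := I.exists_norm_lt (star (I.proj a) * I.proj a) hε
    rw [← proj_star, ← proj_mul, proj_eq_proj_iff] at hd
    have := I.norm_proj_mul_self_le a _ hd
    rw [add_sub_cancel] at this
    exact this.trans hlt.le

noncomputable instance : NonUnitalCStarAlgebra I.Quotient where

/-- For ideals `I`, `J` of `A`, the ideal `I ∩ J` of the C⋆-algebra `J`. -/
def restrict (I J : ClosedIdeal A) : ClosedIdeal J where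
  carrier := {x : J | (x : A) ∈ I}
  add_mem' hx hy := add_mem (S := ClosedIdeal A) hx hy
  zero_mem' := zero_mem (S := ClosedIdeal A) I
  smul_mem' c _ hx := I.smul_mem' c hx
  mul_mem_left' a _ hx := I.mul_mem_left' a hx
  mul_mem_right' a _ hx := I.mul_mem_right' a hx
  star_mem' hx := I.star_mem' hx
  isClosed' := I.isClosed'.preimage continuous_subtype_val

/-- The C⋆-algebra `J / I` for ideals `I ⊆ J` of `A` (in general, this is `J / (I ∩ J)`). -/
abbrev Subquotient (J I : ClosedIdeal A) : Type u := (I.restrict J).Quotient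

end ClosedIdeal

/-! ### The algebra of compact operators -/

section Compact

variable {H : Type u} [NormedAddCommGroup H] [InnerProductSpace ℂ H] [CompleteSpace H]

lemma isCompactOperator_star {T : H →L[ℂ] H} (hT : IsCompactOperator T) :
    IsCompactOperator (star T : H →L[ℂ] H) := by
  have hTT : IsCompactOperator (T * star T : H →L[ℂ] H) := hT.comp_clm (star T : H →L[ℂ] H)
  refine (isCompactOperator_iff_isCompact_closure_image_closedBall
    ((star T : H →L[ℂ] H) : H →ₗ[ℂ] H) zero_lt_one).mpr ?_
  refine TotallyBounded.isCompact_of_isClosed (TotallyBounded.closure ?_) isClosed_closure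
  have hK : TotallyBounded ((T * star T : H →L[ℂ] H) '' Metric.closedBall 0 1) :=
    ((hTT.isCompact_closure_image_closedBall
      (f := ((T * star T : H →L[ℂ] H) : H →ₗ[ℂ] H)) 1).totallyBounded).subset subset_closure
  rw [Metric.totallyBounded_iff] at hK ⊢
  intro ε hε
  have hδ : 0 < ε ^ 2 / 4 := by positivity
  obtain ⟨t, hts, ht, hcov⟩ := totallyBounded_iff_subset.mp
    (Metric.totallyBounded_iff.mpr hK) _ (Metric.dist_mem_uniformity hδ)
  have hts' : ∀ y, ∃ x, y ∈ t → x ∈ Metric.closedBall (0 : H) 1 ∧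
      (T * star T : H →L[ℂ] H) x = y := fun y => by
    by_cases hy : y ∈ t
    · obtain ⟨x, hx, hxy⟩ := hts hy
      exact ⟨x, fun _ => ⟨hx, hxy⟩⟩
    · exact ⟨0, fun h => absurd h hy⟩
  choose g hg using hts'
  refine ⟨(fun y => (star T : H →L[ℂ] H) (g y)) '' t, ht.image _, ?_⟩
  rintro _ ⟨x, hx, rfl⟩
  have := hcov ⟨x, hx, rfl⟩
  simp only [Set.mem_iUnion, Set.mem_ofPred_eq] at this ⊢
  obtain ⟨y, hy, hxy⟩ := this
  refine ⟨_, ⟨y, hy, rfl⟩, ?_⟩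
  obtain ⟨hgy, hgy'⟩ := hg y hy
  rw [Metric.mem_ball, dist_eq_norm]
  change ‖(star T : H →L[ℂ] H) x - (star T : H →L[ℂ] H) (g y)‖ < ε
  rw [← map_sub]
  set z := x - g y with hz
  have hz2 : ‖z‖ ≤ 2 := by
    rw [mem_closedBall_zero_iff] at hx hgy
    exact (norm_sub_le _ _).trans (by linarith)
  have hTz : ‖(T * star T : H →L[ℂ] H) z‖ < ε ^ 2 / 4 := by
    rw [hz, map_sub, hgy', ← dist_eq_norm]
    exact hxy
  have hin : ‖(star T : H →L[ℂ] H) z‖ ^ 2 ≤ ‖(T * star T : H →L[ℂ] H) z‖ * ‖z‖ := by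
    have h1 : inner ℂ ((T * star T : H →L[ℂ] H) z) z =
        inner ℂ ((star T : H →L[ℂ] H) z) ((star T : H →L[ℂ] H) z) := by
      rw [ContinuousLinearMap.star_eq_adjoint]
      exact (ContinuousLinearMap.adjoint_inner_right T _ _).symm
    have h2 := norm_inner_le_norm (𝕜 := ℂ) ((T * star T : H →L[ℂ] H) z) z
    rw [h1, inner_self_eq_norm_sq_to_K, norm_pow, RCLike.norm_ofReal, abs_norm] at h2
    exact h2
  have : ‖(star T : H →L[ℂ] H) z‖ ^ 2 < ε ^ 2 := by nlinarith [norm_nonneg z]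
  exact lt_of_pow_lt_pow_left₀ 2 hε.le this

variable (H) in
/-- The C⋆-algebra `𝓚(H)` of compact operators on the Hilbert space `H`. -/
noncomputable def compactOperators : NonUnitalStarSubalgebra ℂ (H →L[ℂ] H) where
  carrier := {T | IsCompactOperator T}
  add_mem' hS hT := IsCompactOperator.add hS hT
  zero_mem' := isCompactOperator_zero
  mul_mem' {_ T} hS _ := IsCompactOperator.comp_clm hS T
  smul_mem' c _ hT := IsCompactOperator.smul hT c
  star_mem' hT := isCompactOperator_star hT

instance : IsClosed (compactOperators H : Set (H →L[ℂ] H)) :=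
  isClosed_setOfPred_isCompactOperator

end Compact

/-- The C⋆-algebra `𝓚(ℓ₂)`, where `ℓ₂ = ℓ₂(ℕ)` is the complex sequence space. -/
abbrev KEllTwo : Type := compactOperators (lp (fun _ : ℕ => ℂ) 2)

/-! ### The C⋆-tensor product -/

section Tensor

variable (A : Type u) (B : Type v) [NonUnitalCStarAlgebra A] [NonUnitalCStarAlgebra B]

/-- The C⋆-seminorms on the algebraic tensor product of two C⋆-algebras. (The inequality
`p (a ⊗ b) ≤ ‖a‖ ‖b‖` is automatic for C⋆-seminorms; it is recorded as a field.) -/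
structure CStarSeminorm extends Seminorm ℂ (A ⊗[ℂ] B) where
  mul_le' : ∀ x y, toFun (x * y) ≤ toFun x * toFun y
  star_mul_self' : ∀ x, toFun (star x * x) = toFun x * toFun x
  tmul_le' : ∀ a b, toFun (a ⊗ₜ[ℂ] b) ≤ ‖a‖ * ‖b‖

variable {A B}

noncomputable instance : Inhabited (CStarSeminorm A B) where
  default := { (0 : Seminorm ℂ (A ⊗[ℂ] B)) with
    mul_le' := fun _ _ => by change (0 : ℝ) ≤ 0 * 0; simp
    star_mul_self' := fun _ => by change (0 : ℝ) = 0 * 0; simp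
    tmul_le' := fun a b => by change (0 : ℝ) ≤ _; positivity }

lemma CStarSeminorm.bddAbove (x : A ⊗[ℂ] B) :
    BddAbove (Set.range fun p : CStarSeminorm A B => p.toSeminorm x) := by
  induction x with
  | zero => exact ⟨0, by rintro _ ⟨p, rfl⟩; simp⟩
  | tmul a b => exact ⟨‖a‖ * ‖b‖, by rintro _ ⟨p, rfl⟩; exact p.tmul_le' a b⟩
  | add x y hx hy =>
    obtain ⟨c, hc⟩ := hx
    obtain ⟨d, hd⟩ := hy
    refine ⟨c + d, ?_⟩
    rintro _ ⟨p, rfl⟩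
    exact (map_add_le_add p.toSeminorm x y).trans (add_le_add (hc ⟨p, rfl⟩) (hd ⟨p, rfl⟩))

/-- The largest C⋆-seminorm on the algebraic tensor product. -/
noncomputable def maxNorm (x : A ⊗[ℂ] B) : ℝ := ⨆ p : CStarSeminorm A B, p.toSeminorm x

lemma CStarSeminorm.le_maxNorm (p : CStarSeminorm A B) (x : A ⊗[ℂ] B) :
    p.toSeminorm x ≤ maxNorm x :=
  le_ciSup (CStarSeminorm.bddAbove x) p

lemma maxNorm_nonneg (x : A ⊗[ℂ] B) : 0 ≤ maxNorm x :=
  Real.iSup_nonneg fun p => apply_nonneg p.toSeminorm x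

lemma maxNorm_add_le (x y : A ⊗[ℂ] B) : maxNorm (x + y) ≤ maxNorm x + maxNorm y :=
  ciSup_le fun p => (map_add_le_add p.toSeminorm x y).trans
    (add_le_add (p.le_maxNorm x) (p.le_maxNorm y))

lemma maxNorm_mul_le (x y : A ⊗[ℂ] B) : maxNorm (x * y) ≤ maxNorm x * maxNorm y :=
  ciSup_le fun p => (p.mul_le' x y).trans
    (mul_le_mul (p.le_maxNorm x) (p.le_maxNorm y) (apply_nonneg p.toSeminorm y)
      (maxNorm_nonneg x))

lemma maxNorm_smul (c : ℂ) (x : A ⊗[ℂ] B) : maxNorm (c • x) = ‖c‖ * maxNorm x := by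
  simp only [maxNorm, map_smul_eq_mul]
  exact (Real.mul_iSup_of_nonneg (norm_nonneg c) _).symm

lemma maxNorm_sq_le (x : A ⊗[ℂ] B) : maxNorm x * maxNorm x ≤ maxNorm (star x * x) := by
  rw [← sq]
  refine (Real.le_sqrt (maxNorm_nonneg x) (maxNorm_nonneg _)).mp ?_
  refine ciSup_le fun p => (Real.le_sqrt (apply_nonneg _ _) (maxNorm_nonneg _)).mpr ?_
  rw [sq]
  exact (p.star_mul_self' x).symm.le.trans (p.le_maxNorm _)

variable (A B)

/-- The algebraic tensor product, equipped with its largest C⋆-seminorm. -/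
def AlgTensor : Type max u v := A ⊗[ℂ] B

namespace AlgTensor

instance : AddCommGroup (AlgTensor A B) := inferInstanceAs (AddCommGroup (A ⊗[ℂ] B))

instance : Module ℂ (AlgTensor A B) := inferInstanceAs (Module ℂ (A ⊗[ℂ] B))

noncomputable instance : NonUnitalRing (AlgTensor A B) :=
  inferInstanceAs (NonUnitalRing (A ⊗[ℂ] B))

noncomputable instance : StarRing (AlgTensor A B) :=
  inferInstanceAs (StarRing (A ⊗[ℂ] B))

instance : StarModule ℂ (AlgTensor A B) := inferInstanceAs (StarModule ℂ (A ⊗[ℂ] B))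

instance : IsScalarTower ℂ (AlgTensor A B) (AlgTensor A B) :=
  inferInstanceAs (IsScalarTower ℂ (A ⊗[ℂ] B) (A ⊗[ℂ] B))

instance : SMulCommClass ℂ (AlgTensor A B) (AlgTensor A B) :=
  inferInstanceAs (SMulCommClass ℂ (A ⊗[ℂ] B) (A ⊗[ℂ] B))

noncomputable instance : SeminormedAddCommGroup (AlgTensor A B) :=
  AddGroupSeminorm.toSeminormedAddCommGroup
    { toFun := fun x => maxNorm (A := A) (B := B) x
      map_zero' := by
        have := maxNorm_smul (A := A) (B := B) 0 0
        rwa [norm_zero, zero_mul, zero_smul] at this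
      add_le' := maxNorm_add_le
      neg' := fun x => by
        have := maxNorm_smul (A := A) (B := B) (-1) x
        rw [norm_neg, norm_one, one_mul] at this
        exact (congrArg maxNorm (neg_one_smul ℂ (x : A ⊗[ℂ] B))).symm.trans this }

lemma norm_def (x : AlgTensor A B) : ‖x‖ = maxNorm (A := A) (B := B) x := rfl

noncomputable instance : NormedSpace ℂ (AlgTensor A B) where
  norm_smul_le c x := (maxNorm_smul (A := A) (B := B) c x).le

noncomputable instance : NonUnitalSeminormedRing (AlgTensor A B) where
  __ := (inferInstance : NonUnitalRing (AlgTensor A B))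
  __ := (inferInstance : SeminormedAddCommGroup (AlgTensor A B))
  norm_mul_le := maxNorm_mul_le (A := A) (B := B)

lemma norm_sq_le (x : AlgTensor A B) : ‖x‖ * ‖x‖ ≤ ‖star x * x‖ :=
  maxNorm_sq_le (A := A) (B := B) x

instance : NormedStarGroup (AlgTensor A B) where
  norm_star_le x := by
    by_contra! h
    have h1 := norm_sq_le A B (star x)
    rw [star_star] at h1
    have h2 := norm_mul_le x (star x)
    nlinarith [norm_nonneg x]

end AlgTensor

/-- The C⋆-tensor product `A ⊗ B`: the completion of the algebraic tensor product in its largest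
C⋆-norm. -/
def CStarTensor : Type max u v := UniformSpace.Completion (AlgTensor A B)

namespace CStarTensor

open UniformSpace UniformSpace.Completion

noncomputable instance : NormedAddCommGroup (CStarTensor A B) :=
  inferInstanceAs (NormedAddCommGroup (Completion (AlgTensor A B)))

noncomputable instance : NormedSpace ℂ (CStarTensor A B) :=
  inferInstanceAs (NormedSpace ℂ (Completion (AlgTensor A B)))

instance : CompleteSpace (CStarTensor A B) :=
  inferInstanceAs (CompleteSpace (Completion (AlgTensor A B)))

variable {A B}

/-- The canonical map of the algebraic tensor product into its completion. -/
noncomputable def ofAlg : AlgTensor A B →L[ℂ] CStarTensor A B :=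
  toComplL (𝕜 := ℂ) (E := AlgTensor A B)

lemma norm_ofAlg (x : AlgTensor A B) : ‖ofAlg x‖ = ‖x‖ := norm_coe x

lemma isDenseInducing_ofAlg : IsDenseInducing (ofAlg : AlgTensor A B → CStarTensor A B) :=
  isDenseInducing_coe

lemma denseRange_ofAlg : DenseRange (ofAlg : AlgTensor A B → CStarTensor A B) :=
  denseRange_coe

/-- The multiplication of `A ⊗ B`, extended by continuity from the algebraic tensor product. -/
@[irreducible]
noncomputable def mulAux (x y : CStarTensor A B) : CStarTensor A B :=
  (isDenseInducing_ofAlg.prodMap isDenseInducing_ofAlg).extend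
    (fun p : AlgTensor A B × AlgTensor A B => ofAlg (p.1 * p.2)) (x, y)

noncomputable instance : Mul (CStarTensor A B) where
  mul := mulAux

lemma ofAlg_mul (x y : AlgTensor A B) : ofAlg (x * y) = ofAlg x * ofAlg y := by
  change _ = mulAux (ofAlg x) (ofAlg y)
  rw [mulAux]
  exact ((isDenseInducing_ofAlg.prodMap isDenseInducing_ofAlg).extend_eq
    (ofAlg.continuous.comp continuous_mul) (x, y)).symm

instance : ContinuousMul (CStarTensor A B) where
  continuous_mul := by
    let m : AlgTensor A B →+ AlgTensor A B →+ CStarTensor A B :=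
      (AddMonoidHom.mul : AlgTensor A B →+ AlgTensor A B →+ AlgTensor A B).compr₂
        (ofAlg : AlgTensor A B →L[ℂ] CStarTensor A B).toLinearMap.toAddMonoidHom
    have : Continuous fun p : AlgTensor A B × AlgTensor A B => m p.1 p.2 :=
      ofAlg.continuous.comp continuous_mul
    have di : IsDenseInducing (toCompl : AlgTensor A B → Completion (AlgTensor A B)) :=
      isDenseInducing_coe
    change Continuous fun p : CStarTensor A B × CStarTensor A B => mulAux p.1 p.2
    simp only [mulAux]
    exact (di.extend_Z_bilin di this :)

/-- The involution of `A ⊗ B`, extended by continuity from the algebraic tensor product. -/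
@[irreducible]
noncomputable def starAux : CStarTensor A B → CStarTensor A B :=
  Completion.map (star : AlgTensor A B → AlgTensor A B)

noncomputable instance : Star (CStarTensor A B) where
  star := starAux

lemma ofAlg_star (x : AlgTensor A B) : ofAlg (star x) = star (ofAlg x) := by
  change _ = starAux (ofAlg x)
  rw [starAux]
  exact (Completion.map_coe (starₗᵢ ℂ (E := AlgTensor A B)).isometry.uniformContinuous x).symm

instance : ContinuousStar (CStarTensor A B) where
  continuous_star := by
    change Continuous (starAux (A := A) (B := B))
    unfold starAux
    exact Completion.continuous_map

lemma induction_on {p : CStarTensor A B → Prop} (x : CStarTensor A B)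
    (hp : IsClosed {x | p x}) (ih : ∀ x : AlgTensor A B, p (ofAlg x)) : p x :=
  Completion.induction_on x hp ih

lemma continuous_mul_right_aux (y : CStarTensor A B) :
    Continuous fun x : CStarTensor A B => x * y := continuous_mul_const y

lemma continuous_mul_left_aux (x : CStarTensor A B) :
    Continuous fun y : CStarTensor A B => x * y := continuous_const_mul x

lemma left_distrib_aux (x y z : CStarTensor A B) : x * (y + z) = x * y + x * z := by
  induction x using induction_on with
  | hp =>
    exact isClosed_eq (by exact continuous_mul_right_aux (A := A) (B := B) _)
      (by exact (continuous_mul_right_aux (A := A) (B := B) _).add (continuous_mul_right_aux (A := A) (B := B) _))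
  | ih x =>
  induction y using induction_on with
  | hp =>
    exact isClosed_eq (by exact (continuous_mul_left_aux (A := A) (B := B) _).comp (continuous_add_const z))
      (by exact (continuous_mul_left_aux (A := A) (B := B) _).add continuous_const)
  | ih y =>
  induction z using induction_on with
  | hp =>
    exact isClosed_eq (by exact (continuous_mul_left_aux (A := A) (B := B) _).comp (continuous_const_add _))
      (by exact continuous_const.add (continuous_mul_left_aux (A := A) (B := B) _))
  | ih z => simp only [← ofAlg_mul, ← map_add, mul_add]

lemma right_distrib_aux (x y z : CStarTensor A B) : (x + y) * z = x * z + y * z := by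
  induction x using induction_on with
  | hp =>
    exact isClosed_eq (by exact (continuous_mul_right_aux (A := A) (B := B) _).comp (continuous_add_const _))
      (by exact (continuous_mul_right_aux (A := A) (B := B) _).add continuous_const)
  | ih x =>
  induction y using induction_on with
  | hp =>
    exact isClosed_eq (by exact (continuous_mul_right_aux (A := A) (B := B) _).comp (continuous_const_add _))
      (by exact continuous_const.add (continuous_mul_right_aux (A := A) (B := B) _))
  | ih y =>
  induction z using induction_on with
  | hp =>
    exact isClosed_eq (by exact continuous_mul_left_aux (A := A) (B := B) _)
      (by exact (continuous_mul_left_aux (A := A) (B := B) _).add (continuous_mul_left_aux (A := A) (B := B) _))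
  | ih z => simp only [← ofAlg_mul, ← map_add, add_mul]

lemma zero_mul_aux (x : CStarTensor A B) : 0 * x = 0 := by
  induction x using induction_on with
  | hp =>
    exact isClosed_eq (by exact continuous_mul_left_aux (A := A) (B := B) _)
      (by exact continuous_const)
  | ih x => rw [← map_zero ofAlg, ← ofAlg_mul, zero_mul]

lemma mul_zero_aux (x : CStarTensor A B) : x * 0 = 0 := by
  induction x using induction_on with
  | hp =>
    exact isClosed_eq (by exact continuous_mul_right_aux (A := A) (B := B) _)
      (by exact continuous_const)
  | ih x => rw [← map_zero ofAlg, ← ofAlg_mul, mul_zero]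

lemma mul_assoc_aux (x y z : CStarTensor A B) : x * y * z = x * (y * z) := by
  induction x using induction_on with
  | hp =>
    exact isClosed_eq (by exact (continuous_mul_right_aux (A := A) (B := B) z).comp (continuous_mul_right_aux (A := A) (B := B) y))
      (by exact continuous_mul_right_aux (A := A) (B := B) (y * z))
  | ih x =>
  induction y using induction_on with
  | hp =>
    exact isClosed_eq (by exact (continuous_mul_right_aux (A := A) (B := B) z).comp (continuous_mul_left_aux (A := A) (B := B) _))
      (by exact (continuous_mul_left_aux (A := A) (B := B) _).comp (continuous_mul_right_aux (A := A) (B := B) z))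
  | ih y =>
  induction z using induction_on with
  | hp =>
    exact isClosed_eq (by exact continuous_mul_left_aux (A := A) (B := B) _)
      (by exact (continuous_mul_left_aux (A := A) (B := B) _).comp (continuous_mul_left_aux (A := A) (B := B) _))
  | ih z => simp only [← ofAlg_mul, mul_assoc]

noncomputable instance : NonUnitalRing (CStarTensor A B) where
  __ := (inferInstance : AddCommGroup (CStarTensor A B))
  left_distrib := left_distrib_aux
  right_distrib := right_distrib_aux
  zero_mul := zero_mul_aux
  mul_zero := mul_zero_aux
  mul_assoc := mul_assoc_aux

lemma norm_mul_le' (x y : CStarTensor A B) : ‖x * y‖ ≤ ‖x‖ * ‖y‖ := by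
    induction x using induction_on with
    | hp => exact isClosed_le (by fun_prop) (by fun_prop)
    | ih x =>
    induction y using induction_on with
    | hp => exact isClosed_le (by fun_prop) (by fun_prop)
    | ih y =>
      rw [← ofAlg_mul, norm_ofAlg, norm_ofAlg, norm_ofAlg]
      exact norm_mul_le x y

noncomputable instance : NonUnitalNormedRing (CStarTensor A B) where
  __ := (inferInstance : NonUnitalRing (CStarTensor A B))
  __ := (inferInstance : NormedAddCommGroup (CStarTensor A B))
  norm_mul_le := norm_mul_le'

noncomputable instance : StarRing (CStarTensor A B) where
  star_involutive x := by
    induction x using induction_on with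
    | hp => exact isClosed_eq (by fun_prop) (by fun_prop)
    | ih x => rw [← ofAlg_star, ← ofAlg_star, star_star]
  star_mul x y := by
    induction x using induction_on with
    | hp => exact isClosed_eq (by fun_prop) (by fun_prop)
    | ih x =>
    induction y using induction_on with
    | hp => exact isClosed_eq (by fun_prop) (by fun_prop)
    | ih y => simp only [← ofAlg_star, ← ofAlg_mul, star_mul]
  star_add x y := by
    induction x using induction_on with
    | hp => exact isClosed_eq (by fun_prop) (by fun_prop)
    | ih x =>
    induction y using induction_on with
    | hp => exact isClosed_eq (by fun_prop) (by fun_prop)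
    | ih y => simp only [← ofAlg_star, ← map_add, star_add]

instance : CStarRing (CStarTensor A B) where
  norm_mul_self_le x := by
    induction x using induction_on with
    | hp => exact isClosed_le (by fun_prop) (by fun_prop)
    | ih x =>
      rw [← ofAlg_star, ← ofAlg_mul, norm_ofAlg, norm_ofAlg]
      exact AlgTensor.norm_sq_le A B x

lemma continuous_smul_aux (c : ℂ) :
    Continuous fun x : CStarTensor A B => c • x := continuous_const_smul c

instance : IsScalarTower ℂ (CStarTensor A B) (CStarTensor A B) where
  smul_assoc c x y := by
    simp only [smul_eq_mul]
    induction x using induction_on with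
    | hp =>
      exact isClosed_eq (by exact (continuous_mul_right_aux (A := A) (B := B) y).comp (continuous_smul_aux (A := A) (B := B) c))
        (by exact (continuous_smul_aux (A := A) (B := B) c).comp (continuous_mul_right_aux (A := A) (B := B) y))
    | ih x =>
    induction y using induction_on with
    | hp =>
      exact isClosed_eq (by exact continuous_mul_left_aux (A := A) (B := B) _)
        (by exact (continuous_smul_aux (A := A) (B := B) c).comp (continuous_mul_left_aux (A := A) (B := B) _))
    | ih y => simp only [← ofAlg_mul, ← map_smul, smul_mul_assoc]

instance : SMulCommClass ℂ (CStarTensor A B) (CStarTensor A B) where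
  smul_comm c x y := by
    simp only [smul_eq_mul]
    induction x using induction_on with
    | hp =>
      exact isClosed_eq (by exact (continuous_smul_aux (A := A) (B := B) c).comp (continuous_mul_right_aux (A := A) (B := B) y))
        (by exact continuous_mul_right_aux (A := A) (B := B) (c • y))
    | ih x =>
    induction y using induction_on with
    | hp =>
      exact isClosed_eq (by exact (continuous_smul_aux (A := A) (B := B) c).comp (continuous_mul_left_aux (A := A) (B := B) _))
        (by exact (continuous_mul_left_aux (A := A) (B := B) _).comp (continuous_smul_aux (A := A) (B := B) c))
    | ih y => simp only [← ofAlg_mul, ← map_smul, mul_smul_comm]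

instance : StarModule ℂ (CStarTensor A B) where
  star_smul c x := by
    induction x using induction_on with
    | hp =>
      exact isClosed_eq (by exact continuous_star.comp (continuous_smul_aux (A := A) (B := B) c))
        (by exact (continuous_smul_aux (A := A) (B := B) (star c)).comp continuous_star)
    | ih x => simp only [← ofAlg_star, ← map_smul, star_smul]

noncomputable instance : NonUnitalCStarAlgebra (CStarTensor A B) where

/-- The elementary tensor `a ⊗ b` in `A ⊗ B`. -/
noncomputable def tmul (a : A) (b : B) : CStarTensor A B :=
  ofAlg ((a ⊗ₜ[ℂ] b : A ⊗[ℂ] B) : AlgTensor A B)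

lemma tmul_mul_tmul (a a' : A) (b b' : B) :
    tmul a b * tmul a' b' = tmul (a * a') (b * b') := by
  refine (ofAlg_mul (A := A) (B := B) (a ⊗ₜ[ℂ] b : A ⊗[ℂ] B) (a' ⊗ₜ[ℂ] b' : A ⊗[ℂ] B)).symm.trans ?_
  exact congrArg (ofAlg (A := A) (B := B)) (Algebra.TensorProduct.tmul_mul_tmul a a' b b')

lemma star_tmul (a : A) (b : B) : star (tmul a b) = tmul (star a) (star b) := by
  exact (ofAlg_star (A := A) (B := B) (a ⊗ₜ[ℂ] b : A ⊗[ℂ] B)).symm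

lemma dense_span_tmul :
    Dense ((Submodule.span ℂ {x : CStarTensor A B | ∃ (a : A) (b : B), x = tmul a b} :
      Submodule ℂ (CStarTensor A B)) : Set (CStarTensor A B)) := by
  refine denseRange_ofAlg.mono ?_
  rintro _ ⟨x, rfl⟩
  refine TensorProduct.induction_on (motive := fun x : A ⊗[ℂ] B =>
    ofAlg (x : AlgTensor A B) ∈
      Submodule.span ℂ {x : CStarTensor A B | ∃ (a : A) (b : B), x = tmul a b}) x ?_ ?_ ?_
  · exact (map_zero (ofAlg : AlgTensor A B →L[ℂ] CStarTensor A B)).symm ▸ Submodule.zero_mem _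
  · exact fun a b => Submodule.subset_span ⟨a, b, rfl⟩
  · intro x y hx hy
    have := Submodule.add_mem _ hx hy
    exact (map_add (ofAlg : AlgTensor A B →L[ℂ] CStarTensor A B) x y).symm ▸ this

end CStarTensor

open CStarTensor in
/-- For an ideal `I` of `A`, the ideal `I ⊗ B` of `A ⊗ B`: the closed linear span of the elementary
tensors `x ⊗ b` with `x ∈ I` and `b ∈ B`. -/
noncomputable def ClosedIdeal.tensor {A : Type u} [NonUnitalCStarAlgebra A] (I : ClosedIdeal A)
    (B : Type v) [NonUnitalCStarAlgebra B] : ClosedIdeal (CStarTensor A B) where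
  toSubmodule := (Submodule.span ℂ
    {t : CStarTensor A B | ∃ x ∈ I, ∃ b : B, t = tmul x b}).topologicalClosure
  mul_mem_left' a t ht := by
    set N := (Submodule.span ℂ
      {t : CStarTensor A B | ∃ x ∈ I, ∃ b : B, t = tmul x b}).topologicalClosure with hN
    have hNc : IsClosed (N : Set (CStarTensor A B)) := Submodule.isClosed_topologicalClosure _
    have key : N ≤ N.comap (LinearMap.mulLeft ℂ a) := by
      refine Submodule.topologicalClosure_minimal _ (Submodule.span_le.mpr ?_)
        (hNc.preimage (continuous_const_mul a))
      rintro _ ⟨x, hx, b, rfl⟩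
      have h2 : (⊤ : Submodule ℂ (CStarTensor A B)) ≤ N.comap (LinearMap.mulRight ℂ (tmul x b)) := by
        rw [← Submodule.dense_iff_topologicalClosure_eq_top.mp (dense_span_tmul (A := A) (B := B))]
        refine Submodule.topologicalClosure_minimal _ (Submodule.span_le.mpr ?_)
          (hNc.preimage (continuous_mul_const (tmul x b)))
        rintro _ ⟨a', b', rfl⟩
        refine Submodule.le_topologicalClosure _ (Submodule.subset_span ?_)
        exact ⟨a' * x, I.mul_mem_left' a' hx, b' * b, tmul_mul_tmul _ _ _ _⟩
      exact h2 (Submodule.mem_top (x := a))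
    exact key ht
  mul_mem_right' a t ht := by
    set N := (Submodule.span ℂ
      {t : CStarTensor A B | ∃ x ∈ I, ∃ b : B, t = tmul x b}).topologicalClosure with hN
    have hNc : IsClosed (N : Set (CStarTensor A B)) := Submodule.isClosed_topologicalClosure _
    have key : N ≤ N.comap (LinearMap.mulRight ℂ a) := by
      refine Submodule.topologicalClosure_minimal _ (Submodule.span_le.mpr ?_)
        (hNc.preimage (continuous_mul_const a))
      rintro _ ⟨x, hx, b, rfl⟩
      have h2 : (⊤ : Submodule ℂ (CStarTensor A B)) ≤ N.comap (LinearMap.mulLeft ℂ (tmul x b)) := by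
        rw [← Submodule.dense_iff_topologicalClosure_eq_top.mp (dense_span_tmul (A := A) (B := B))]
        refine Submodule.topologicalClosure_minimal _ (Submodule.span_le.mpr ?_)
          (hNc.preimage (continuous_const_mul (tmul x b)))
        rintro _ ⟨a', b', rfl⟩
        refine Submodule.le_topologicalClosure _ (Submodule.subset_span ?_)
        exact ⟨x * a', I.mul_mem_right' a' hx, b * b', tmul_mul_tmul _ _ _ _⟩
      exact h2 (Submodule.mem_top (x := a))
    exact key ht
  star_mem' {t} ht := by
    set S := Submodule.span ℂ {t : CStarTensor A B | ∃ x ∈ I, ∃ b : B, t = tmul x b} with hS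
    have key : ∀ s ∈ S, star s ∈ S := by
      intro s hs
      induction hs using Submodule.span_induction with
      | mem s hs =>
        obtain ⟨x, hx, b, rfl⟩ := hs
        exact Submodule.subset_span ⟨star x, I.star_mem' hx, star b, star_tmul x b⟩
      | zero => rw [star_zero]; exact Submodule.zero_mem _
      | add x y _ _ hx hy => rw [star_add]; exact Submodule.add_mem _ hx hy
      | smul c x _ hx => rw [star_smul]; exact Submodule.smul_mem _ _ hx
    exact map_mem_closure continuous_star ht key
  isClosed' := Submodule.isClosed_topologicalClosure _

end Tensor

/-! ### Cantor–Bendixson sequences -/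

/-- `(I α)_{α ≤ ht}` is the Cantor–Bendixson sequence of `A`, and `ht` its Cantor–Bendixson height:
a strictly increasing continuous sequence of closed ideals from `0` to `A` with
`𝓘ᴬᵗ(A / I α) = {[a] : a ∈ I (α + 1)}` for all `α < ht`. (Only the values `I α` with `α ≤ ht`
matter.) -/
structure IsCantorBendixsonSequence (A : Type u) [NonUnitalCStarAlgebra A] (ht : Ordinal.{u})
    (I : Ordinal.{u} → ClosedIdeal A) : Prop where
  zero : (I 0 : Set A) = {0}
  height : (I ht : Set A) = Set.univ
  strictMono : ∀ α β, α < β → β ≤ ht → (I α : Set A) ⊂ (I β : Set A)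
  limit : ∀ β ≤ ht, Order.IsSuccLimit β → (I β : Set A) = closure (⋃ α < β, (I α : Set A))
  succ : ∀ α < ht,
    (atomicPart (I α).Quotient : Set (I α).Quotient) = (I α).proj '' (I (α + 1) : Set A)

end ScatteredCStar

open ScatteredCStar

/-! The bridge between scatteredness and Cantor–Bendixson sequences is spectral: a C⋆-algebra is
scattered iff no self-adjoint element has `[0,1]` in its quasispectrum (`NoIntervalSpectrum`), iff
it has a Cantor–Bendixson sequence. This is proved as a cycle.

Scattered algebras have no interval spectra, because the algebra generated by an element with
spectrum exactly `[0,1]` consists of functions on a connected set vanishing at `0`, so it has no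
nonzero projection (`IsScattered.noIntervalSpectrum`). The spectral condition passes to quotients
and forces a nonzero algebra to have a minimal projection: otherwise every nonzero projection
splits, and a dyadic tree of projections yields an element with spectrum containing `[0,1]`
(`not_noIntervalSpectrum_of_split`). Hence the ideals obtained by repeatedly pulling back the atomic
part of the quotient grow strictly until they exhaust `A`. Conversely, given a Cantor–Bendixson
sequence, take the least `α` at which a subalgebra `B` meets `I α` nontrivially. It is a successor
`β + 1`, and `B ∩ I (β + 1)` embeds into the atomic part of `A / I β`, whose self-adjoint elements
have no interval in their spectrum (`not_Icc_subset_of_mem_atomicIdeal`). So the intersection, an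
ideal of `B`, has a minimal projection, which is also minimal in `B`
(`IsCantorBendixsonSequence.isScattered`).

For the tensor product only the matrix units of `K = 𝓚(ℓ₂)` are used. The corner `a ↦ a ⊗ e 0 0` is
injective, since compressions to matrices over the unitization give a C⋆-seminorm that detects `a`.
Cutting by matrix units and approximate units shows that every closed ideal of `A ⊗ K` is `I ⊗ K`
for the ideal `I` it traces on the corner (`eq_tensor_comap_corner`). This correspondence gives `ker
(φ ⊗ id) = ker φ ⊗ K`, hence `(A ⊗ K) / (I ⊗ K) ≅ (A / I) ⊗ K`. It also matches atomic ideals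
(`atomicIdeal_eq_tensor`), since `p ⊗ e 0 0` is minimal exactly when `p` is. So `I ↦ I ⊗ K` commutes
with the derivation step and with closed suprema, and carries the Cantor–Bendixson sequence of `A`
to one of `A ⊗ K`. Scatteredness of `A ⊗ K` then follows from the converse half of the cycle, and
the equality of heights and ideals from uniqueness. -/

namespace ScatteredCStar

/-! ### Minimal projections and the atomic ideal -/

namespace IsMinimalProjection

variable {A : Type u} [NonUnitalCStarAlgebra A] {p : A}

lemma mul_self (hp : IsMinimalProjection p) : p * p = p := hp.isStarProjection.isIdempotentElem

lemma star_eq (hp : IsMinimalProjection p) : star p = p := hp.isStarProjection.isSelfAdjoint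

lemma exists_smul (hp : IsMinimalProjection p) (a : A) : ∃ c : ℂ, p * a * p = c • p := by
  have : p * a * p ∈ Set.range fun c : ℂ => c • p := hp.corner_eq ▸ ⟨a, rfl⟩
  obtain ⟨c, hc⟩ := this
  exact ⟨c, hc.symm⟩

lemma of_exists_smul (hp : IsStarProjection p) (h0 : p ≠ 0)
    (h : ∀ a : A, ∃ c : ℂ, p * a * p = c • p) : IsMinimalProjection p where
  isStarProjection := hp
  ne_zero := h0
  corner_eq := by
    have hpp : p * p = p := hp.isIdempotentElem
    refine Set.Subset.antisymm ?_ ?_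
    · rintro _ ⟨a, rfl⟩
      obtain ⟨c, hc⟩ := h a
      exact ⟨c, hc.symm⟩
    · rintro _ ⟨c, rfl⟩
      exact ⟨c • p, by simp only [mul_smul_comm, smul_mul_assoc, hpp]⟩

lemma smul_injective (hp : IsMinimalProjection p) {c d : ℂ} (h : c • p = d • p) : c = d := by
  have : (c - d) • p = 0 := by rw [sub_smul, h, sub_self]
  exact sub_eq_zero.mp ((smul_eq_zero.mp this).resolve_right hp.ne_zero)

/-- If `x = x * p` is nonzero with `p` minimal, then `x * star x` is a nonzero multiple of a minimal
projection. -/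
lemma exists_smul_mul_star (hp : IsMinimalProjection p) {x : A} (hx : x * p = x) (hx0 : x ≠ 0) :
    ∃ c : ℂ, c ≠ 0 ∧ ∃ q : A, IsMinimalProjection q ∧ x * star x = c • q := by
  have hpx : p * star x = star x := by
    conv_rhs => rw [← hx, star_mul, hp.star_eq]
  have hcor : ∀ b : A, ∃ d : ℂ, star x * b * x = d • p := by
    intro b
    obtain ⟨d, hd⟩ := hp.exists_smul (star x * b * x)
    refine ⟨d, ?_⟩
    rw [← hd]
    calc star x * b * x = (p * star x) * b * (x * p) := by rw [hpx, hx]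
      _ = _ := by noncomm_ring
  obtain ⟨c, hc⟩ : ∃ c : ℂ, star x * x = c • p := by
    obtain ⟨d, hd⟩ := hp.exists_smul (star x * x)
    refine ⟨d, ?_⟩
    rw [← hd]
    calc star x * x = (p * star x) * (x * p) := by rw [hpx, hx]
      _ = _ := by noncomm_ring
  have hc0 : c ≠ 0 := by
    rintro rfl
    rw [zero_smul] at hc
    exact hx0 (CStarRing.star_mul_self_eq_zero_iff x |>.mp hc)
  have hcr : star c = c := by
    refine hp.smul_injective ?_
    have := congrArg star hc
    rw [star_mul, star_star, star_smul, hp.star_eq, hc] at this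
    exact this.symm
  have hxx0 : x * star x ≠ 0 := fun h => hx0 (CStarRing.mul_star_self_eq_zero_iff x |>.mp h)
  refine ⟨c, hc0, c⁻¹ • (x * star x), ?_, by rw [smul_inv_smul₀ hc0]⟩
  refine of_exists_smul ⟨?_, ?_⟩ (smul_ne_zero (inv_ne_zero hc0) hxx0) ?_
  · change c⁻¹ • (x * star x) * c⁻¹ • (x * star x) = _
    have : x * star x * (x * star x) = c • (x * star x) := by
      calc x * star x * (x * star x) = x * (star x * x) * star x := by noncomm_ring
        _ = _ := by rw [hc, mul_smul_comm, smul_mul_assoc, hx]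
    rw [smul_mul_assoc, mul_smul_comm, this, inv_smul_smul₀ hc0]
  · change star _ = _
    rw [star_smul, star_mul, star_star, star_inv₀, hcr]
  · intro a
    obtain ⟨d, hd⟩ := hcor a
    refine ⟨c⁻¹ * d, ?_⟩
    have : x * star x * a * (x * star x) = d • (x * star x) := by
      calc x * star x * a * (x * star x) = x * (star x * a * x) * star x := by noncomm_ring
        _ = _ := by rw [hd, mul_smul_comm, smul_mul_assoc, hx]
    rw [smul_mul_assoc, smul_mul_assoc, mul_smul_comm, this]
    simp only [smul_smul]
    ring_nf

lemma map {B : Type v} [NonUnitalCStarAlgebra B] (hp : IsMinimalProjection p) (e : A ≃⋆ₐ[ℂ] B) :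
    IsMinimalProjection (e p) := by
  refine of_exists_smul ⟨?_, ?_⟩ ?_ ?_
  · change e p * e p = e p
    rw [← map_mul, hp.mul_self]
  · change star (e p) = e p
    rw [← map_star, hp.star_eq]
  · exact (map_ne_zero_iff e e.injective).mpr hp.ne_zero
  · intro b
    obtain ⟨a, ha⟩ := e.surjective b
    have ha : e a = b := ha
    obtain ⟨c, hc⟩ := hp.exists_smul a
    exact ⟨c, by rw [← ha, ← map_mul, ← map_mul, hc, map_smul]⟩

end IsMinimalProjection

section AtomicIdeal

variable (A : Type u) [NonUnitalCStarAlgebra A]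

/-- The linear span of the minimal projections. -/
def atomSpan : Submodule ℂ A := Submodule.span ℂ {p : A | IsMinimalProjection p}

variable {A}

lemma IsMinimalProjection.mul_star_mem_atomSpan {p x : A} (hp : IsMinimalProjection p)
    (hx : x * p = x) : x * star x ∈ atomSpan A := by
  by_cases hx0 : x = 0
  · simp [hx0]
  · obtain ⟨c, -, q, hq, h⟩ := hp.exists_smul_mul_star hx hx0
    exact h ▸ Submodule.smul_mem _ _ (Submodule.subset_span hq)

lemma polarization (x y : A) : (4 : ℂ) • (x * star y) =
    (x + y) * star (x + y) - (x - y) * star (x - y) +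
      Complex.I • ((x + Complex.I • y) * star (x + Complex.I • y)) -
      Complex.I • ((x - Complex.I • y) * star (x - Complex.I • y)) := by
  simp only [star_add, star_sub, star_smul, mul_add, add_mul, mul_sub, sub_mul, smul_add, smul_sub,
    smul_mul_assoc, mul_smul_comm, smul_smul, Complex.star_def, Complex.conj_I]
  simp only [mul_neg, Complex.I_mul_I, neg_neg]
  have : (4 : ℂ) • (x * star y) = x * star y + x * star y + x * star y + x * star y := by
    rw [show (4 : ℂ) = 1 + 1 + 1 + 1 by norm_num]; simp only [add_smul, one_smul]
  rw [this]
  module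

/-- Polarizing `(a * p) * star p` writes `a * p` through elements `x * star x` with `x * p = x`,
each a multiple of a minimal projection. Thus the span of the minimal projections is already an
ideal. -/
lemma IsMinimalProjection.mul_mem_atomSpan {p : A} (hp : IsMinimalProjection p) (a : A) :
    a * p ∈ atomSpan A := by
  have hpp := hp.mul_self
  have key : ∀ c : ℂ, (a * p + c • p) * star (a * p + c • p) ∈ atomSpan A := fun c =>
    hp.mul_star_mem_atomSpan (by rw [add_mul, mul_assoc, smul_mul_assoc, hpp])
  have h : (4 : ℂ) • (a * p) ∈ atomSpan A := by
    have := polarization (a * p) p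
    rw [hp.star_eq, mul_assoc, hpp] at this
    rw [this]
    refine Submodule.sub_mem _ (Submodule.add_mem _ (Submodule.sub_mem _ ?_ ?_)
      (Submodule.smul_mem _ _ (key _))) (Submodule.smul_mem _ _ ?_)
    · simpa using key 1
    · simpa [sub_eq_add_neg] using key (-1)
    · simpa [sub_eq_add_neg] using key (-Complex.I)
  have := Submodule.smul_mem (atomSpan A) (4 : ℂ)⁻¹ h
  rwa [inv_smul_smul₀ (by norm_num)] at this

lemma mul_mem_atomSpan (a : A) {x : A} (hx : x ∈ atomSpan A) : a * x ∈ atomSpan A := by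
  have : atomSpan A ≤ (atomSpan A).comap (LinearMap.mulLeft ℂ a) :=
    Submodule.span_le.mpr fun p hp => IsMinimalProjection.mul_mem_atomSpan hp a
  exact this hx

lemma star_mem_atomSpan {x : A} (hx : x ∈ atomSpan A) : star x ∈ atomSpan A := by
  induction hx using Submodule.span_induction with
  | mem p hp => exact (IsMinimalProjection.star_eq hp).symm ▸ Submodule.subset_span hp
  | zero => simp
  | add x y _ _ hx hy => rw [star_add]; exact Submodule.add_mem _ hx hy
  | smul c x _ hx => rw [star_smul]; exact Submodule.smul_mem _ _ hx

lemma mul_mem_atomSpan' (a : A) {x : A} (hx : x ∈ atomSpan A) : x * a ∈ atomSpan A := by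
  have := star_mem_atomSpan (mul_mem_atomSpan (star a) (star_mem_atomSpan hx))
  rwa [star_mul, star_star, star_star] at this

variable (A) in
/-- The atomic part, as a closed ideal. -/
def atomicIdeal : ClosedIdeal A where
  toSubmodule := (atomSpan A).topologicalClosure
  mul_mem_left' a _ hx :=
    map_mem_closure (continuous_const_mul a) hx fun _ h => mul_mem_atomSpan a h
  mul_mem_right' a _ hx :=
    map_mem_closure (f := fun y => y * a) (continuous_mul_const a) hx fun _ h => mul_mem_atomSpan' a h
  star_mem' hx := map_mem_closure continuous_star hx fun _ h => star_mem_atomSpan h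
  isClosed' := Submodule.isClosed_topologicalClosure _

lemma coe_atomicIdeal : (atomicIdeal A : Set A) = closure (atomSpan A : Set A) := rfl

/-- The span is closed under products and adjoints, so generating an algebra adds nothing; after
closure, the atomic part is a closed ideal. -/
lemma coe_adjoin_isMinimalProjection :
    ((NonUnitalStarAlgebra.adjoin ℂ {p : A | IsMinimalProjection p} :
      NonUnitalStarSubalgebra ℂ A) : Set A) = atomSpan A := by
  refine Set.Subset.antisymm ?_ ?_
  · let S : NonUnitalStarSubalgebra ℂ A :=
      { atomSpan A with
        mul_mem' := fun {a _} _ hb => mul_mem_atomSpan a hb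
        star_mem' := fun h => star_mem_atomSpan h }
    have : NonUnitalStarAlgebra.adjoin ℂ {p : A | IsMinimalProjection p} ≤ S :=
      NonUnitalStarAlgebra.adjoin_le fun p hp => Submodule.subset_span hp
    exact this
  · intro x hx
    refine (Submodule.span_le (p := (NonUnitalStarAlgebra.adjoin ℂ
      {p : A | IsMinimalProjection p}).toNonUnitalSubalgebra.toSubmodule)).mpr ?_ hx
    exact NonUnitalStarAlgebra.subset_adjoin ℂ _

lemma coe_atomicPart : (atomicPart A : Set A) = atomicIdeal A := by
  rw [coe_atomicIdeal, ← coe_adjoin_isMinimalProjection]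
  rfl

lemma mem_atomicPart {x : A} : x ∈ atomicPart A ↔ x ∈ atomicIdeal A := by
  rw [← SetLike.mem_coe, coe_atomicPart, SetLike.mem_coe]

lemma IsMinimalProjection.mem_atomicIdeal {p : A} (hp : IsMinimalProjection p) :
    p ∈ atomicIdeal A := subset_closure (Submodule.subset_span hp)

lemma exists_isMinimalProjection (h : atomicPart A ≠ ⊥) : ∃ p : A, IsMinimalProjection p := by
  by_contra! hne
  apply h
  have : {p : A | IsMinimalProjection p} = ∅ := Set.eq_empty_of_forall_notMem hne
  refine SetLike.coe_injective ?_
  rw [coe_atomicPart, coe_atomicIdeal, atomSpan, this, Submodule.span_empty]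
  simp

lemma IsMinimalProjection.atomicPart_ne_bot {p : A} (hp : IsMinimalProjection p) :
    atomicPart A ≠ ⊥ := by
  intro h
  have := mem_atomicPart.mpr hp.mem_atomicIdeal
  rw [h] at this
  exact hp.ne_zero (NonUnitalStarAlgebra.mem_bot.mp this)

lemma map_mem_atomicIdeal {B : Type v} [NonUnitalCStarAlgebra B] (e : A ≃⋆ₐ[ℂ] B) {x : A}
    (hx : x ∈ atomicIdeal A) : e x ∈ atomicIdeal B := by
  have he : Continuous e := (NonUnitalStarAlgHom.isometry e e.injective).continuous
  refine map_mem_closure he hx fun y hy => ?_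
  change y ∈ atomSpan A at hy
  change e y ∈ atomSpan B
  induction hy using Submodule.span_induction with
  | mem p hp => exact Submodule.subset_span (IsMinimalProjection.map hp e)
  | zero => simp
  | add x y _ _ hx hy => rw [map_add]; exact Submodule.add_mem _ hx hy
  | smul c x _ hx => rw [map_smul]; exact Submodule.smul_mem _ _ hx

lemma map_mem_atomicIdeal_iff {B : Type v} [NonUnitalCStarAlgebra B] (e : A ≃⋆ₐ[ℂ] B) {x : A} :
    e x ∈ atomicIdeal B ↔ x ∈ atomicIdeal A :=
  ⟨fun h => by simpa using map_mem_atomicIdeal e.symm h, map_mem_atomicIdeal e⟩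

end AtomicIdeal

/-! ### Spectra containing an interval -/

section Spectrum

/-- No self-adjoint element has the unit interval in its spectrum. -/
def NoIntervalSpectrum (A : Type u) [NonUnitalCStarAlgebra A] : Prop :=
  ∀ b : A, IsSelfAdjoint b → ¬ Set.Icc (0 : ℝ) 1 ⊆ quasispectrum ℝ b

variable {A : Type u} [NonUnitalCStarAlgebra A] {B : Type v} [NonUnitalCStarAlgebra B]

lemma continuous_hom (φ : A →⋆ₙₐ[ℂ] B) : Continuous φ :=
  AddMonoidHomClass.continuous_of_bound φ 1 fun a => by
    simpa using NonUnitalStarAlgHom.norm_apply_le φ a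

lemma map_cfcn_real (φ : A →⋆ₙₐ[ℂ] B) (f : ℝ → ℝ) {a : A} (ha : IsSelfAdjoint a)
    (hf : ContinuousOn f (quasispectrum ℝ a)) (hf0 : f 0 = 0) : φ (cfcₙ f a) = cfcₙ f (φ a) :=
  NonUnitalStarAlgHom.map_cfcₙ φ f a hf hf0 (continuous_hom φ) ha (ha.map φ)

/-- A point `t` lost from the spectrum could be separated by a function equal to `1` at `t` and `0`
on the spectrum of `φ a`; applied to `a`, it would give a nonzero element killed by `φ`. Injectivity
on functions of `a` therefore suffices. -/
lemma quasispectrum_subset_of_injective_on (φ : A →⋆ₙₐ[ℂ] B) {a : A} (ha : IsSelfAdjoint a)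
    (hφ : ∀ f : ℝ → ℝ, Continuous f → f 0 = 0 → φ (cfcₙ f a) = 0 → cfcₙ f a = 0) :
    quasispectrum ℝ a ⊆ quasispectrum ℝ (φ a) := by
  intro t ht
  by_contra ht'
  have hcl : IsClosed (quasispectrum ℝ (φ a)) := (NonUnitalContinuousFunctionalCalculus.isCompact_quasispectrum
    (R := ℝ) (p := IsSelfAdjoint) (φ a)).isClosed
  obtain ⟨f, hf0, hf1, -⟩ := exists_continuous_zero_one_of_isClosed hcl
    (isClosed_singleton (x := t)) (by simpa using ht')
  have hz : f 0 = 0 := hf0 (quasispectrum.zero_mem ℝ (φ a))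
  have h1 : φ (cfcₙ f a) = 0 := by
    rw [map_cfcn_real φ f ha f.continuous.continuousOn hz,
      cfcₙ_congr (g := fun _ => 0) (fun x hx => hf0 hx), cfcₙ_const_zero]
  have h2 := hφ f f.continuous hz h1
  have h3 := norm_apply_le_norm_cfcₙ (f : ℝ → ℝ) a ht f.continuous.continuousOn hz ha
  rw [h2, hf1 (Set.mem_singleton t), norm_zero] at h3
  simp at h3
  exact absurd h3 (by norm_num)

lemma exists_isSelfAdjoint_map_eq (φ : A →⋆ₙₐ[ℂ] B) (hφ : Function.Surjective φ) {b : B}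
    (hb : IsSelfAdjoint b) : ∃ a : A, IsSelfAdjoint a ∧ φ a = b := by
  obtain ⟨a, rfl⟩ := hφ b
  refine ⟨realPart a, (realPart a).2, ?_⟩
  have h : φ (star a) = φ a := by rw [map_star, hb.star_eq]
  rw [realPart_apply_coe]
  have : φ ((⅟2 : ℝ) • (a + star a)) = φ (((⅟2 : ℝ) : ℂ) • (a + star a)) := by
    rw [Complex.coe_smul]
  simp only [invOf_eq_inv] at this ⊢
  rw [this, map_smul, map_add, h, Complex.coe_smul, ← two_smul ℝ (φ a), smul_smul]
  norm_num

/-- Self-adjoint elements lift to self-adjoint elements, and spectra can only shrink under a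
homomorphism. -/
lemma NoIntervalSpectrum.of_surjective (hA : NoIntervalSpectrum A) (φ : A →⋆ₙₐ[ℂ] B)
    (hφ : Function.Surjective φ) : NoIntervalSpectrum B := by
  intro b hb h
  obtain ⟨a, ha, rfl⟩ := exists_isSelfAdjoint_map_eq φ hφ hb
  exact hA a ha (h.trans (NonUnitalAlgHom.quasispectrum_apply_subset' (R := ℝ) ℂ φ a))

/-- The clamp maps `[s,t]` affinely onto `[0,1]` and everything else into it; `0 ≤ s` makes it
vanish at `0`, as the non-unital calculus requires. -/
lemma cfcn_clamp_quasispectrum {b : A} (hb : IsSelfAdjoint b) {s t : ℝ} (hs : 0 ≤ s) (hst : s < t)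
    (h : Set.Icc s t ⊆ quasispectrum ℝ b) :
    quasispectrum ℝ (cfcₙ (fun x => max 0 (min 1 ((x - s) / (t - s)))) b) = Set.Icc 0 1 := by
  have h0 : max 0 (min 1 ((0 - s) / (t - s))) = 0 := by
    rw [max_eq_left]
    exact min_le_of_right_le (div_nonpos_of_nonpos_of_nonneg (by linarith) (by linarith))
  rw [cfcₙ_map_quasispectrum _ b (by fun_prop) h0 hb]
  refine Set.Subset.antisymm ?_ ?_
  · rintro _ ⟨x, -, rfl⟩
    exact ⟨le_max_left _ _, max_le zero_le_one (min_le_left _ _)⟩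
  · rintro r ⟨hr0, hr1⟩
    have hts : 0 < t - s := by linarith
    refine ⟨s + r * (t - s), h ⟨by nlinarith, by nlinarith⟩, ?_⟩
    have : (s + r * (t - s) - s) / (t - s) = r := by field_simp; ring
    simp only [this]
    rw [min_eq_right hr1, max_eq_right hr0]

lemma NoIntervalSpectrum.not_Icc_subset (hA : NoIntervalSpectrum A) {b : A} (hb : IsSelfAdjoint b)
    {s t : ℝ} (hs : 0 ≤ s) (hst : s < t) : ¬ Set.Icc s t ⊆ quasispectrum ℝ b := fun h =>
  hA _ (cfcₙ_predicate _ b) (cfcn_clamp_quasispectrum hb hs hst h).superset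

/-- A projection in the algebra generated by an element with spectrum `[0,1]` is a continuous
`{0,1}`-valued function on a connected set with value `0` at `0`, hence zero. -/
lemma IsScattered.noIntervalSpectrum (hA : IsScattered A) : NoIntervalSpectrum A := by
  intro b hb h
  set c : A := cfcₙ (fun x : ℝ => max 0 (min 1 ((x - 0) / (1 - 0)))) b with hc
  have hcσ : quasispectrum ℝ c = Set.Icc 0 1 :=
    cfcn_clamp_quasispectrum hb le_rfl zero_lt_one h
  have hcs : IsSelfAdjoint c := cfcₙ_predicate _ b
  have hc0 : c ≠ 0 := by
    intro h0
    have h1 : (1 : ℝ) ∈ quasispectrum ℝ c := hcσ ▸ ⟨zero_le_one, le_rfl⟩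
    rw [h0, CFC.quasispectrum_zero_eq] at h1
    exact one_ne_zero h1
  have : IsClosed (NonUnitalStarAlgebra.elemental ℂ c : Set A) :=
    NonUnitalStarAlgebra.elemental.isClosed ℂ c
  have hne : NonUnitalStarAlgebra.elemental ℂ c ≠ ⊥ := by
    intro h0
    have h1 : c ∈ NonUnitalStarAlgebra.elemental ℂ c :=
      NonUnitalStarAlgebra.elemental.self_mem ℂ c
    rw [h0] at h1
    exact hc0 (NonUnitalStarAlgebra.mem_bot.mp h1)
  obtain ⟨p, hp⟩ := exists_isMinimalProjection (hA _ hne)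
  have hp1 : (p : A) ∈ (NonUnitalStarAlgebra.elemental ℂ c : Set A) := p.2
  have hpp : (p : A) * p = p := congrArg Subtype.val hp.mul_self
  have hp0 : (p : A) ≠ 0 := fun h => hp.ne_zero (Subtype.ext h)
  rw [← range_cfcₙ ℂ (a := c) hcs.isStarNormal] at hp1
  obtain ⟨f, hf⟩ := hp1
  have hf : cfcₙ f c = p := hf
  -- `cfcₙ` takes the default value `0` on inadmissible functions, so `p ≠ 0` forces `f` to be
  -- continuous on the spectrum and to vanish at `0`.
  have hfc : ContinuousOn f (quasispectrum ℂ c) := by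
    by_contra h'
    exact hp0 (hf ▸ cfcₙ_apply_of_not_continuousOn c h')
  have hf0 : f 0 = 0 := by
    by_contra h'
    exact hp0 (hf ▸ cfcₙ_apply_of_not_map_zero c h')
  have hσ : quasispectrum ℂ c = Complex.ofReal '' Set.Icc 0 1 := by
    rw [← hcσ, ← hcs.quasispectrumRestricts.algebraMap_image]
    rfl
  have hidem : ∀ x ∈ quasispectrum ℂ c, f x * f x = f x := by
    have : cfcₙ (fun x => f x * f x) c = cfcₙ f c := by
      rw [cfcₙ_mul f f c hfc hf0 hfc hf0, hf, hpp]
    exact eqOn_of_cfcₙ_eq_cfcₙ this hcs.isStarNormal (hfc.mul hfc) (by simp [hf0]) hfc hf0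
  have hconn : IsPreconnected (quasispectrum ℂ c) := by
    rw [hσ]
    exact isPreconnected_Icc.image _ Complex.continuous_ofReal.continuousOn
  have hdisc : IsDiscrete ({0, 1} : Set ℂ) :=
    (Set.toFinite ({0, 1} : Set ℂ)).isDiscrete
  have hmaps : Set.MapsTo f (quasispectrum ℂ c) {0, 1} := by
    intro x hx
    have := hidem x hx
    rcases mul_eq_zero.mp (show f x * (f x - 1) = 0 by rw [mul_sub, this]; ring) with h | h
    · exact Or.inl h
    · exact Or.inr (sub_eq_zero.mp h)
  apply hp0
  rw [← hf, cfcₙ_congr (g := fun _ => 0), cfcₙ_const_zero]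
  intro x hx
  exact (hconn.constant_of_mapsTo hdisc hfc hmaps hx (quasispectrum.zero_mem ℂ c)).trans hf0

end Spectrum

/-! ### Existence of minimal projections -/

section Projections

variable {A : Type u} [NonUnitalCStarAlgebra A]

lemma norm_mem_quasispectrum {y : A} (hy : IsSelfAdjoint y)
    (hpos : ∀ x ∈ quasispectrum ℝ y, 0 ≤ x) : ‖y‖ ∈ quasispectrum ℝ y := by
  obtain ⟨⟨x, hx, hxy⟩, -⟩ := IsGreatest.norm_cfcₙ (id : ℝ → ℝ) y continuousOn_id rfl hy
  rw [cfcₙ_id ℝ y hy] at hxy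
  simp only [id, Real.norm_eq_abs, abs_of_nonneg (hpos x hx)] at hxy
  exact hxy ▸ hx

/-- Just below `‖y‖` the spectrum has a gap `r > 0`. The indicator of `(r, ∞)` is then continuous on
the spectrum and gives a spectral projection on which `y` is nearly `‖y‖`; positivity of `r` lets
`y` be inverted there, so the projection factors through `y`. -/
lemma NoIntervalSpectrum.exists_isStarProjection (hA : NoIntervalSpectrum A) {y : A}
    (hy : IsSelfAdjoint y) (hpos : ∀ x ∈ quasispectrum ℝ y, 0 ≤ x) (hy0 : y ≠ 0) {ε : ℝ}
    (hε : 0 < ε) :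
    ∃ q : A, IsStarProjection q ∧ q ≠ 0 ∧ (∃ z, q = y * z) ∧ ‖y * q - (‖y‖ : ℝ) • q‖ ≤ ε := by
  have hn : 0 < ‖y‖ := norm_pos_iff.mpr hy0
  obtain ⟨r, hrσ, hr0, hr1, hrε⟩ :
      ∃ r, r ∉ quasispectrum ℝ y ∧ 0 < r ∧ r < ‖y‖ ∧ ‖y‖ - ε ≤ r := by
    by_contra! H
    have h1 : max 0 (‖y‖ - ε) < ‖y‖ := max_lt hn (by linarith)
    -- The midpoint keeps the interval strictly above both `0` and `‖y‖ - ε`, so each of its points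
    -- below `‖y‖` would be an admissible gap.
    refine hA.not_Icc_subset hy (s := (max 0 (‖y‖ - ε) + ‖y‖) / 2) (t := ‖y‖) ?_ ?_ ?_
    · have := le_max_left 0 (‖y‖ - ε)
      linarith
    · linarith
    · rintro x ⟨hx1, hx2⟩
      rcases hx2.eq_or_lt with rfl | hx2
      · exact norm_mem_quasispectrum hy hpos
      · by_contra hx
        have := H x hx (by have := le_max_left 0 (‖y‖ - ε); linarith) hx2
        have := le_max_right 0 (‖y‖ - ε)
        linarith
  -- Used twice: with `g = 1` for the spectral projection and with `g = x⁻¹` for the factor `z`.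
  have hcont : ∀ g : ℝ → ℝ, (∀ x, r < x → ContinuousAt g x) →
      ContinuousOn (fun x => if r < x then g x else 0) (quasispectrum ℝ y) := by
    intro g hg x hx
    have hxr : x ≠ r := fun h => hrσ (h ▸ hx)
    refine ContinuousAt.continuousWithinAt ?_
    rcases lt_or_gt_of_ne hxr with h | h
    · refine (continuousAt_const (y := (0 : ℝ))).congr ?_
      filter_upwards [Iio_mem_nhds h] with z hz
      rw [if_neg (not_lt.mpr (le_of_lt hz))]
    · refine (hg x h).congr ?_
      filter_upwards [Ioi_mem_nhds h] with z hz
      exact (if_pos (Set.mem_Ioi.mp hz)).symm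
  let χ : ℝ → ℝ := fun x => if r < x then 1 else 0
  have hχ : ContinuousOn χ (quasispectrum ℝ y) := hcont (fun _ => 1) fun _ _ => continuousAt_const
  have hχ0 : χ 0 = 0 := if_neg (not_lt.mpr hr0.le)
  refine ⟨cfcₙ χ y, ⟨?_, cfcₙ_predicate _ _⟩, ?_, ⟨cfcₙ (fun x => if r < x then x⁻¹ else 0) y, ?_⟩, ?_⟩
  · change cfcₙ χ y * cfcₙ χ y = cfcₙ χ y
    rw [← cfcₙ_mul χ χ y hχ hχ0 hχ hχ0]
    refine cfcₙ_congr fun x _ => ?_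
    simp only [χ]
    split_ifs <;> simp
  · intro h
    have := norm_apply_le_norm_cfcₙ χ y (norm_mem_quasispectrum hy hpos) hχ hχ0 hy
    rw [h, norm_zero] at this
    simp only [χ, if_pos hr1, norm_one] at this
    exact absurd this (by norm_num)
  · have hc := hcont (fun x => x⁻¹) fun x hx => continuousAt_inv₀ (by linarith : x ≠ 0)
    have h0 : (if r < 0 then (0 : ℝ)⁻¹ else 0) = 0 := by simp
    have h1 := cfcₙ_mul (fun x : ℝ => x) (fun x => if r < x then x⁻¹ else 0) y continuousOn_id rfl
      hc h0
    rw [cfcₙ_id' ℝ y hy] at h1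
    rw [← h1]
    refine cfcₙ_congr fun x _ => ?_
    simp only [χ]
    split_ifs with h
    · rw [mul_inv_cancel₀ (by linarith)]
    · simp
  · have h1 : y * cfcₙ χ y - (‖y‖ : ℝ) • cfcₙ χ y = cfcₙ (fun x => x * χ x - ‖y‖ * χ x) y := by
      rw [cfcₙ_sub (fun x => x * χ x) (fun x => ‖y‖ * χ x) y (continuousOn_id.mul hχ) (by simp)
        (continuousOn_const.mul hχ) (by simp [hχ0]), cfcₙ_mul (fun x => x) χ y continuousOn_id rfl
        hχ hχ0, cfcₙ_id' ℝ y hy, cfcₙ_const_mul _ χ y hχ hχ0]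
    rw [h1]
    refine norm_cfcₙ_le fun x hx => ?_
    simp only [χ]
    split_ifs with h
    · have h2 : ‖x‖ ≤ ‖y‖ := by
        have := norm_apply_le_norm_cfcₙ (fun x : ℝ => x) y hx continuousOn_id rfl hy
        rwa [cfcₙ_id' ℝ y hy] at this
      rw [Real.norm_eq_abs] at h2 ⊢
      rw [mul_one, mul_one, abs_le]
      have := le_abs_self x
      constructor <;> linarith
    · simpa using hε.le

/-- In an algebra without interval spectra, a nonzero projection without proper subprojections is
minimal. -/
lemma NoIntervalSpectrum.isMinimalProjection (hA : NoIntervalSpectrum A) {p : A}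
    (hp : IsStarProjection p) (h0 : p ≠ 0)
    (h : ∀ q : A, IsStarProjection q → q ≠ 0 → p * q = q → q = p) : IsMinimalProjection p := by
  let _ := CStarAlgebra.spectralOrder A
  have _ := CStarAlgebra.spectralOrderedRing A
  have hpp : p * p = p := hp.isIdempotentElem
  have hps : star p = p := hp.isSelfAdjoint
  -- The nearly-eigenvalue projection of `y` lies under `p`, hence equals `p`, so `y` is within
  -- every `ε` of `‖y‖ • p`.
  have key : ∀ y : A, 0 ≤ y → p * y = y → y = (‖y‖ : ℝ) • p := by
    intro y hy hpy
    by_cases hy0 : y = 0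
    · simp [hy0]
    have hys : IsSelfAdjoint y := .of_nonneg hy
    have hyp : y * p = y := by
      have := congrArg star hpy
      rwa [star_mul, hps, hys.star_eq] at this
    refine eq_of_sub_eq_zero (norm_le_zero_iff.mp (le_of_forall_pos_le_add fun ε hε => ?_))
    obtain ⟨q, hq, hq0, ⟨z, hz⟩, hqε⟩ := hA.exists_isStarProjection hys
      (fun x hx => quasispectrum_nonneg_of_nonneg y hy x hx) hy0 hε
    have : q = p := h q hq hq0 (by rw [hz, ← mul_assoc, hpy])
    rw [this, hyp] at hqε
    simpa using hqε
  refine IsMinimalProjection.of_exists_smul hp h0 fun a => ?_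
  have ha : a ∈ Submodule.span ℂ {a : A | 0 ≤ a} := by
    rw [CStarAlgebra.span_nonneg]; trivial
  induction ha using Submodule.span_induction with
  | mem a ha =>
    have h1 : 0 ≤ p * a * p := by
      have := star_left_conjugate_nonneg ha p
      rwa [hps] at this
    have h2 := key _ h1 (by rw [← mul_assoc, ← mul_assoc, hpp])
    exact ⟨(‖p * a * p‖ : ℝ), by rw [Complex.coe_smul]; exact h2⟩
  | zero => exact ⟨0, by simp⟩
  | add x y _ _ hx hy =>
    obtain ⟨c, hc⟩ := hx
    obtain ⟨d, hd⟩ := hy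
    exact ⟨c + d, by rw [mul_add, add_mul, hc, hd, add_smul]⟩
  | smul c x _ hx =>
    obtain ⟨d, hd⟩ := hx
    exact ⟨c * d, by rw [mul_smul_comm, smul_mul_assoc, hd, smul_smul]⟩

lemma _root_.IsStarProjection.norm_eq_one {p : A} (hp : IsStarProjection p) (h0 : p ≠ 0) :
    ‖p‖ = 1 := by
  have h := CStarRing.norm_star_mul_self (x := p)
  rw [hp.isSelfAdjoint.star_eq, hp.isIdempotentElem.eq] at h
  have := norm_pos_iff.mpr h0
  nlinarith

/-! ### Approximate eigenvectors and the dyadic tree of projections. -/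

/-- If `t - x` had an inverse `v` in the unitization, then `1 = ‖q‖ ≤ ‖v‖ * ‖x * q - t • q‖`, which
fails for a small enough defect. -/
lemma mem_quasispectrum_of_approx {x : A} {t : ℝ}
    (h : ∀ ε > 0, ∃ q : A, ‖q‖ = 1 ∧ ‖x * q - t • q‖ ≤ ε) : t ∈ quasispectrum ℝ x := by
  rw [Unitization.quasispectrum_eq_spectrum_inr' ℝ ℂ, spectrum.mem_iff]
  rintro ⟨u, hu⟩
  have hpos : 0 < ‖(↑u⁻¹ : Unitization ℂ A)‖ + 1 := by positivity
  obtain ⟨q, hq, hqε⟩ := h (1 / (2 * (‖(↑u⁻¹ : Unitization ℂ A)‖ + 1))) (by positivity)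
  have h1 : (u : Unitization ℂ A) * (q : Unitization ℂ A) = -((x * q - t • q : A) : Unitization ℂ A) := by
    rw [hu, sub_mul, Algebra.algebraMap_eq_smul_one, smul_mul_assoc, one_mul]
    simp
  have h2 : (q : Unitization ℂ A) = ↑u⁻¹ * -((x * q - t • q : A) : Unitization ℂ A) := by
    rw [← h1, ← mul_assoc, Units.inv_mul, one_mul]
  have h3 : ‖(q : Unitization ℂ A)‖ ≤ ‖(↑u⁻¹ : Unitization ℂ A)‖ * ‖x * q - t • q‖ := by
    conv_lhs => rw [h2]
    refine (norm_mul_le _ _).trans_eq ?_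
    rw [norm_neg, Unitization.norm_inr]
  rw [Unitization.norm_inr, hq] at h3
  have h4 := h3.trans (mul_le_mul_of_nonneg_left hqε (norm_nonneg _))
  have : ‖(↑u⁻¹ : Unitization ℂ A)‖ * (1 / (2 * (‖(↑u⁻¹ : Unitization ℂ A)‖ + 1))) < 1 := by
    rw [mul_one_div, div_lt_one (by positivity)]
    linarith [norm_nonneg (↑u⁻¹ : Unitization ℂ A)]
  linarith

/-- The approximations of the element with spectrum `[0, 1]` built from a splitting `p ↦ L p` of
projections. -/
noncomputable def dyadicApprox (L : A → A) : ℕ → A → A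
  | 0, _ => 0
  | n + 1, p => (2⁻¹ : ℝ) • (dyadicApprox L n (L p) + dyadicApprox L n (p - L p) + (p - L p))

/-- The splitting gives a binary tree of projections below `p₀`. The limit `Y p₀` acts as the number
whose binary digits record the branch taken, so every `t ∈ [0,1]` is an approximate eigenvalue,
reached by descending along digits of `t`. -/
lemma not_noIntervalSpectrum_of_split (P : A → Prop) (hP : ∀ p, P p → IsStarProjection p ∧ p ≠ 0)
    (L : A → A) (hL : ∀ p, P p → P (L p) ∧ P (p - L p) ∧ p * L p = L p) {p₀ : A} (hp₀ : P p₀) :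
    ¬ NoIntervalSpectrum A := by
  let _ := CStarAlgebra.spectralOrder A
  have _ := CStarAlgebra.spectralOrderedRing A
  set X := dyadicApprox L with hX
  have hXs : ∀ n p, X (n + 1) p = (2⁻¹ : ℝ) • (X n (L p) + X n (p - L p) + (p - L p)) :=
    fun n p => rfl
  have hX0 : ∀ p, X 0 p = 0 := fun p => rfl
  have hsub : ∀ p, P p → 0 ≤ p := fun p hp => (hP p hp).1.nonneg
  -- Passing to the next level adds one binary digit: an increment between `0` and `2⁻¹ ^ (n + 1)`
  -- times `p`. This yields the Cauchy property and the bound `‖Y p‖ ≤ 1`.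
  have hmono : ∀ n p, P p → 0 ≤ X (n + 1) p - X n p ∧
      X (n + 1) p - X n p ≤ ((2⁻¹ : ℝ) ^ (n + 1)) • p := by
    intro n
    induction n with
    | zero =>
      intro p hp
      obtain ⟨h1, h2, -⟩ := hL p hp
      have h3 : X 1 p - X 0 p = (2⁻¹ : ℝ) • (p - L p) := by simp [hXs, hX0]
      rw [zero_add, h3, pow_one]
      refine ⟨smul_nonneg (by norm_num) (hsub _ h2), smul_le_smul_of_nonneg_left ?_ (by norm_num)⟩
      exact sub_le_self _ (hsub _ h1)
    | succ n ih =>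
      intro p hp
      obtain ⟨h1, h2, -⟩ := hL p hp
      have h3 : X (n + 1 + 1) p - X (n + 1) p = (2⁻¹ : ℝ) • ((X (n + 1) (L p) - X n (L p)) +
          (X (n + 1) (p - L p) - X n (p - L p))) := by
        rw [hXs (n + 1), hXs n p, ← smul_sub]
        congr 1
        abel
      have h4 : ((2⁻¹ : ℝ) ^ (n + 1 + 1)) • p = (2⁻¹ : ℝ) • (((2⁻¹ : ℝ) ^ (n + 1)) • L p +
          ((2⁻¹ : ℝ) ^ (n + 1)) • (p - L p)) := by
        rw [← smul_add, add_sub_cancel, smul_smul, ← pow_succ']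
      rw [h3, h4]
      exact ⟨smul_nonneg (by norm_num) (add_nonneg (ih _ h1).1 (ih _ h2).1),
        smul_le_smul_of_nonneg_left (add_le_add (ih _ h1).2 (ih _ h2).2) (by norm_num)⟩
  have hmul : ∀ n p, P p → X n p * p = X n p := by
    intro n
    induction n with
    | zero => intro p _; simp [hX0]
    | succ n ih =>
      intro p hp
      obtain ⟨h1, h2, h3⟩ := hL p hp
      have h4 : L p * p = L p := by
        have := congrArg star h3
        rwa [star_mul, (hP _ h1).1.isSelfAdjoint.star_eq, (hP _ hp).1.isSelfAdjoint.star_eq] at this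
      have hpp : p * p = p := (hP _ hp).1.isIdempotentElem
      have h5 : (p - L p) * p = p - L p := by rw [sub_mul, hpp, h4]
      have h6 : X n (L p) * p = X n (L p) := by
        conv_lhs => rw [← ih _ h1, mul_assoc, h4, ih _ h1]
      have h7 : X n (p - L p) * p = X n (p - L p) := by
        conv_lhs => rw [← ih _ h2, mul_assoc, h5, ih _ h2]
      rw [hXs, smul_mul_assoc, add_mul, add_mul, h5, h6, h7]
  have hpos : ∀ n p, P p → IsSelfAdjoint (X n p) := by
    intro n p hp
    refine IsSelfAdjoint.of_nonneg ?_
    induction n with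
    | zero => simp [hX0]
    | succ n ih => exact ih.trans (sub_nonneg.mp (hmono n p hp).1)
  have hcauchy : ∀ p, P p → ∃ x, Filter.Tendsto (fun n => X n p) Filter.atTop (nhds x) := by
    intro p hp
    refine cauchySeq_tendsto_of_complete (cauchySeq_of_le_geometric 2⁻¹ 1 (by norm_num) ?_)
    intro n
    rw [dist_comm, dist_eq_norm]
    refine (CStarAlgebra.norm_le_norm_of_nonneg_of_le (hmono n p hp).1 (hmono n p hp).2).trans ?_
    rw [norm_smul, (hP p hp).1.norm_eq_one (hP p hp).2, mul_one, one_mul, Real.norm_eq_abs,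
      abs_of_nonneg (by positivity), pow_succ]
    have : (0 : ℝ) ≤ 2⁻¹ ^ n := by positivity
    linarith
  have hlim : ∀ p, ∃ x, P p → Filter.Tendsto (fun n => X n p) Filter.atTop (nhds x) := fun p => by
    by_cases hp : P p
    · obtain ⟨x, hx⟩ := hcauchy p hp
      exact ⟨x, fun _ => hx⟩
    · exact ⟨0, fun h => absurd h hp⟩
  choose Y hY using hlim
  have hYmul : ∀ p, P p → Y p * p = Y p := fun p hp =>
    tendsto_nhds_unique ((hY p hp).mul_const p) ((hY p hp).congr fun n => (hmul n p hp).symm)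
  -- Self-similarity: on the branch `L p` the values are scaled to `[0,1/2]`, on the branch `p - L
  -- p` to `[1/2,1]`.
  have hYrec : ∀ p, P p → Y p = (2⁻¹ : ℝ) • (Y (L p) + Y (p - L p) + (p - L p)) := by
    intro p hp
    obtain ⟨h1, h2, h3⟩ := hL p hp
    refine tendsto_nhds_unique ((hY p hp).comp (Filter.tendsto_add_atTop_nat 1)) ?_
    exact ((((hY _ h1).add (hY _ h2)).add_const _).const_smul _)
  have hYs : IsSelfAdjoint (Y p₀) := by
    refine tendsto_nhds_unique ((continuous_star.tendsto _).comp (hY p₀ hp₀))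
      ((hY p₀ hp₀).congr fun n => (hpos n p₀ hp₀).star_eq.symm)
  have hYn : ∀ p, P p → ‖Y p‖ ≤ 1 := by
    intro p hp
    refine le_of_tendsto (hY p hp).norm (Filter.Eventually.of_forall fun n => ?_)
    have h1 : 0 ≤ X n p ∧ X n p ≤ (1 - (2⁻¹ : ℝ) ^ n) • p := by
      induction n with
      | zero => simp [hX0]
      | succ n ih =>
        refine ⟨ih.1.trans (sub_nonneg.mp (hmono n p hp).1), ?_⟩
        have := add_le_add ih.2 (hmono n p hp).2
        rw [add_sub_cancel, ← add_smul] at this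
        refine this.trans_eq ?_
        congr 1
        rw [pow_succ]
        ring
    refine (CStarAlgebra.norm_le_norm_of_nonneg_of_le h1.1 h1.2).trans ?_
    rw [norm_smul, (hP p hp).1.norm_eq_one (hP p hp).2, mul_one, Real.norm_eq_abs,
      abs_of_nonneg]
    · have : (0 : ℝ) ≤ 2⁻¹ ^ n := by positivity
      linarith
    · have : (2⁻¹ : ℝ) ^ n ≤ 1 := pow_le_one₀ (by norm_num) (by norm_num)
      linarith
  -- Each descent halves the error. The left branch is followed with target `2 * t` when `t ≤ 1/2`,
  -- the right branch with target `2 * t - 1` otherwise; at depth `0` the error is at most `‖Y p‖ +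
  -- t ≤ 2`.
  have happ : ∀ n p, P p → ∀ t ∈ Set.Icc (0 : ℝ) 1, ∃ q, P q ∧ p * q = q ∧
      ‖Y p * q - t • q‖ ≤ 2 * (2⁻¹ : ℝ) ^ n := by
    intro n
    induction n with
    | zero =>
      rintro p hp t ⟨ht0, ht1⟩
      refine ⟨p, hp, (hP p hp).1.isIdempotentElem, ?_⟩
      rw [hYmul p hp]
      refine (norm_sub_le _ _).trans ?_
      rw [norm_smul, (hP p hp).1.norm_eq_one (hP p hp).2, Real.norm_eq_abs, abs_of_nonneg ht0]
      have := hYn p hp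
      linarith
    | succ n ih =>
      rintro p hp t ⟨ht0, ht1⟩
      obtain ⟨h1, h2, h3⟩ := hL p hp
      have hLL : L p * L p = L p := (hP _ h1).1.isIdempotentElem
      have hLs : star (L p) = L p := (hP _ h1).1.isSelfAdjoint
      have hpp : p * p = p := (hP _ hp).1.isIdempotentElem
      have hps : star p = p := (hP _ hp).1.isSelfAdjoint
      have h4 : L p * p = L p := by
        have := congrArg star h3
        rwa [star_mul, hLs, hps] at this
      rcases le_total t 2⁻¹ with ht | ht
      · obtain ⟨q, hq, hq1, hq2⟩ := ih (L p) h1 (2 * t) ⟨by linarith, by linarith⟩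
        refine ⟨q, hq, by rw [← hq1, ← mul_assoc, h3], ?_⟩
        have hRq : (p - L p) * q = 0 := by
          rw [← hq1, ← mul_assoc, sub_mul, h3, hLL, sub_self, zero_mul]
        have h5 : Y (p - L p) * q = 0 := by
          rw [← hYmul _ h2, mul_assoc, hRq, mul_zero]
        have h6 : Y p * q - t • q = (2⁻¹ : ℝ) • (Y (L p) * q - (2 * t) • q) := by
          rw [hYrec p hp, smul_mul_assoc, add_mul, add_mul, hRq, h5, add_zero, add_zero, smul_sub,
            smul_smul]
          congr 2
          ring
        rw [h6, norm_smul, pow_succ]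
        norm_num at hq2 ⊢
        linarith
      · obtain ⟨q, hq, hq1, hq2⟩ := ih (p - L p) h2 (2 * t - 1) ⟨by linarith, by linarith⟩
        refine ⟨q, hq, by rw [← hq1, ← mul_assoc, mul_sub, hpp, h3], ?_⟩
        have hLq : L p * q = 0 := by
          rw [← hq1, ← mul_assoc, mul_sub, h4, hLL, sub_self, zero_mul]
        have h5 : Y (L p) * q = 0 := by
          rw [← hYmul _ h1, mul_assoc, hLq, mul_zero]
        have h6 : Y p * q - t • q = (2⁻¹ : ℝ) • (Y (p - L p) * q - (2 * t - 1) • q) := by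
          rw [hYrec p hp, smul_mul_assoc, add_mul, add_mul, hq1, h5, zero_add, smul_sub, smul_add,
            smul_smul, show (2⁻¹ : ℝ) * (2 * t - 1) = t - 2⁻¹ by ring, sub_smul]
          abel
        rw [h6, norm_smul, pow_succ]
        norm_num at hq2 ⊢
        linarith
  intro hA
  refine hA (Y p₀) hYs fun t ht => mem_quasispectrum_of_approx fun ε hε => ?_
  obtain ⟨n, hn⟩ := exists_pow_lt_of_lt_one (half_pos hε) (by norm_num : (2⁻¹ : ℝ) < 1)
  obtain ⟨q, hq, -, hq2⟩ := happ n p₀ hp₀ t ht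
  exact ⟨q, (hP q hq).1.norm_eq_one (hP q hq).2, hq2.trans (by linarith)⟩

/-- Without minimal projections every nonzero projection has a proper nonzero subprojection, so the
tree construction runs from a spectral projection of `star a * a`. -/
lemma NoIntervalSpectrum.exists_isMinimalProjection (hA : NoIntervalSpectrum A) {a : A}
    (ha : a ≠ 0) : ∃ p : A, IsMinimalProjection p := by
  let _ := CStarAlgebra.spectralOrder A
  have _ := CStarAlgebra.spectralOrderedRing A
  by_contra! hno
  let P : A → Prop := fun p => IsStarProjection p ∧ p ≠ 0
  have hsplit : ∀ p, ∃ q, P p → P q ∧ P (p - q) ∧ p * q = q := by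
    intro p
    by_cases hp : P p
    · have := hno p
      by_contra! H
      refine this (hA.isMinimalProjection hp.1 hp.2 fun q hq hq0 hpq => ?_)
      by_contra hne
      refine (H q).2 ⟨hq, hq0⟩ ⟨⟨?_, ?_⟩, fun h => hne (sub_eq_zero.mp h).symm⟩ hpq
      · have hqp : q * p = q := by
          have := congrArg star hpq
          rwa [star_mul, hq.isSelfAdjoint.star_eq, hp.1.isSelfAdjoint.star_eq] at this
        change (p - q) * (p - q) = p - q
        rw [sub_mul, mul_sub, mul_sub, hpq, hqp, hq.isIdempotentElem.eq, hp.1.isIdempotentElem.eq]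
        abel
      · exact hp.1.isSelfAdjoint.sub hq.isSelfAdjoint
    · exact ⟨0, fun h => absurd h hp⟩
  choose L hL using hsplit
  have hy0 : star a * a ≠ 0 := fun h => ha (CStarRing.star_mul_self_eq_zero_iff a |>.mp h)
  obtain ⟨p₀, hp₀, hp₀', -⟩ := hA.exists_isStarProjection (IsSelfAdjoint.star_mul_self a)
    (fun x hx => quasispectrum_nonneg_of_nonneg _ (star_mul_self_nonneg a) x hx) hy0 one_pos
  exact not_noIntervalSpectrum_of_split P (fun p hp => hp) L hL (p₀ := p₀) ⟨hp₀, hp₀'⟩ hA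

end Projections

/-! ### Homomorphisms and closed ideals -/

namespace ClosedIdeal

variable {A : Type u} [NonUnitalCStarAlgebra A]

lemma ext_coe {I J : ClosedIdeal A} (h : (I : Set A) = J) : I = J := SetLike.coe_injective h

/-- The quotient map as a ⋆-homomorphism. -/
noncomputable def projHom (I : ClosedIdeal A) : A →⋆ₙₐ[ℂ] I.Quotient where
  toFun := I.proj
  map_smul' := I.proj.map_smul
  map_zero' := I.proj.map_zero
  map_add' := I.proj.map_add
  map_mul' := I.proj_mul
  map_star' := I.proj_star

lemma projHom_apply (I : ClosedIdeal A) (a : A) : I.projHom a = I.proj a := rfl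

lemma projHom_surjective (I : ClosedIdeal A) : Function.Surjective I.projHom := I.proj_surjective

lemma proj_eq_zero_iff (I : ClosedIdeal A) {a : A} : I.proj a = 0 ↔ a ∈ I := by
  rw [← map_zero I.proj, proj_eq_proj_iff, sub_zero]

/-- The preimage of a closed ideal. -/
def comap {B : Type v} [NonUnitalCStarAlgebra B] (φ : A →⋆ₙₐ[ℂ] B) (J : ClosedIdeal B) :
    ClosedIdeal A where
  carrier := {a | φ a ∈ J}
  add_mem' {a b} ha hb := by
    change φ (a + b) ∈ J
    rw [map_add]
    exact add_mem (S := ClosedIdeal B) ha hb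
  zero_mem' := by
    change φ 0 ∈ J
    rw [map_zero]
    exact zero_mem J
  smul_mem' c a ha := by
    change φ (c • a) ∈ J
    rw [map_smul]
    exact J.smul_mem' c ha
  mul_mem_left' a x hx := by
    change φ (a * x) ∈ J
    rw [map_mul]
    exact J.mul_mem_left' _ hx
  mul_mem_right' a x hx := by
    change φ (x * a) ∈ J
    rw [map_mul]
    exact J.mul_mem_right' _ hx
  star_mem' {x} hx := by
    change φ (star x) ∈ J
    rw [map_star]
    exact J.star_mem' hx
  isClosed' := J.isClosed'.preimage (continuous_hom φ)

lemma mem_comap {B : Type v} [NonUnitalCStarAlgebra B] {φ : A →⋆ₙₐ[ℂ] B} {J : ClosedIdeal B}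
    {a : A} : a ∈ J.comap φ ↔ φ a ∈ J := Iff.rfl

variable (A) in
/-- The zero ideal. -/
def zeroIdeal : ClosedIdeal A where
  toSubmodule := ⊥
  mul_mem_left' a x hx := by
    have : x = 0 := hx
    rw [this, mul_zero]; exact Submodule.zero_mem ⊥
  mul_mem_right' a x hx := by
    have : x = 0 := hx
    rw [this, zero_mul]; exact Submodule.zero_mem ⊥
  star_mem' {x} hx := by
    have : x = 0 := hx
    rw [this, star_zero]; exact Submodule.zero_mem ⊥
  isClosed' := isClosed_singleton

/-- The kernel of a ⋆-homomorphism. -/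
def ker {B : Type v} [NonUnitalCStarAlgebra B] (φ : A →⋆ₙₐ[ℂ] B) : ClosedIdeal A :=
  (zeroIdeal B).comap φ

section Lift

variable {B : Type v} [NonUnitalCStarAlgebra B] (I : ClosedIdeal A) (φ : A →⋆ₙₐ[ℂ] B)
  (h : ∀ a ∈ I, φ a = 0)

/-- The ⋆-homomorphism induced on the quotient. -/
noncomputable def lift : I.Quotient →⋆ₙₐ[ℂ] B where
  toFun := I.toSubmodule.liftQ (φ : A →ₗ[ℂ] B) h
  map_smul' c x := by
    obtain ⟨x, rfl⟩ := I.proj_surjective x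
    exact map_smul φ c x
  map_zero' := map_zero φ
  map_add' x y := by
    obtain ⟨x, rfl⟩ := I.proj_surjective x
    obtain ⟨y, rfl⟩ := I.proj_surjective y
    exact map_add φ x y
  map_mul' x y := by
    obtain ⟨x, rfl⟩ := I.proj_surjective x
    obtain ⟨y, rfl⟩ := I.proj_surjective y
    exact map_mul φ x y
  map_star' x := by
    obtain ⟨x, rfl⟩ := I.proj_surjective x
    exact map_star φ x

lemma lift_proj (a : A) : I.lift φ h (I.proj a) = φ a := rfl

end Lift

/-- A surjective ⋆-homomorphism with kernel `I` induces an isomorphism on `A / I`. -/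
noncomputable def quotientEquiv {B : Type v} [NonUnitalCStarAlgebra B] (I : ClosedIdeal A)
    (φ : A →⋆ₙₐ[ℂ] B) (h : ∀ a, a ∈ I ↔ φ a = 0) (hφ : Function.Surjective φ) :
    I.Quotient ≃⋆ₐ[ℂ] B :=
  StarAlgEquiv.ofBijective (I.lift φ fun a => (h a).mp) (by
    refine ⟨?_, ?_⟩
    · rw [injective_iff_map_eq_zero]
      intro x hx
      obtain ⟨a, rfl⟩ := I.proj_surjective x
      rw [lift_proj] at hx
      rw [proj_eq_zero_iff, h, hx]
    · intro b
      obtain ⟨a, rfl⟩ := hφ b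
      exact ⟨I.proj a, I.lift_proj φ _ a⟩)

lemma quotientEquiv_proj {B : Type v} [NonUnitalCStarAlgebra B] (I : ClosedIdeal A)
    (φ : A →⋆ₙₐ[ℂ] B) (h : ∀ a, a ∈ I ↔ φ a = 0) (hφ : Function.Surjective φ) (a : A) :
    I.quotientEquiv φ h hφ (I.proj a) = φ a := rfl

/-- The range of a ⋆-homomorphism of C⋆-algebras is closed. -/
lemma _root_.ScatteredCStar.isClosed_range_hom {B : Type v} [NonUnitalCStarAlgebra B]
    (φ : A →⋆ₙₐ[ℂ] B) : IsClosed (Set.range φ) := by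
  set ψ := (ker φ).lift φ fun a ha => ha with hψ
  have hinj : Function.Injective ψ := by
    rw [injective_iff_map_eq_zero]
    intro x hx
    obtain ⟨a, rfl⟩ := (ker φ).proj_surjective x
    exact (proj_eq_zero_iff _).mpr hx
  have hr : Set.range φ = Set.range ψ := by
    ext b
    constructor
    · rintro ⟨a, rfl⟩
      exact ⟨(ker φ).proj a, rfl⟩
    · rintro ⟨x, rfl⟩
      obtain ⟨a, rfl⟩ := (ker φ).proj_surjective x
      exact ⟨a, rfl⟩
  rw [hr]
  exact (NonUnitalStarAlgHom.isometry ψ hinj).isClosedEmbedding.isClosed_range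

/-- The closed ideal generated by a family of closed ideals. -/
def closedSup {ι : Sort*} (F : ι → ClosedIdeal A) : ClosedIdeal A where
  toSubmodule := (⨆ i, (F i).toSubmodule).topologicalClosure
  mul_mem_left' a x hx := by
    have : (⨆ i, (F i).toSubmodule) ≤ (⨆ i, (F i).toSubmodule).comap (LinearMap.mulLeft ℂ a) :=
      iSup_le fun i x hx => (le_iSup (fun i => (F i).toSubmodule) i) ((F i).mul_mem_left' a hx)
    exact map_mem_closure (continuous_const_mul a) hx this
  mul_mem_right' a x hx := by
    have : (⨆ i, (F i).toSubmodule) ≤ (⨆ i, (F i).toSubmodule).comap (LinearMap.mulRight ℂ a) :=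
      iSup_le fun i x hx => (le_iSup (fun i => (F i).toSubmodule) i) ((F i).mul_mem_right' a hx)
    exact map_mem_closure (f := fun y => y * a) (continuous_mul_const a) hx this
  star_mem' {x} hx := by
    refine map_mem_closure continuous_star hx fun y hy => ?_
    change y ∈ ⨆ i, (F i).toSubmodule at hy
    change star y ∈ ⨆ i, (F i).toSubmodule
    induction hy using Submodule.iSup_induction' with
    | mem i y hy => exact (le_iSup (fun i => (F i).toSubmodule) i) ((F i).star_mem' hy)
    | zero => rw [star_zero]; exact Submodule.zero_mem _
    | add y z _ _ hy hz => rw [star_add]; exact Submodule.add_mem _ hy hz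
  isClosed' := Submodule.isClosed_topologicalClosure _

lemma subset_closedSup {ι : Sort*} (F : ι → ClosedIdeal A) (i : ι) :
    (F i : Set A) ⊆ closedSup F := fun _ hx =>
  subset_closure ((le_iSup (fun i => (F i).toSubmodule) i) hx)

lemma closedSup_subset {ι : Sort*} (F : ι → ClosedIdeal A) {J : ClosedIdeal A}
    (h : ∀ i, (F i : Set A) ⊆ J) : (closedSup F : Set A) ⊆ J :=
  closure_minimal (show ((⨆ i, (F i).toSubmodule : Submodule ℂ A) : Set A) ⊆ J.toSubmodule from
    (iSup_le fun i => h i : (⨆ i, (F i).toSubmodule) ≤ J.toSubmodule)) J.isClosed'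

lemma coe_closedSup_of_directed {ι : Type*} [Nonempty ι] (F : ι → ClosedIdeal A)
    (h : ∀ i j, ∃ k, (F i : Set A) ⊆ F k ∧ (F j : Set A) ⊆ F k) :
    (closedSup F : Set A) = closure (⋃ i, (F i : Set A)) := by
  change closure ((⨆ i, (F i).toSubmodule : Submodule ℂ A) : Set A) = _
  rw [Submodule.coe_iSup_of_directed]
  · rfl
  · exact fun i j => h i j

/-- The preimage of the atomic part of the quotient. -/
noncomputable def derived (I : ClosedIdeal A) : ClosedIdeal A := (atomicIdeal I.Quotient).comap I.projHom

lemma mem_derived {I : ClosedIdeal A} {a : A} :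
    a ∈ I.derived ↔ I.proj a ∈ atomicIdeal I.Quotient := Iff.rfl

lemma subset_derived (I : ClosedIdeal A) : (I : Set A) ⊆ I.derived := fun a ha => by
  rw [SetLike.mem_coe, mem_derived, I.proj_eq_zero_iff.mpr ha]
  exact zero_mem _

/-- Turns the successor clause into an equality of ideals of `A`: since `I ⊆ J`, the ideal `J` is
the full preimage of its image. -/
lemma coe_atomicPart_eq_image_iff {I J : ClosedIdeal A} (h : (I : Set A) ⊆ J) :
    (atomicPart I.Quotient : Set I.Quotient) = I.proj '' (J : Set A) ↔ J = I.derived := by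
  constructor
  · intro h1
    refine ext_coe (Set.ext fun a => ?_)
    rw [SetLike.mem_coe, SetLike.mem_coe, mem_derived, ← mem_atomicPart]
    refine Iff.trans ?_ (Set.ext_iff.mp h1 (I.proj a)).symm
    constructor
    · exact fun ha => ⟨a, ha, rfl⟩
    · rintro ⟨b, hb, hab⟩
      rw [proj_eq_proj_iff] at hab
      have := sub_mem (S := ClosedIdeal A) hb (h hab)
      rwa [sub_sub_cancel] at this
  · rintro rfl
    rw [coe_atomicPart]
    ext x
    constructor
    · intro hx
      obtain ⟨a, rfl⟩ := I.proj_surjective x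
      exact ⟨a, hx, rfl⟩
    · rintro ⟨a, ha, rfl⟩
      exact ha

end ClosedIdeal

/-! ### Elements of the atomic part have small spectrum -/

section Small

variable {A : Type u} [NonUnitalCStarAlgebra A]

/-- If `v = p * a * q ≠ 0`, then `star v * v` is a nonzero multiple of `q` and `p * b * q * star v`
is a multiple of `p`; multiplying the latter by `v` shows that `p * b * q` is a multiple of `v`. -/
lemma IsMinimalProjection.exists_corner {p q : A} (hp : IsMinimalProjection p)
    (hq : IsMinimalProjection q) : ∃ v : A, ∀ a : A, ∃ c : ℂ, p * a * q = c • v := by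
  by_cases h : ∀ a : A, p * a * q = 0
  · exact ⟨0, fun a => ⟨0, by simp [h a]⟩⟩
  push Not at h
  obtain ⟨a, ha⟩ := h
  set v := p * a * q with hv
  have hvs : star v = q * star a * p := by
    rw [hv, star_mul, star_mul, hp.star_eq, hq.star_eq, mul_assoc]
  have hvq : v * q = v := by rw [hv, mul_assoc, hq.mul_self]
  obtain ⟨d, hd⟩ : ∃ d : ℂ, star v * v = d • q := by
    obtain ⟨d, hd⟩ := hq.exists_smul (star a * p * (p * a))
    refine ⟨d, ?_⟩
    rw [← hd, hvs, hv]
    noncomm_ring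
  have hd0 : d ≠ 0 := by
    rintro rfl
    rw [zero_smul] at hd
    exact ha (CStarRing.star_mul_self_eq_zero_iff v |>.mp hd)
  refine ⟨v, fun b => ?_⟩
  obtain ⟨c, hc⟩ := hp.exists_smul (b * q * star a)
  refine ⟨d⁻¹ * c, ?_⟩
  have h1 : p * b * q * (star v * v) = c • v := by
    rw [hvs]
    calc p * b * q * (q * star a * p * v) = p * (b * (q * q) * star a) * p * v := by noncomm_ring
      _ = c • (p * v) := by rw [hq.mul_self, hc, smul_mul_assoc]
      _ = c • v := by rw [hv, ← mul_assoc, ← mul_assoc, hp.mul_self]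
  rw [hd, mul_smul_comm, mul_assoc, hq.mul_self] at h1
  rw [mul_smul, ← h1, inv_smul_smul₀ hd0]

lemma exists_finiteDimensional_corner {x y : A} (hx : x ∈ atomSpan A) (hy : y ∈ atomSpan A) :
    ∃ W : Submodule ℂ A, FiniteDimensional ℂ W ∧ ∀ a : A, x * a * y ∈ W := by
  induction hx using Submodule.span_induction with
  | mem p hp =>
    induction hy using Submodule.span_induction with
    | mem q hq =>
      obtain ⟨v, hv⟩ := IsMinimalProjection.exists_corner hp hq
      refine ⟨Submodule.span ℂ {v}, inferInstance, fun a => ?_⟩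
      obtain ⟨c, hc⟩ := hv a
      exact Submodule.mem_span_singleton.mpr ⟨c, hc.symm⟩
    | zero => exact ⟨⊥, inferInstance, fun a => by simp⟩
    | add y z _ _ hy hz =>
      obtain ⟨V, hV, hV'⟩ := hy
      obtain ⟨W, hW, hW'⟩ := hz
      refine ⟨V ⊔ W, inferInstance, fun a => ?_⟩
      rw [mul_add]
      exact Submodule.add_mem_sup (hV' a) (hW' a)
    | smul c y _ hy =>
      obtain ⟨V, hV, hV'⟩ := hy
      exact ⟨V, hV, fun a => by rw [mul_smul_comm]; exact V.smul_mem c (hV' a)⟩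
  | zero => exact ⟨⊥, inferInstance, fun a => by simp⟩
  | add y z _ _ hy hz =>
    obtain ⟨V, hV, hV'⟩ := hy
    obtain ⟨W, hW, hW'⟩ := hz
    refine ⟨V ⊔ W, inferInstance, fun a => ?_⟩
    rw [add_mul, add_mul]
    exact Submodule.add_mem_sup (hV' a) (hW' a)
  | smul c y _ hy =>
    obtain ⟨V, hV, hV'⟩ := hy
    exact ⟨V, hV, fun a => by rw [smul_mul_assoc, smul_mul_assoc]; exact V.smul_mem c (hV' a)⟩

/-- Approximate `b` by `y` with `y * A * y` finite-dimensional. An interval in the spectrum gives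
infinitely many independent functions of `b` living where `b ≥ 1/2`; a nonzero combination `F` has
`y * F * y = 0`, yet `‖b * F * b‖ ≥ ‖F‖ / 4`. These clash once `y` is close to `b`. -/
lemma not_Icc_subset_of_mem_atomicIdeal {b : A} (hb : b ∈ atomicIdeal A) (hbs : IsSelfAdjoint b) :
    ¬ Set.Icc (0 : ℝ) 1 ⊆ quasispectrum ℝ b := by
  intro hσ
  -- Chosen so that `‖b - y‖ * (2 * ‖b‖ + 1) < 1 / 4`, against the lower bound `‖F‖ / 4`.
  have hδ : 0 < 1 / (8 * (‖b‖ + 1)) := by positivity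
  obtain ⟨y, hy, hby⟩ := Metric.mem_closure_iff.mp hb _ hδ
  rw [dist_eq_norm] at hby
  obtain ⟨W, hW, hyW⟩ := exists_finiteDimensional_corner (A := A) hy hy
  -- The cutoff makes `f P` vanish at `0` and confines it to `x > 1/2`, where `x * x ≥ 1/4`; the
  -- polynomial factor supplies infinitely many dimensions.
  let f : Polynomial ℝ → ℝ → ℝ := fun P x => max 0 (x - 2⁻¹) * P.eval x
  have hfc : ∀ P, Continuous (f P) := fun P =>
    (by fun_prop : Continuous fun x : ℝ => max 0 (x - 2⁻¹)).mul P.continuous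
  have hf0 : ∀ P, f P 0 = 0 := fun P => by simp [f]
  let Λ : Polynomial ℝ →ₗ[ℝ] W.restrictScalars ℝ :=
    { toFun := fun P => ⟨y * cfcₙ (f P) b * y, hyW _⟩
      map_add' := fun P Q => by
        refine Subtype.ext ?_
        have : cfcₙ (f (P + Q)) b = cfcₙ (f P) b + cfcₙ (f Q) b := by
          rw [← cfcₙ_add (f P) (f Q) b (hfc P).continuousOn (hf0 P) (hfc Q).continuousOn (hf0 Q)]
          refine cfcₙ_congr fun x _ => ?_
          simp only [f, Polynomial.eval_add, mul_add]
        change y * cfcₙ (f (P + Q)) b * y = y * cfcₙ (f P) b * y + y * cfcₙ (f Q) b * y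
        rw [this, mul_add, add_mul]
      map_smul' := fun c P => by
        refine Subtype.ext ?_
        have : cfcₙ (f (c • P)) b = c • cfcₙ (f P) b := by
          rw [← cfcₙ_const_mul c (f P) b (hfc P).continuousOn (hf0 P)]
          refine cfcₙ_congr fun x _ => ?_
          simp only [f, Polynomial.eval_smul, smul_eq_mul]
          ring
        change y * cfcₙ (f (c • P)) b * y = c • (y * cfcₙ (f P) b * y)
        rw [this, mul_smul_comm, smul_mul_assoc] }
  have hfin : FiniteDimensional ℝ (W.restrictScalars ℝ) :=
    inferInstanceAs (FiniteDimensional ℝ W)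
  have hninj : ¬ Function.Injective Λ := fun h =>
    Polynomial.not_finite (R := ℝ) (Module.Finite.of_injective Λ h)
  rw [injective_iff_map_eq_zero] at hninj
  push Not at hninj
  obtain ⟨P, hP, hP0⟩ := hninj
  have hP : y * cfcₙ (f P) b * y = 0 := congrArg Subtype.val hP
  set F := cfcₙ (f P) b with hF
  have hF0 : 0 < ‖F‖ := by
    rw [norm_pos_iff]
    intro h0
    apply hP0
    -- If `F = 0`, then `f P` vanishes on the whole spectrum, so every point of `(1/2, 1]` is a root
    -- of `P`.
    refine Polynomial.eq_zero_of_infinite_isRoot P ((Set.Ioc_infinite (by norm_num : (2⁻¹ : ℝ) < 1)).mono ?_)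
    rintro x ⟨hx1, hx2⟩
    have h1 := norm_apply_le_norm_cfcₙ (f P) b (hσ ⟨by linarith, hx2⟩) (hfc P).continuousOn (hf0 P) hbs
    rw [← hF, h0, norm_zero] at h1
    have h2 : f P x = 0 := norm_le_zero_iff.mp h1
    have h3 : max 0 (x - 2⁻¹) ≠ 0 := by
      rw [max_eq_right (by linarith)]
      linarith
    exact (mul_eq_zero.mp h2).resolve_left h3
  have hlow : ‖F‖ / 4 ≤ ‖b * F * b‖ := by
    obtain ⟨⟨x, hx, hxF⟩, -⟩ := IsGreatest.norm_cfcₙ (f P) b (hfc P).continuousOn (hf0 P) hbs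
    have hxF : ‖f P x‖ = ‖F‖ := hxF
    have hx2 : 2⁻¹ < x := by
      by_contra h
      have : f P x = 0 := by
        simp only [f]
        rw [max_eq_left (by linarith), zero_mul]
      rw [this, norm_zero] at hxF
      exact hF0.ne hxF
    have h1 : b * F * b = cfcₙ (fun x => x * f P x * x) b := by
      rw [cfcₙ_mul (fun x => x * f P x) (fun x => x) b (continuous_id.mul (hfc P)).continuousOn
        (by simp) continuousOn_id rfl, cfcₙ_mul (fun x => x) (f P) b continuousOn_id rfl
        (hfc P).continuousOn (hf0 P), cfcₙ_id' ℝ b hbs]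
    have h2 := norm_apply_le_norm_cfcₙ (fun x => x * f P x * x) b hx
      ((continuous_id.mul (hfc P)).mul continuous_id).continuousOn (by simp) hbs
    rw [h1]
    refine le_trans ?_ h2
    rw [norm_mul, norm_mul, hxF, Real.norm_eq_abs, abs_of_pos (by linarith)]
    nlinarith [mul_pos hF0 (by linarith : 0 < x - 2⁻¹)]
  have hup : ‖b * F * b‖ ≤ ‖b - y‖ * ‖F‖ * ‖b‖ + ‖y‖ * ‖F‖ * ‖b - y‖ := by
    have h1 : b * F * b = (b - y) * F * b + y * F * (b - y) := by
      have : b * F * b = (b - y) * F * b + y * F * (b - y) + y * F * y := by noncomm_ring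
      rw [this, hP, add_zero]
    rw [h1]
    refine (norm_add_le _ _).trans (add_le_add ?_ ?_)
    · exact (norm_mul_le _ _).trans (mul_le_mul_of_nonneg_right (norm_mul_le _ _) (norm_nonneg _))
    · exact (norm_mul_le _ _).trans (mul_le_mul_of_nonneg_right (norm_mul_le _ _) (norm_nonneg _))
  have hyb : ‖y‖ ≤ ‖b‖ + ‖b - y‖ := by
    have := norm_sub_le b (b - y)
    rwa [sub_sub_cancel] at this
  have hd : ‖b - y‖ * (8 * (‖b‖ + 1)) < 1 := by
    rwa [lt_div_iff₀ (by positivity)] at hby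
  have hd1 : ‖b - y‖ < 1 := by nlinarith [norm_nonneg b, norm_nonneg (b - y)]
  have : ‖F‖ / 4 ≤ ‖F‖ * (‖b - y‖ * (2 * ‖b‖ + 1)) := by
    have h3 : ‖b - y‖ * ‖F‖ * ‖b‖ + ‖y‖ * ‖F‖ * ‖b - y‖ = ‖F‖ * (‖b - y‖ * (‖b‖ + ‖y‖)) := by ring
    rw [h3] at hup
    refine hlow.trans (hup.trans ?_)
    have h5 : ‖b‖ + ‖y‖ ≤ 2 * ‖b‖ + 1 := by linarith
    gcongr
  have h4 : 1 / 4 ≤ ‖b - y‖ * (2 * ‖b‖ + 1) := by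
    by_contra! h
    have := mul_lt_mul_of_pos_left h hF0
    linarith
  nlinarith [norm_nonneg b, norm_nonneg (b - y)]

end Small

/-! ### Cantor–Bendixson sequences -/

section CantorBendixson

variable {A : Type u} [NonUnitalCStarAlgebra A]

/-! ### Uniqueness of the sequence, and scatteredness from its existence. -/

namespace IsCantorBendixsonSequence

variable {ht : Ordinal.{u}} {I : Ordinal.{u} → ClosedIdeal A}

lemma mono (h : IsCantorBendixsonSequence A ht I) {α β : Ordinal.{u}} (hαβ : α ≤ β) (hβ : β ≤ ht) :
    (I α : Set A) ⊆ I β := by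
  rcases hαβ.eq_or_lt with rfl | hlt
  · exact subset_rfl
  · exact (h.strictMono α β hlt hβ).subset

lemma succ_eq_derived (h : IsCantorBendixsonSequence A ht I) {α : Ordinal.{u}} (hα : α < ht) :
    I (α + 1) = (I α).derived :=
  (ClosedIdeal.coe_atomicPart_eq_image_iff (h.mono (by simp) (Order.add_one_le_of_lt hα))).mp
    (h.succ α hα)

lemma eq_of_le (h : IsCantorBendixsonSequence A ht I) {ht' : Ordinal.{u}}
    {J : Ordinal.{u} → ClosedIdeal A} (h' : IsCantorBendixsonSequence A ht' J) (α : Ordinal.{u})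
    (hα : α ≤ ht) (hα' : α ≤ ht') : I α = J α := by
  induction α using Ordinal.limitRecOn with
  | zero => exact ClosedIdeal.ext_coe (h.zero.trans h'.zero.symm)
  | add_one α ih =>
    have h1 : α < ht := lt_of_lt_of_le (by simp) hα
    have h2 : α < ht' := lt_of_lt_of_le (by simp) hα'
    rw [h.succ_eq_derived h1, h'.succ_eq_derived h2, ih h1.le h2.le]
  | limit α hlim ih =>
    refine ClosedIdeal.ext_coe ?_
    rw [h.limit α hα hlim, h'.limit α hα' hlim]
    congr 1
    refine Set.iUnion₂_congr fun β hβ => ?_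
    rw [ih β hβ (hβ.le.trans hα) (hβ.le.trans hα')]

/-- The sequences agree up to `ht`, where the first is already all of `A`, so the second cannot grow
strictly past it. -/
lemma height_le (h : IsCantorBendixsonSequence A ht I) {ht' : Ordinal.{u}}
    {J : Ordinal.{u} → ClosedIdeal A} (h' : IsCantorBendixsonSequence A ht' J) : ht' ≤ ht := by
  by_contra! hlt
  have h1 := h'.strictMono ht ht' hlt le_rfl
  rw [← h.eq_of_le h' ht le_rfl hlt.le, h.height] at h1
  exact h1.2 (Set.subset_univ _)

lemma unique (h : IsCantorBendixsonSequence A ht I) {ht' : Ordinal.{u}}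
    {J : Ordinal.{u} → ClosedIdeal A} (h' : IsCantorBendixsonSequence A ht' J) :
    ht' = ht ∧ ∀ α ≤ ht, J α = I α := by
  have heq : ht' = ht := le_antisymm (h.height_le h') (h'.height_le h)
  exact ⟨heq, fun α hα => (h.eq_of_le h' α hα (heq ▸ hα)).symm⟩

/-- At the least level `α` where `B` meets `I α` nontrivially, `B` embeds into `A / I β` for all `β
< α`. This rules out limits and, at a successor, places the intersection inside an atomic ideal. -/
lemma isScattered (h : IsCantorBendixsonSequence A ht I) : IsScattered A := by
  intro B hBc hB
  let S : Set Ordinal.{u} := {α | α ≤ ht ∧ ∃ z ∈ B, z ≠ 0 ∧ z ∈ I α}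
  have hS : S.Nonempty := by
    obtain ⟨b, hb, hb0⟩ : ∃ b ∈ B, b ≠ 0 := by
      by_contra! H
      refine hB (le_antisymm (fun b hb => ?_) bot_le)
      rw [H b hb]
      exact zero_mem _
    refine ⟨ht, le_rfl, b, hb, hb0, ?_⟩
    rw [← SetLike.mem_coe, h.height]
    trivial
  obtain ⟨hα, z, hzB, hz0, hzI⟩ := csInf_mem hS
  have hmin : ∀ β < sInf S, ∀ z ∈ B, z ∈ I β → z = 0 := by
    intro β hβ z hz hzI
    by_contra hz0
    exact notMem_of_lt_csInf' hβ ⟨hβ.le.trans hα, z, hz, hz0, hzI⟩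
  generalize sInf S = α at hα hzI hmin
  have hinj : ∀ β < α, Function.Injective
      ((I β).projHom.comp (NonUnitalStarSubalgebraClass.subtype B)) := by
    intro β hβ
    rw [injective_iff_map_eq_zero]
    intro x hx
    exact Subtype.ext (hmin β hβ x x.2 ((I β).proj_eq_zero_iff.mp hx))
  rcases Ordinal.zero_or_succ_or_isSuccLimit α with rfl | ⟨β, rfl⟩ | hlim
  · rw [← SetLike.mem_coe, h.zero] at hzI
    exact absurd hzI hz0
  · rw [Order.succ_eq_add_one] at hα hzI hmin hinj
    have hβ : β < β + 1 := by simp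
    -- `B ∩ I (β + 1)` is an ideal of `B` on which the quotient map by `I β` is injective.
    let F : NonUnitalStarSubalgebra ℂ A :=
      { carrier := {x | x ∈ B ∧ x ∈ I (β + 1)}
        add_mem' := fun hx hy => ⟨add_mem hx.1 hy.1, add_mem (S := ClosedIdeal A) hx.2 hy.2⟩
        zero_mem' := ⟨zero_mem _, zero_mem _⟩
        mul_mem' := fun hx hy => ⟨mul_mem hx.1 hy.1, (I (β + 1)).mul_mem_left' _ hy.2⟩
        smul_mem' := fun c x hx => ⟨SMulMemClass.smul_mem c hx.1, (I (β + 1)).smul_mem' c hx.2⟩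
        star_mem' := fun hx => ⟨star_mem hx.1, (I (β + 1)).star_mem' hx.2⟩ }
    have hFc : IsClosed (F : Set A) := hBc.inter (I (β + 1)).isClosed'
    have hF : NoIntervalSpectrum F := by
      intro b hb hσ
      let φ := (I β).projHom.comp (NonUnitalStarSubalgebraClass.subtype F)
      have hφ : Function.Injective φ := by
        rw [injective_iff_map_eq_zero]
        intro x hx
        exact Subtype.ext (hmin β hβ x x.2.1 ((I β).proj_eq_zero_iff.mp hx))
      have hmem : φ b ∈ atomicIdeal (I β).Quotient := by
        have : (b : A) ∈ (I β).derived := by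
          rw [← h.succ_eq_derived (lt_of_lt_of_le hβ hα)]
          exact b.2.2
        exact this
      refine not_Icc_subset_of_mem_atomicIdeal hmem (hb.map φ) (hσ.trans ?_)
      exact quasispectrum_subset_of_injective_on φ hb fun f _ _ h => hφ (h.trans (map_zero φ).symm)
    obtain ⟨p, hp⟩ := hF.exists_isMinimalProjection (a := ⟨z, hzB, hzI⟩)
      fun h => hz0 (congrArg Subtype.val h)
    have hpp : (p : A) * p = p := congrArg Subtype.val hp.mul_self
    have hps : star (p : A) = p := congrArg Subtype.val hp.star_eq
    have hp0 : (p : A) ≠ 0 := fun h => hp.ne_zero (Subtype.ext h)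
    have hmin' : IsMinimalProjection (⟨p, p.2.1⟩ : B) := by
      refine IsMinimalProjection.of_exists_smul ⟨Subtype.ext hpp, Subtype.ext hps⟩
        (fun h => hp0 (congrArg Subtype.val h)) fun a => ?_
      -- For arbitrary `a ∈ B` the product `p * a` lies in `F`, and `p * (p * a) * p = p * a * p`;
      -- so minimality in `F` gives minimality in `B`.
      obtain ⟨c, hc⟩ := hp.exists_smul ⟨p * a, mul_mem p.2.1 a.2, (I (β + 1)).mul_mem_right' _ p.2.2⟩
      refine ⟨c, Subtype.ext ?_⟩
      have hc : (p : A) * (p * a) * p = c • (p : A) := congrArg Subtype.val hc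
      rw [← mul_assoc, hpp] at hc
      exact hc
    exact hmin'.atomicPart_ne_bot
  · rw [← SetLike.mem_coe, h.limit α hα hlim] at hzI
    obtain ⟨c, hc, hzc⟩ := Metric.mem_closure_iff.mp hzI ‖z‖ (norm_pos_iff.mpr hz0)
    obtain ⟨β, hβ, hcβ⟩ := Set.mem_iUnion₂.mp hc
    -- Injective ⋆-homomorphisms are isometric, so `z` is at distance `‖z‖` from `I β`; this
    -- contradicts the choice of `c ∈ I β` closer than that.
    have h1 := NonUnitalStarAlgHom.norm_map _ (hinj β hβ) ⟨z, hzB⟩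
    have h2 : ((I β).projHom.comp (NonUnitalStarSubalgebraClass.subtype B)) ⟨z, hzB⟩ =
        (I β).proj (z - c) := by
      change (I β).proj z = _
      rw [ClosedIdeal.proj_eq_proj_iff, sub_sub_cancel]
      exact hcβ
    rw [h2] at h1
    have h3 := (I β).norm_proj_le (z - c)
    rw [h1] at h3
    rw [dist_eq_norm] at hzc
    exact absurd h3 (not_le.mpr hzc)

end IsCantorBendixsonSequence

/-! ### Existence of the sequence by transfinite derivation. -/

variable (A) in
/-- The transfinite sequence of ideals obtained by iterating `ClosedIdeal.derived`. -/
noncomputable def derivedSeq (α : Ordinal.{u}) : ClosedIdeal A :=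
  ClosedIdeal.closedSup fun β : Set.Iio α => (derivedSeq β.1).derived
termination_by α
decreasing_by exact β.2

lemma derived_subset_derivedSeq {α β : Ordinal.{u}} (h : β < α) :
    ((derivedSeq A β).derived : Set A) ⊆ derivedSeq A α := by
  conv_rhs => rw [derivedSeq]
  exact ClosedIdeal.subset_closedSup (fun β : Set.Iio α => (derivedSeq A β.1).derived) ⟨β, h⟩

lemma derivedSeq_mono {α β : Ordinal.{u}} (h : β ≤ α) :
    (derivedSeq A β : Set A) ⊆ derivedSeq A α := by
  rcases h.eq_or_lt with rfl | h
  · exact subset_rfl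
  · exact (ClosedIdeal.subset_derived _).trans (derived_subset_derivedSeq h)

/-- In the supremum over `β ≤ α` the term `β = α` dominates, because the derived ideal at `β < α`
already lies in stage `α`. -/
lemma derivedSeq_add_one (α : Ordinal.{u}) : derivedSeq A (α + 1) = (derivedSeq A α).derived := by
  refine ClosedIdeal.ext_coe (Set.Subset.antisymm ?_ (derived_subset_derivedSeq (by simp)))
  conv_lhs => rw [derivedSeq]
  refine ClosedIdeal.closedSup_subset _ ?_
  rintro ⟨β, hβ⟩
  rcases (Order.lt_add_one_iff.mp (Set.mem_Iio.mp hβ)).eq_or_lt with rfl | h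
  · exact subset_rfl
  · exact (derived_subset_derivedSeq h).trans (ClosedIdeal.subset_derived _)

lemma derivedSeq_zero : (derivedSeq A 0 : Set A) = {0} := by
  refine Set.Subset.antisymm ?_ (Set.singleton_subset_iff.mpr (zero_mem _))
  conv_lhs => rw [derivedSeq]
  refine ClosedIdeal.closedSup_subset (J := ClosedIdeal.zeroIdeal A) _ ?_
  rintro ⟨β, hβ⟩
  exact absurd hβ (by simp)

lemma derivedSeq_limit {α : Ordinal.{u}} (hα : Order.IsSuccLimit α) :
    (derivedSeq A α : Set A) = closure (⋃ β < α, (derivedSeq A β : Set A)) := by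
  refine Set.Subset.antisymm ?_ (closure_minimal ?_ (derivedSeq A α).isClosed')
  · have : Nonempty (Set.Iio α) := ⟨⟨0, hα.bot_lt⟩⟩
    conv_lhs => rw [derivedSeq]
    rw [ClosedIdeal.coe_closedSup_of_directed]
    · refine closure_mono (Set.iUnion_subset ?_)
      rintro ⟨β, hβ⟩
      -- The derived ideal at `β` sits inside stage `β + 1`, still below the limit, so the union of
      -- the stages themselves suffices.
      have hβ' : β + 1 < α := by simpa using hα.succ_lt hβ
      refine Set.Subset.trans ?_ (Set.subset_biUnion_of_mem (u := fun β => (derivedSeq A β : Set A)) hβ')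
      exact derived_subset_derivedSeq (by simp)
    · intro β γ
      have key : ∀ β γ : Set.Iio α, β ≤ γ →
          ((derivedSeq A β.1).derived : Set A) ⊆ (derivedSeq A γ.1).derived := by
        intro β γ h
        rw [← derivedSeq_add_one, ← derivedSeq_add_one]
        exact derivedSeq_mono (by simpa using h)
      rcases le_total β γ with h | h
      · exact ⟨γ, key β γ h, subset_rfl⟩
      · exact ⟨β, subset_rfl, key γ β h⟩
  · exact Set.iUnion₂_subset fun β hβ => derivedSeq_mono hβ.le

/-- The quotient is nonzero and inherits the spectral condition, so it has a minimal projection,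
whose lifts are in the derived ideal but not in `I`. -/
lemma NoIntervalSpectrum.ssubset_derived (hA : NoIntervalSpectrum A) {I : ClosedIdeal A}
    (hI : (I : Set A) ≠ Set.univ) : (I : Set A) ⊂ I.derived := by
  refine ⟨I.subset_derived, fun hsub => ?_⟩
  obtain ⟨a, ha⟩ := (Set.ne_univ_iff_exists_notMem _).mp hI
  obtain ⟨p, hp⟩ := (hA.of_surjective I.projHom I.projHom_surjective).exists_isMinimalProjection
    (a := I.proj a) fun h => ha (I.proj_eq_zero_iff.mp h)
  obtain ⟨b, rfl⟩ := I.proj_surjective p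
  exact hp.ne_zero (I.proj_eq_zero_iff.mpr (hsub hp.mem_atomicIdeal))

/-- Otherwise the strictly increasing stages would inject all ordinals of the universe into the
small type of closed ideals. -/
lemma NoIntervalSpectrum.exists_derivedSeq_eq_univ (hA : NoIntervalSpectrum A) :
    ∃ α : Ordinal.{u}, (derivedSeq A α : Set A) = Set.univ := by
  by_contra! H
  refine not_injective_of_ordinal (derivedSeq A) (fun α β heq => ?_)
  by_contra hne
  wlog h : α < β generalizing α β
  · exact this β α heq.symm (Ne.symm hne) (lt_of_le_of_ne (not_lt.mp h) (Ne.symm hne))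
  have := (hA.ssubset_derived (H α)).trans_subset (derived_subset_derivedSeq h)
  rw [heq] at this
  exact this.2 subset_rfl

lemma NoIntervalSpectrum.exists_isCantorBendixsonSequence (hA : NoIntervalSpectrum A) :
    ∃ (ht : Ordinal.{u}) (I : Ordinal.{u} → ClosedIdeal A), IsCantorBendixsonSequence A ht I := by
  have hne : {α : Ordinal.{u} | (derivedSeq A α : Set A) = Set.univ}.Nonempty :=
    hA.exists_derivedSeq_eq_univ
  refine ⟨sInf {α | (derivedSeq A α : Set A) = Set.univ}, derivedSeq A, ?_⟩
  exact
    { zero := derivedSeq_zero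
      height := csInf_mem hne
      strictMono := fun α β h hβ => by
        have : (derivedSeq A α : Set A) ≠ Set.univ := fun h' =>
          notMem_of_lt_csInf' (h.trans_le hβ) h'
        exact (hA.ssubset_derived this).trans_subset (derived_subset_derivedSeq h)
      limit := fun β _ hβ => derivedSeq_limit hβ
      succ := fun α _ => (ClosedIdeal.coe_atomicPart_eq_image_iff (derivedSeq_mono (by simp))).mpr
        (derivedSeq_add_one α) }

end CantorBendixson

/-! ### Matrix units -/

/-- A system of matrix units `e i j` of a C⋆-algebra, together with the matrix coefficients. -/
structure MatrixUnits (K : Type v) [NonUnitalCStarAlgebra K] where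
  e : ℕ → ℕ → K
  coeff : ℕ → ℕ → K →ₗ[ℂ] ℂ
  ne_zero : ∀ i j, e i j ≠ 0
  mul_eq : ∀ i j j' k, e i j * e j' k = if j = j' then e i k else 0
  star_eq : ∀ i j, star (e i j) = e j i
  mul_mul_eq : ∀ i i' j j' k, e i i' * k * e j j' = coeff i' j k • e i j'

namespace MatrixUnits

variable {K : Type v} [NonUnitalCStarAlgebra K] (E : MatrixUnits K)

lemma mul_self (i j k : ℕ) : E.e i j * E.e j k = E.e i k := by rw [E.mul_eq, if_pos rfl]

variable {E} in
lemma smul_injective {c d : ℂ} {i j : ℕ} (h : c • E.e i j = d • E.e i j) : c = d := by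
  have : (c - d) • E.e i j = 0 := by rw [sub_smul, h, sub_self]
  exact sub_eq_zero.mp ((smul_eq_zero.mp this).resolve_right (E.ne_zero i j))

lemma coeff_star (k : K) (i j : ℕ) : E.coeff i j (star k) = star (E.coeff j i k) := by
  refine smul_injective (E := E) (i := i) (j := j) ?_
  have h := congrArg star (E.mul_mul_eq j j i i k)
  rw [star_mul, star_mul, star_smul, E.star_eq, E.star_eq, E.star_eq, ← mul_assoc,
    E.mul_mul_eq] at h
  exact h

lemma coeff_mul_e_mul (k l : K) (i j m : ℕ) :
    E.coeff i j (k * E.e m m * l) = E.coeff i m k * E.coeff m j l := by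
  refine smul_injective (E := E) (i := i) (j := j) ?_
  rw [← E.mul_mul_eq i i j j]
  calc E.e i i * (k * E.e m m * l) * E.e j j
      = E.e i i * (k * (E.e m m * E.e m m) * l) * E.e j j := by rw [E.mul_self]
    _ = (E.e i i * k * E.e m m) * (E.e m m * l * E.e j j) := by noncomm_ring
    _ = _ := by
      rw [E.mul_mul_eq, E.mul_mul_eq, smul_mul_assoc, mul_smul_comm, E.mul_self, smul_smul]

lemma coeff_e (i j i' j' : ℕ) : E.coeff i j (E.e i' j') = if i = i' ∧ j = j' then 1 else 0 := by
  refine smul_injective (E := E) (i := i) (j := j) ?_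
  rw [← E.mul_mul_eq i i j j, E.mul_eq]
  by_cases h : i = i'
  · subst h
    rw [if_pos rfl, E.mul_eq]
    by_cases h' : j = j'
    · subst h'
      simp
    · rw [if_neg (Ne.symm h'), if_neg (fun h => h' h.2), zero_smul]
  · rw [if_neg h, zero_mul, if_neg (fun h' => h h'.1), zero_smul]

/-- The projection `∑ i < n, e i i`. -/
noncomputable def finProj (n : ℕ) : K := ∑ i ∈ Finset.range n, E.e i i

lemma isStarProjection_finProj (n : ℕ) : IsStarProjection (E.finProj n) := by
  constructor
  · change E.finProj n * E.finProj n = E.finProj n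
    rw [finProj, Finset.sum_mul_sum]
    refine Finset.sum_congr rfl fun i hi => ?_
    simp only [E.mul_eq]
    rw [Finset.sum_ite_eq, if_pos hi]
  · change star (E.finProj n) = E.finProj n
    rw [finProj, star_sum]
    simp only [E.star_eq]

lemma norm_finProj_le (n : ℕ) : ‖E.finProj n‖ ≤ 1 := by
  by_cases h : E.finProj n = 0
  · simp [h]
  · exact ((E.isStarProjection_finProj n).norm_eq_one h).le

lemma finProj_mul_mul_finProj (k : K) (n : ℕ) : E.finProj n * k * E.finProj n =
    ∑ i ∈ Finset.range n, ∑ j ∈ Finset.range n, E.coeff i j k • E.e i j := by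
  rw [finProj, Finset.sum_mul, Finset.sum_mul]
  refine Finset.sum_congr rfl fun i _ => ?_
  rw [Finset.mul_sum]
  refine Finset.sum_congr rfl fun j _ => ?_
  rw [E.mul_mul_eq]

/-- Inserting the finite projection truncates the matrix product to a finite sum, so coefficients
multiply exactly. -/
lemma coeff_mul_finProj_mul (k l : K) (n i j : ℕ) :
    E.coeff i j (k * E.finProj n * l) = ∑ m ∈ Finset.range n, E.coeff i m k * E.coeff m j l := by
  rw [finProj, Finset.mul_sum, Finset.sum_mul, map_sum]
  exact Finset.sum_congr rfl fun m _ => E.coeff_mul_e_mul k l i j m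

lemma coeff_finProj_mul_mul_finProj (k : K) {n i j : ℕ} (hi : i < n) (hj : j < n) :
    E.coeff i j (E.finProj n * k * E.finProj n) = E.coeff i j k := by
  simp only [E.finProj_mul_mul_finProj, map_sum, map_smul, E.coeff_e, smul_eq_mul, mul_ite,
    mul_one, mul_zero, ite_and]
  simp [hi, hj]

end MatrixUnits

/-- A system of matrix units spanning a dense subspace. -/
structure CompleteMatrixUnits (K : Type v) [NonUnitalCStarAlgebra K] extends MatrixUnits K where
  tendsto_finProj_mul : ∀ k : K,
    Filter.Tendsto (fun n => toMatrixUnits.finProj n * k) Filter.atTop (nhds k)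

namespace CompleteMatrixUnits

variable {K : Type v} [NonUnitalCStarAlgebra K] (E : CompleteMatrixUnits K)

lemma tendsto_mul_finProj (k : K) :
    Filter.Tendsto (fun n => k * E.finProj n) Filter.atTop (nhds k) := by
  have h := (continuous_star.tendsto _).comp (E.tendsto_finProj_mul (star k))
  rw [star_star] at h
  refine h.congr fun n => ?_
  rw [Function.comp_apply, star_mul, star_star,
    (E.isStarProjection_finProj n).isSelfAdjoint.star_eq]

lemma tendsto_finProj_mul_mul_finProj (k : K) :
    Filter.Tendsto (fun n => E.finProj n * k * E.finProj n) Filter.atTop (nhds k) := by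
  have h1 : Filter.Tendsto (fun n => (E.finProj n * k - k) * E.finProj n + k * E.finProj n)
      Filter.atTop (nhds (0 + k)) := by
    refine Filter.Tendsto.add ?_ (E.tendsto_mul_finProj k)
    refine squeeze_zero_norm (a := fun n => ‖E.finProj n * k - k‖) (fun n => ?_) ?_
    · exact (norm_mul_le _ _).trans (mul_le_of_le_one_right (norm_nonneg _) (E.norm_finProj_le n))
    · have := ((E.tendsto_finProj_mul k).sub_const k).norm
      rwa [sub_self, norm_zero] at this
  rw [zero_add] at h1
  exact h1.congr fun n => by rw [sub_mul, sub_add_cancel]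

end CompleteMatrixUnits

/-! ### The matrix units of the compact operators on `ℓ₂`. -/

namespace KEllTwo

open InnerProductSpace

/-- The standard basis vectors of `ℓ₂`. -/
noncomputable def basisVec (i : ℕ) : lp (fun _ : ℕ => ℂ) 2 := lp.single 2 i (1 : ℂ)

lemma inner_basisVec (i : ℕ) (x : lp (fun _ : ℕ => ℂ) 2) : inner ℂ (basisVec i) x = x i := by
  rw [basisVec, lp.inner_single_left]
  simp

lemma basisVec_apply (i j : ℕ) : basisVec i j = if i = j then 1 else 0 := by
  rw [basisVec, lp.single_apply, Pi.single_apply]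
  simp only [eq_comm]

lemma isCompactOperator_rankOne {H : Type*} [NormedAddCommGroup H] [InnerProductSpace ℂ H]
    (x y : H) : IsCompactOperator (rankOne ℂ x y) := by
  have h : IsCompactOperator (innerSL ℂ y) :=
    isCompactOperator_of_locallyCompactSpace_dom (innerSL ℂ y)
  exact h.clm_comp (ContinuousLinearMap.toSpanSingleton ℂ x)

/-- The rank one operators between basis vectors. -/
noncomputable def basisOp (i j : ℕ) : KEllTwo :=
  ⟨rankOne ℂ (basisVec i) (basisVec j), isCompactOperator_rankOne _ _⟩

lemma basisOp_apply (i j : ℕ) (x : lp (fun _ : ℕ => ℂ) 2) :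
    (basisOp i j).1 x = x j • basisVec i := by
  rw [← inner_basisVec]
  rfl

lemma ext_apply {k l : KEllTwo} (h : ∀ x, k.1 x = l.1 x) : k = l :=
  Subtype.ext (ContinuousLinearMap.ext h)

/-- The matrix units of `𝓚(ℓ₂)`. -/
noncomputable def matrixUnits : MatrixUnits KEllTwo where
  e := basisOp
  coeff i j :=
    { toFun := fun k => (k.1 (basisVec j)) i
      map_add' := fun _ _ => rfl
      map_smul' := fun _ _ => rfl }
  ne_zero i j h := by
    have h1 : ((basisOp i j).1 (basisVec j)) i = 0 := by rw [h]; rfl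
    rw [basisOp_apply, lp.coeFn_smul, Pi.smul_apply, basisVec_apply, basisVec_apply] at h1
    simp at h1
  mul_eq i j j' k := by
    refine ext_apply fun x => ?_
    change (basisOp i j).1 ((basisOp j' k).1 x) = _
    rw [basisOp_apply, basisOp_apply, lp.coeFn_smul, Pi.smul_apply, basisVec_apply]
    split_ifs with h h' h'
    · rw [basisOp_apply, smul_eq_mul, mul_one]
    · exact absurd h.symm h'
    · exact absurd h'.symm h
    · simp
  star_eq i j := by
    refine Subtype.ext ?_
    change star (rankOne ℂ (basisVec i) (basisVec j)) = rankOne ℂ (basisVec j) (basisVec i)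
    rw [ContinuousLinearMap.star_eq_adjoint, adjoint_rankOne]
  mul_mul_eq i i' j j' k := by
    refine ext_apply fun x => ?_
    change (basisOp i i').1 (k.1 ((basisOp j j').1 x)) =
      ((k.1 (basisVec j)) i') • (basisOp i j').1 x
    rw [basisOp_apply, basisOp_apply, basisOp_apply, map_smul, lp.coeFn_smul, Pi.smul_apply,
      smul_smul, smul_eq_mul, mul_comm]

lemma finProj_apply (n : ℕ) (x : lp (fun _ : ℕ => ℂ) 2) :
    (matrixUnits.finProj n).1 x = ∑ i ∈ Finset.range n, lp.single 2 i (x i) := by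
  have h : (matrixUnits.finProj n).1 = ∑ i ∈ Finset.range n, (basisOp i i).1 :=
    map_sum (NonUnitalStarSubalgebraClass.subtype
      (compactOperators (lp (fun _ : ℕ => ℂ) 2))) _ _
  rw [h, sum_apply]
  refine Finset.sum_congr rfl fun i _ => ?_
  rw [basisOp_apply, basisVec, ← lp.single_smul, smul_eq_mul, mul_one]

lemma tendsto_finProj_apply (x : lp (fun _ : ℕ => ℂ) 2) :
    Filter.Tendsto (fun n => (matrixUnits.finProj n).1 x) Filter.atTop (nhds x) := by
  simp only [finProj_apply]
  exact (lp.hasSum_single (by norm_num) x).tendsto_sum_nat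

/-- A bounded sequence of operators converging strongly to the identity converges uniformly on the
image of the unit ball under a compact operator. -/
lemma tendsto_mul_of_isCompactOperator {H : Type*} [NormedAddCommGroup H] [InnerProductSpace ℂ H]
    {P : ℕ → H →L[ℂ] H} (hP : ∀ n, ‖P n‖ ≤ 1)
    (hPx : ∀ x, Filter.Tendsto (fun n => P n x) Filter.atTop (nhds x)) {k : H →L[ℂ] H}
    (hk : IsCompactOperator k) :
    Filter.Tendsto (fun n => P n * k) Filter.atTop (nhds k) := by
  rw [Metric.tendsto_nhds]
  intro ε hε
  have hK : TotallyBounded (k '' Metric.closedBall 0 1) :=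
    ((IsCompactOperator.isCompact_closure_image_closedBall
      (f := (k : H →ₗ[ℂ] H)) hk 1).totallyBounded).subset subset_closure
  obtain ⟨t, ht, hcov⟩ := Metric.totallyBounded_iff.mp hK (ε / 4) (by positivity)
  -- Strong convergence is uniform on a finite `ε / 4`-net of the image of the ball; `‖P n‖ ≤ 1`
  -- extends it to the whole image at the cost of two more errors of `ε / 4`.
  have hev : ∀ᶠ n in Filter.atTop, ∀ y ∈ t, dist (P n y) y < ε / 4 := by
    rw [Filter.eventually_all_finite ht]
    exact fun y _ => Metric.tendsto_nhds.mp (hPx y) _ (by positivity)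
  filter_upwards [hev] with n hn
  rw [dist_eq_norm]
  have hle : ‖P n * k - k‖ ≤ 3 * (ε / 4) := by
    refine ContinuousLinearMap.opNorm_le_of_unit_norm (𝕜 := ℂ) (by positivity) fun x hx => ?_
    have hmem := hcov ⟨x, by simp [hx], rfl⟩
    obtain ⟨y, hy, hxy⟩ := Set.mem_iUnion₂.mp hmem
    rw [Metric.mem_ball, dist_eq_norm] at hxy
    have h1 := hn y hy
    rw [dist_eq_norm] at h1
    have h2 : ‖P n (k x - y)‖ ≤ ‖k x - y‖ :=
      ((P n).le_opNorm _).trans (mul_le_of_le_one_left (norm_nonneg _) (hP n))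
    have h3 : (P n * k - k) x = P n (k x - y) + (P n y - y) - (k x - y) := by
      rw [map_sub]
      change P n (k x) - k x = _
      abel
    rw [h3]
    refine (norm_sub_le _ _).trans ?_
    refine (add_le_add_left (norm_add_le _ _) _).trans ?_
    linarith
  linarith

/-- The matrix units of `𝓚(ℓ₂)` span a dense subspace. -/
noncomputable def completeMatrixUnits : CompleteMatrixUnits KEllTwo where
  toMatrixUnits := matrixUnits
  tendsto_finProj_mul k := by
    refine tendsto_subtype_rng.mpr ?_
    exact tendsto_mul_of_isCompactOperator (P := fun n => (matrixUnits.finProj n).1)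
      matrixUnits.norm_finProj_le tendsto_finProj_apply k.2

end KEllTwo

/-! ### The norm of elementary tensors with matrix units -/

section Nondegenerate

variable {A : Type u} [NonUnitalCStarAlgebra A] {K : Type v} [NonUnitalCStarAlgebra K]
  (E : CompleteMatrixUnits K) {B : Type*} [CStarAlgebra B]
  (ι : A →⋆ₙₐ[ℂ] B)

/-- The diagonal embedding into the matrix algebra. -/
noncomputable def diagHom (n : ℕ) : A →⋆ₙₐ[ℂ] CStarMatrix (Fin n) (Fin n) B where
  toFun a := CStarMatrix.ofMatrix (Matrix.diagonal fun _ => ι a)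
  map_smul' c a := by
    ext i j
    change Matrix.diagonal (fun _ => ι (c • a)) i j = c • Matrix.diagonal (fun _ => ι a) i j
    rw [Matrix.diagonal_apply, Matrix.diagonal_apply, map_smul]
    split_ifs <;> simp
  map_zero' := by
    ext i j
    change Matrix.diagonal (fun _ => ι 0) i j = 0
    rw [map_zero, Matrix.diagonal_zero]
    rfl
  map_add' a b := by
    ext i j
    change Matrix.diagonal (fun _ => ι (a + b)) i j =
      Matrix.diagonal (fun _ => ι a) i j + Matrix.diagonal (fun _ => ι b) i j
    simp only [Matrix.diagonal_apply, map_add]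
    split_ifs <;> simp
  map_mul' a b := by
    have h : (Matrix.diagonal fun _ : Fin n => ι (a * b)) =
        Matrix.diagonal (fun _ => ι a) * Matrix.diagonal (fun _ => ι b) := by
      rw [Matrix.diagonal_mul_diagonal, map_mul]
    exact congrArg CStarMatrix.ofMatrix h
  map_star' a := by
    ext i j
    change Matrix.diagonal (fun _ => ι (star a)) i j =
      star (Matrix.diagonal (fun _ => ι a) j i)
    simp only [Matrix.diagonal_apply, map_star]
    by_cases h : i = j
    · subst h
      simp
    · rw [if_neg h, if_neg (Ne.symm h), star_zero]

variable (B) in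
/-- The matrix of coefficients. -/
noncomputable def coeffMatrix (n : ℕ) : K →ₗ[ℂ] CStarMatrix (Fin n) (Fin n) B where
  toFun k := CStarMatrix.ofMatrix (Matrix.of fun i j => algebraMap ℂ B (E.coeff i j k))
  map_add' k l := by
    ext i j
    change algebraMap ℂ B (E.coeff i j (k + l)) = algebraMap ℂ B (E.coeff i j k) +
      algebraMap ℂ B (E.coeff i j l)
    rw [map_add, map_add]
  map_smul' c k := by
    ext i j
    change algebraMap ℂ B (E.coeff i j (c • k)) = c • algebraMap ℂ B (E.coeff i j k)
    rw [map_smul, smul_eq_mul, map_mul, Algebra.smul_def]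

lemma coeffMatrix_apply (n : ℕ) (k : K) (i j : Fin n) :
    coeffMatrix E B n k i j = algebraMap ℂ B (E.coeff i j k) := rfl

lemma coeffMatrix_star (n : ℕ) (k : K) : coeffMatrix E B n (star k) = star (coeffMatrix E B n k) := by
  ext i j
  change algebraMap ℂ B (E.coeff i j (star k)) = star (algebraMap ℂ B (E.coeff j i k))
  rw [E.coeff_star, algebraMap_star_comm]

lemma coeffMatrix_mul (n : ℕ) (k l : K) :
    coeffMatrix E B n (k * E.finProj n * l) = coeffMatrix E B n k * coeffMatrix E B n l := by
  ext i j
  change algebraMap ℂ B (E.coeff i j (k * E.finProj n * l)) =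
    ∑ m : Fin n, algebraMap ℂ B (E.coeff i m k) * algebraMap ℂ B (E.coeff m j l)
  rw [E.coeff_mul_finProj_mul, map_sum, Finset.sum_range]
  simp only [map_mul]

lemma coeffMatrix_mul_diagHom (n : ℕ) (k : K) (a : A) :
    coeffMatrix E B n k * diagHom ι n a = diagHom ι n a * coeffMatrix E B n k := by
  let M : Matrix (Fin n) (Fin n) B := Matrix.of fun i j => algebraMap ℂ B (E.coeff i j k)
  have h : M * Matrix.diagonal (fun _ => ι a) = Matrix.diagonal (fun _ => ι a) * M := by
    ext i j
    rw [Matrix.mul_diagonal, Matrix.diagonal_mul]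
    exact Algebra.commutes _ _
  exact congrArg CStarMatrix.ofMatrix h

/-- The compression of the algebraic tensor product to matrices. -/
noncomputable def compression (n : ℕ) : A ⊗[ℂ] K →ₗ[ℂ] CStarMatrix (Fin n) (Fin n) B :=
  TensorProduct.lift ((LinearMap.mul ℂ (CStarMatrix (Fin n) (Fin n) B)).compl₁₂
    (diagHom ι n : A →ₗ[ℂ] CStarMatrix (Fin n) (Fin n) B) (coeffMatrix E B n))

lemma compression_tmul (n : ℕ) (a : A) (k : K) :
    compression E ι n (a ⊗ₜ k) = diagHom ι n a * coeffMatrix E B n k := rfl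

lemma compression_star (n : ℕ) (x : A ⊗[ℂ] K) :
    compression E ι n (star x) = star (compression E ι n x) := by
  induction x with
  | zero => simp
  | add x y hx hy => rw [star_add, map_add, map_add, star_add, hx, hy]
  | tmul a k =>
    rw [TensorProduct.star_tmul, compression_tmul, compression_tmul, star_mul,
      ← map_star (diagHom ι n), ← coeffMatrix_star, coeffMatrix_mul_diagHom]

variable [PartialOrder B] [StarOrderedRing B]

/-- Only the compression of `k` by the `n`-th projection matters, and on that closed corner the
coefficient matrix is a ⋆-homomorphism, hence contractive. -/
lemma norm_coeffMatrix_le (n : ℕ) (k : K) : ‖coeffMatrix E B n k‖ ≤ ‖k‖ := by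
  have hp := E.isStarProjection_finProj n
  have hpp : E.finProj n * E.finProj n = E.finProj n := hp.isIdempotentElem
  have hps : star (E.finProj n) = E.finProj n := hp.isSelfAdjoint
  let C : NonUnitalStarSubalgebra ℂ K :=
    { carrier := {k | E.finProj n * k = k ∧ k * E.finProj n = k}
      add_mem' := fun hx hy => ⟨by rw [mul_add, hx.1, hy.1], by rw [add_mul, hx.2, hy.2]⟩
      zero_mem' := ⟨mul_zero _, zero_mul _⟩
      mul_mem' := fun hx hy => ⟨by rw [← mul_assoc, hx.1], by rw [mul_assoc, hy.2]⟩
      smul_mem' := fun c x hx => ⟨by rw [mul_smul_comm, hx.1], by rw [smul_mul_assoc, hx.2]⟩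
      star_mem' := fun {x} hx => by
        constructor
        · have := congrArg star hx.2
          rwa [star_mul, hps] at this
        · have := congrArg star hx.1
          rwa [star_mul, hps] at this }
  have hC : IsClosed (C : Set K) :=
    (isClosed_eq (continuous_const_mul _) continuous_id).inter
      (isClosed_eq (continuous_mul_const _) continuous_id)
  let φ : C →⋆ₙₐ[ℂ] CStarMatrix (Fin n) (Fin n) B :=
    { toFun := fun k => coeffMatrix E B n k
      map_smul' := fun c k => map_smul (coeffMatrix E B n) c (k : K)
      map_zero' := map_zero (coeffMatrix E B n)
      map_add' := fun k l => map_add (coeffMatrix E B n) (k : K) l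
      map_mul' := fun k l => by
        rw [← coeffMatrix_mul, k.2.2]
        rfl
      map_star' := fun k => coeffMatrix_star E n k }
  have hmem : E.finProj n * k * E.finProj n ∈ C :=
    ⟨by rw [← mul_assoc, ← mul_assoc, hpp], by rw [mul_assoc, hpp]⟩
  have h1 : coeffMatrix E B n k = φ ⟨_, hmem⟩ := by
    ext i j
    change algebraMap ℂ B (E.coeff i j k) =
      algebraMap ℂ B (E.coeff i j (E.finProj n * k * E.finProj n))
    rw [E.coeff_finProj_mul_mul_finProj k i.2 j.2]
  rw [h1]
  refine (NonUnitalStarAlgHom.norm_apply_le φ _).trans ?_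
  change ‖E.finProj n * k * E.finProj n‖ ≤ ‖k‖
  calc ‖E.finProj n * k * E.finProj n‖ ≤ ‖E.finProj n‖ * ‖k‖ * ‖E.finProj n‖ :=
        (norm_mul_le _ _).trans (mul_le_mul_of_nonneg_right (norm_mul_le _ _) (norm_nonneg _))
    _ ≤ 1 * ‖k‖ * 1 := by
        gcongr
        · exact E.norm_finProj_le n
        · exact E.norm_finProj_le n
    _ = ‖k‖ := by ring

lemma norm_compression_tmul_le (n : ℕ) (a : A) (k : K) :
    ‖compression E ι n (a ⊗ₜ k)‖ ≤ ‖a‖ * ‖k‖ := by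
  rw [compression_tmul]
  exact (norm_mul_le _ _).trans (mul_le_mul (NonUnitalStarAlgHom.norm_apply_le _ _)
    (norm_coeffMatrix_le E n k) (norm_nonneg _) (norm_nonneg _))

/-- The compressions are not multiplicative, but on elementary tensors the defect is the compression
of `(a * b) ⊗ₜ (k * (l - E.finProj n * l))`, whose second factor tends to `0`. -/
lemma tendsto_compression_mul (x y : A ⊗[ℂ] K) :
    Filter.Tendsto (fun n => ‖compression E ι n (x * y) - compression E ι n x * compression E ι n y‖)
      Filter.atTop (nhds 0) := by
  have hadd : ∀ f g h : (n : ℕ) → CStarMatrix (Fin n) (Fin n) B, (∀ n, f n = g n + h n) →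
      Filter.Tendsto (fun n => ‖g n‖) Filter.atTop (nhds 0) →
      Filter.Tendsto (fun n => ‖h n‖) Filter.atTop (nhds 0) →
      Filter.Tendsto (fun n => ‖f n‖) Filter.atTop (nhds 0) := by
    intro f g h hf hg hh
    refine squeeze_zero (fun n => norm_nonneg _) (fun n => ?_) (by simpa using hg.add hh)
    rw [hf]
    exact norm_add_le _ _
  induction x with
  | zero => simp
  | add x x' hx hx' =>
    refine hadd _ _ _ (fun n => ?_) hx hx'
    rw [add_mul, map_add, map_add, add_mul]
    abel
  | tmul a k =>
    induction y with
    | zero => simp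
    | add y y' hy hy' =>
      refine hadd _ _ _ (fun n => ?_) hy hy'
      rw [mul_add, map_add, map_add, mul_add]
      abel
    | tmul b l =>
      have h1 : ∀ n, compression E ι n (a ⊗ₜ k * b ⊗ₜ l) -
          compression E ι n (a ⊗ₜ k) * compression E ι n (b ⊗ₜ l) =
          compression E ι n ((a * b) ⊗ₜ (k * (l - E.finProj n * l))) := by
        intro n
        rw [Algebra.TensorProduct.tmul_mul_tmul]
        simp only [compression_tmul]
        rw [mul_sub, map_sub, mul_sub, ← mul_assoc k, coeffMatrix_mul, map_mul]
        congr 1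
        simp only [mul_assoc]
        rw [← mul_assoc (coeffMatrix E B n k), coeffMatrix_mul_diagHom]
        simp only [mul_assoc]
      simp only [h1]
      have h2 := ((E.tendsto_finProj_mul l).const_sub l).norm.const_mul (‖a * b‖ * ‖k‖)
      rw [sub_self, norm_zero, mul_zero] at h2
      refine squeeze_zero (fun n => norm_nonneg _) (fun n => ?_) h2
      refine (norm_compression_tmul_le E ι n _ _).trans ?_
      rw [mul_assoc]
      exact mul_le_mul_of_nonneg_left (norm_mul_le _ _) (norm_nonneg _)

lemma exists_norm_compression_le (x : A ⊗[ℂ] K) : ∃ C, ∀ n, ‖compression E ι n x‖ ≤ C := by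
  induction x with
  | zero => exact ⟨0, fun n => by simp⟩
  | add x y hx hy =>
    obtain ⟨C, hC⟩ := hx
    obtain ⟨D, hD⟩ := hy
    refine ⟨C + D, fun n => ?_⟩
    rw [map_add]
    exact (norm_add_le _ _).trans (add_le_add (hC n) (hD n))
  | tmul a k => exact ⟨_, fun n => norm_compression_tmul_le E ι n a k⟩

/-- Boundedness gives a limit along a fixed ultrafilter, so ordinary convergence of the norms is not
needed. -/
lemma exists_tendsto_norm_compression (x : A ⊗[ℂ] K) :
    ∃ c, Filter.Tendsto (fun n => ‖compression E ι n x‖) (Filter.hyperfilter ℕ) (nhds c) := by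
  obtain ⟨C, hC⟩ := exists_norm_compression_le E ι x
  obtain ⟨c, -, hc⟩ := (isCompact_Icc (a := 0) (b := C)).ultrafilter_le_nhds
    ((Filter.hyperfilter ℕ).map fun n => ‖compression E ι n x‖)
    (Filter.le_principal_iff.mpr (Filter.Eventually.of_forall (f := (Filter.hyperfilter ℕ : Filter ℕ))
      fun n => ⟨norm_nonneg _, hC n⟩))
  exact ⟨c, hc⟩

/-- The C⋆-seminorm obtained as the ultralimit of the norms of the compressions. -/
noncomputable def compressionSeminorm : CStarSeminorm A K :=
  have hlim := fun x => (exists_tendsto_norm_compression E ι x).choose_spec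
  have hzero : ∀ {f : ℕ → ℝ}, Filter.Tendsto f Filter.atTop (nhds 0) →
      Filter.Tendsto f (Filter.hyperfilter ℕ) (nhds 0) :=
    fun h => h.mono_left Nat.hyperfilter_le_atTop
  { Seminorm.of (fun x => (exists_tendsto_norm_compression E ι x).choose)
      (fun x y => le_of_tendsto_of_tendsto' (hlim (x + y)) ((hlim x).add (hlim y)) fun n => by
        rw [map_add]
        exact norm_add_le _ _)
      (fun c x => tendsto_nhds_unique (hlim (c • x)) (((hlim x).const_mul ‖c‖).congr fun n => by
        rw [map_smul, norm_smul])) with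
    mul_le' := fun x y => by
      -- The multiplicative defect disappears in the limit, leaving submultiplicativity of the
      -- matrix norms; the C⋆-identity is obtained in the same way.
      have h0 := (hzero (tendsto_compression_mul E ι x y)).add ((hlim x).mul (hlim y))
      rw [zero_add] at h0
      refine le_of_tendsto_of_tendsto' (hlim (x * y)) h0 fun n => ?_
      have h1 := norm_add_le (compression E ι n (x * y) - compression E ι n x * compression E ι n y)
        (compression E ι n x * compression E ι n y)
      rw [sub_add_cancel] at h1
      exact h1.trans (add_le_add_right (norm_mul_le _ _) _)
    star_mul_self' := fun x => by
      refine tendsto_nhds_unique (hlim (star x * x)) ?_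
      have h1 : Filter.Tendsto (fun n => ‖compression E ι n (star x * x)‖ -
          ‖compression E ι n x‖ * ‖compression E ι n x‖) (Filter.hyperfilter ℕ) (nhds 0) := by
        refine squeeze_zero_norm (fun n => ?_) (hzero (tendsto_compression_mul E ι (star x) x))
        rw [← CStarRing.norm_star_mul_self, compression_star]
        exact abs_norm_sub_norm_le _ _
      have h2 := h1.add ((hlim x).mul (hlim x))
      rw [zero_add] at h2
      exact h2.congr fun n => sub_add_cancel _ _
    tmul_le' := fun a k => le_of_tendsto' (hlim _) fun n => norm_compression_tmul_le E ι n a k }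

/-- Once `n` exceeds `i` and `j`, `ι a` is an entry of the compressed matrix, and entries are
bounded by the matrix norm. -/
lemma norm_le_compressionSeminorm (a : A) (i j : ℕ) :
    ‖ι a‖ ≤ (compressionSeminorm E ι).toSeminorm (a ⊗ₜ E.e i j) := by
  refine ge_of_tendsto (exists_tendsto_norm_compression E ι (a ⊗ₜ E.e i j)).choose_spec ?_
  refine Nat.hyperfilter_le_atTop ?_
  filter_upwards [Filter.eventually_gt_atTop i, Filter.eventually_gt_atTop j] with n hi hj
  have h := CStarMatrix.norm_entry_le_norm (M := compression E ι n (a ⊗ₜ E.e i j))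
    (i := ⟨i, hi⟩) (j := ⟨j, hj⟩)
  have h1 : compression E ι n (a ⊗ₜ E.e i j) ⟨i, hi⟩ ⟨j, hj⟩ = ι a := by
    rw [compression_tmul, CStarMatrix.mul_apply]
    simp only [coeffMatrix_apply, E.coeff_e]
    rw [Finset.sum_eq_single ⟨i, hi⟩]
    · have : diagHom ι n a ⟨i, hi⟩ ⟨i, hi⟩ = ι a := Matrix.diagonal_apply_eq _ _
      rw [this]
      simp
    · intro b _ hb
      have : ¬ (b : ℕ) = i := fun h => hb (Fin.ext h)
      simp [this]
    · simp
  rwa [h1] at h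

end Nondegenerate

section NormTmul

variable {A : Type u} [NonUnitalCStarAlgebra A] {K : Type v} [NonUnitalCStarAlgebra K]

lemma norm_tmul (a : A) (k : K) : ‖CStarTensor.tmul a k‖ = maxNorm (a ⊗ₜ[ℂ] k) :=
  CStarTensor.norm_ofAlg _

lemma norm_tmul_le (a : A) (k : K) : ‖CStarTensor.tmul a k‖ ≤ ‖a‖ * ‖k‖ := by
  rw [norm_tmul]
  exact ciSup_le fun p => p.tmul_le' a k

/-- The maximal seminorm dominates the one built from compressions over the unitization, into which
`A` embeds isometrically. Hence `a ↦ a ⊗ e i j` is injective with closed range. -/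
lemma CompleteMatrixUnits.norm_le_norm_tmul (E : CompleteMatrixUnits K) (a : A) (i j : ℕ) :
    ‖a‖ ≤ ‖CStarTensor.tmul a (E.e i j)‖ := by
  let _ := CStarAlgebra.spectralOrder (Unitization ℂ A)
  have _ := CStarAlgebra.spectralOrderedRing (Unitization ℂ A)
  have h1 := norm_le_compressionSeminorm E (Unitization.inrNonUnitalStarAlgHom ℂ A) a i j
  rw [Unitization.inrNonUnitalStarAlgHom_apply, Unitization.norm_inr] at h1
  rw [norm_tmul]
  exact h1.trans (CStarSeminorm.le_maxNorm _ _)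

end NormTmul

/-! ### Ideals of the tensor product with an algebra with matrix units -/

section ApproximateUnit

variable {A : Type u} [NonUnitalCStarAlgebra A]

/-- A closed subspace containing all `u * a * star u` contains `a`. -/
lemma mem_of_forall_mul_mul_star_mem {M : Submodule ℂ A} (hM : IsClosed (M : Set A)) {a : A}
    (h : ∀ u, u * a * star u ∈ M) : a ∈ M := by
  let _ := CStarAlgebra.spectralOrder A
  have _ := CStarAlgebra.spectralOrderedRing A
  have hl := CStarAlgebra.increasingApproximateUnit A
  have hne : (CStarAlgebra.approximateUnit A).NeBot := hl.neBot
  -- A rewriting of `u * a * u` that isolates the errors of left and right multiplication by the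
  -- approximate unit.
  have h1 : Filter.Tendsto (fun u : A => (u * a - a) * u + a * u) (CStarAlgebra.approximateUnit A)
      (nhds (0 + a)) := by
    refine Filter.Tendsto.add ?_ (hl.tendsto_mul_left a)
    refine squeeze_zero_norm' (a := fun u => ‖u * a - a‖) ?_ ?_
    · filter_upwards [hl.eventually_norm] with u hu
      exact (norm_mul_le _ _).trans (mul_le_of_le_one_right (norm_nonneg _) hu)
    · have := ((hl.tendsto_mul_right a).sub_const a).norm
      rwa [sub_self, norm_zero] at this
  rw [zero_add] at h1
  refine hM.mem_of_tendsto h1 ?_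
  filter_upwards [hl.eventually_star_eq] with u hu
  rw [sub_mul, sub_add_cancel]
  have := h u
  rwa [hu] at this

/-- A closed subspace containing all `s * a * t` with `s`, `t` in a total set contains `a`. -/
lemma mem_of_forall_mul_mul_mem {S : Set A} (hS : Dense (Submodule.span ℂ S : Set A))
    {M : Submodule ℂ A} (hM : IsClosed (M : Set A)) {a : A}
    (h : ∀ s ∈ S, ∀ t ∈ S, s * a * t ∈ M) : a ∈ M := by
  refine mem_of_forall_mul_mul_star_mem hM fun u => ?_
  have hl : ∀ t ∈ S, ∀ x : A, x * a * t ∈ M := fun t ht x => by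
    have h1 : Submodule.span ℂ S ≤ M.comap (LinearMap.mulRight ℂ t ∘ₗ LinearMap.mulRight ℂ a) :=
      Submodule.span_le.mpr fun s hs => h s hs t ht
    have h2 := closure_mono h1 (hS x)
    exact (hM.preimage ((continuous_mul_const t).comp (continuous_mul_const a))).closure_subset h2
  have h1 : Submodule.span ℂ S ≤ M.comap (LinearMap.mulLeft ℂ (u * a)) :=
    Submodule.span_le.mpr fun t ht => hl t ht u
  exact (hM.preimage (continuous_const_mul (u * a))).closure_subset (closure_mono h1 (hS (star u)))

end ApproximateUnit

/-! ### Elementary tensors, corners and the ideal correspondence. -/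

namespace CStarTensor

variable {A : Type u} [NonUnitalCStarAlgebra A] {K : Type v} [NonUnitalCStarAlgebra K]

variable (A K) in
/-- The elementary tensors as a bilinear map. -/
noncomputable def tmulLin : A →ₗ[ℂ] K →ₗ[ℂ] CStarTensor A K :=
  (TensorProduct.mk ℂ A K).compr₂ (ofAlg (A := A) (B := K)).toLinearMap

lemma add_tmul (a b : A) (k : K) : tmul (a + b) k = tmul a k + tmul b k :=
  (tmulLin A K).map_add₂ a b k

lemma smul_tmul (c : ℂ) (a : A) (k : K) : tmul (c • a) k = c • tmul a k :=
  (tmulLin A K).map_smul₂ c a k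

lemma zero_tmul (k : K) : tmul (0 : A) k = 0 := (tmulLin A K).map_zero₂ k

lemma tmul_smul (c : ℂ) (a : A) (k : K) : tmul a (c • k) = c • tmul a k :=
  (tmulLin A K a).map_smul c k

variable (A) in
/-- The map `a ↦ a ⊗ k`. -/
noncomputable def tmulRight (k : K) : A →L[ℂ] CStarTensor A K :=
  ((tmulLin A K).flip k).mkContinuous ‖k‖ fun a => (norm_tmul_le a k).trans_eq (mul_comm _ _)

lemma tmulRight_apply (k : K) (a : A) : tmulRight A k a = tmul a k := rfl

/-- The map `k ↦ a ⊗ k`. -/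
noncomputable def tmulLeft (a : A) : K →L[ℂ] CStarTensor A K :=
  (tmulLin A K a).mkContinuous ‖a‖ fun k => norm_tmul_le a k

variable (E : CompleteMatrixUnits K)

lemma tmul_e_injective (i j : ℕ) : Function.Injective (tmulRight A (E.e i j)) := by
  rw [injective_iff_map_eq_zero]
  intro a ha
  have := E.norm_le_norm_tmul a i j
  rw [← tmulRight_apply, ha, norm_zero] at this
  exact norm_le_zero_iff.mp this

lemma isClosedEmbedding_tmul_e (i j : ℕ) :
    Topology.IsClosedEmbedding (tmulRight A (E.e i j)) := by
  refine AntilipschitzWith.isClosedEmbedding (K := 1) ?_ (tmulRight A (E.e i j)).uniformContinuous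
  refine AddMonoidHomClass.antilipschitz_of_bound _ fun a => ?_
  rw [NNReal.coe_one, one_mul]
  exact E.norm_le_norm_tmul a i j

/-- A closed subspace containing `a ⊗ e i j` for all `i`, `j` contains all `a ⊗ k`. -/
lemma tmul_mem_of_forall_tmul_e_mem {M : Submodule ℂ (CStarTensor A K)}
    (hM : IsClosed (M : Set (CStarTensor A K))) {a : A} (h : ∀ i j, tmul a (E.e i j) ∈ M) (k : K) :
    tmul a k ∈ M := by
  refine hM.mem_of_tendsto (((tmulLeft a).continuous.tendsto k).comp
    (E.tendsto_finProj_mul_mul_finProj k)) (Filter.Eventually.of_forall fun n => ?_)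
  change tmulLeft a (E.finProj n * k * E.finProj n) ∈ M
  rw [E.finProj_mul_mul_finProj, map_sum]
  refine Submodule.sum_mem _ fun i _ => ?_
  rw [map_sum]
  refine Submodule.sum_mem _ fun j _ => ?_
  rw [map_smul]
  exact M.smul_mem _ (h i j)

/-- A closed subspace containing all `a ⊗ e i j` is everything. -/
lemma eq_top_of_forall_tmul_e_mem {M : Submodule ℂ (CStarTensor A K)}
    (hM : IsClosed (M : Set (CStarTensor A K))) (h : ∀ a i j, tmul a (E.e i j) ∈ M) : M = ⊤ := by
  rw [eq_top_iff, ← Submodule.dense_iff_topologicalClosure_eq_top.mp (dense_span_tmul (A := A) (B := K))]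
  refine Submodule.topologicalClosure_minimal _ (Submodule.span_le.mpr ?_) hM
  rintro _ ⟨a, k, rfl⟩
  exact tmul_mem_of_forall_tmul_e_mem E hM (h a) k

lemma dense_span_tmul_e :
    Dense (Submodule.span ℂ {x : CStarTensor A K | ∃ a i j, x = tmul a (E.e i j)} :
      Set (CStarTensor A K)) := by
  rw [Submodule.dense_iff_topologicalClosure_eq_top]
  exact eq_top_of_forall_tmul_e_mem E (Submodule.isClosed_topologicalClosure _) fun a i j =>
    Submodule.le_topologicalClosure _ (Submodule.subset_span ⟨a, i, j, rfl⟩)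

/-- The sandwich sends each `a ⊗ e m n` into the range of `b ↦ b ⊗ e i j`; as that range is closed,
it receives all of `A ⊗ K`. -/
lemma exists_eq_tmul_e (x : CStarTensor A K) (u u' : A) (i k l j : ℕ) :
    ∃ b : A, tmul u (E.e i k) * x * tmul u' (E.e l j) = tmul b (E.e i j) := by
  let R : Submodule ℂ (CStarTensor A K) := LinearMap.range (tmulRight A (E.e i j)).toLinearMap
  have hR : IsClosed (R : Set (CStarTensor A K)) := by
    have := (isClosedEmbedding_tmul_e (A := A) E i j).isClosed_range
    exact this
  let Λ : CStarTensor A K →ₗ[ℂ] CStarTensor A K :=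
    LinearMap.mulRight ℂ (tmul u' (E.e l j)) ∘ₗ LinearMap.mulLeft ℂ (tmul u (E.e i k))
  have hΛ : Continuous Λ := (continuous_mul_const (tmul u' (E.e l j))).comp
    (continuous_const_mul (tmul u (E.e i k)))
  have htop : R.comap Λ = ⊤ := by
    refine eq_top_of_forall_tmul_e_mem E (hR.preimage hΛ) fun a m n => ?_
    refine ⟨E.coeff k l (E.e m n) • (u * a * u'), ?_⟩
    change tmul _ _ = tmul u (E.e i k) * tmul a (E.e m n) * tmul u' (E.e l j)
    rw [tmul_mul_tmul, tmul_mul_tmul, E.mul_mul_eq, tmul_smul, smul_tmul]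
  obtain ⟨b, hb⟩ : x ∈ R.comap Λ := htop ▸ Submodule.mem_top
  exact ⟨b, hb.symm⟩

/-- The embedding `a ↦ a ⊗ e 0 0`. -/
noncomputable def corner : A →⋆ₙₐ[ℂ] CStarTensor A K where
  toFun a := tmul a (E.e 0 0)
  map_smul' c a := smul_tmul c a _
  map_zero' := zero_tmul _
  map_add' a b := add_tmul a b _
  map_mul' a b := by rw [tmul_mul_tmul, E.mul_self]
  map_star' a := by rw [star_tmul, E.star_eq]

lemma corner_injective : Function.Injective (corner (A := A) E) := tmul_e_injective E 0 0

lemma tmul_mem_tensor {I : ClosedIdeal A} {a : A} (ha : a ∈ I) (k : K) : tmul a k ∈ I.tensor K :=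
  Submodule.le_topologicalClosure _ (Submodule.subset_span ⟨a, ha, k, rfl⟩)

lemma tensor_subset {I : ClosedIdeal A} {M : Submodule ℂ (CStarTensor A K)}
    (hM : IsClosed (M : Set (CStarTensor A K))) (h : ∀ a ∈ I, ∀ k, tmul a k ∈ M) :
    (I.tensor K : Set (CStarTensor A K)) ⊆ M := by
  refine Submodule.topologicalClosure_minimal _ (Submodule.span_le.mpr ?_) hM
  rintro _ ⟨a, ha, k, rfl⟩
  exact h a ha k

/-- Multiplying by `u ⊗ e i' i` and `star u ⊗ e j j'` moves the matrix position, at the cost of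
replacing `a` by `u * a * star u`; an approximate unit removes the `u`. -/
lemma tmul_e_mem_iff {N : ClosedIdeal (CStarTensor A K)} {a : A} (i j : ℕ) :
    tmul a (E.e i j) ∈ N ↔ corner E a ∈ N := by
  have key : ∀ i j i' j', tmul a (E.e i j) ∈ N → tmul a (E.e i' j') ∈ N := by
    intro i j i' j' h
    refine mem_of_forall_mul_mul_star_mem
      (M := N.toSubmodule.comap (tmulRight A (E.e i' j')).toLinearMap)
      (N.isClosed'.preimage (tmulRight A (E.e i' j')).continuous) fun u => ?_
    have h1 : tmul u (E.e i' i) * tmul a (E.e i j) * tmul (star u) (E.e j j') ∈ N :=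
      N.mul_mem_right' _ (N.mul_mem_left' _ h)
    rw [tmul_mul_tmul, tmul_mul_tmul, E.mul_self, E.mul_self] at h1
    exact h1
  exact ⟨key _ _ _ _, key _ _ _ _⟩

/-- Every closed ideal of `A ⊗ K` is of the form `I ⊗ K`. -/
lemma eq_tensor_comap_corner (N : ClosedIdeal (CStarTensor A K)) :
    N = (N.comap (corner E)).tensor K := by
  refine ClosedIdeal.ext_coe (Set.Subset.antisymm (fun x hx => ?_) ?_)
  · refine mem_of_forall_mul_mul_mem (M := ((N.comap (corner E)).tensor K).toSubmodule)
      (dense_span_tmul_e E) ((N.comap (corner E)).tensor K).isClosed' ?_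
    rintro _ ⟨u, i, k, rfl⟩ _ ⟨u', l, j, rfl⟩
    obtain ⟨b, hb⟩ := exists_eq_tmul_e E x u u' i k l j
    have hN : tmul u (E.e i k) * x * tmul u' (E.e l j) ∈ N :=
      N.mul_mem_right' _ (N.mul_mem_left' _ hx)
    rw [hb] at hN ⊢
    have hb' : b ∈ N.comap (corner E) := (tmul_e_mem_iff E i j).mp hN
    have := tmul_mem_tensor hb' (E.e i j)
    exact this
  · have key : ∀ a, corner E a ∈ N → ∀ k, tmul a k ∈ N.toSubmodule := fun a ha =>
      tmul_mem_of_forall_tmul_e_mem E N.isClosed' fun i j => (tmul_e_mem_iff E i j).mpr ha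
    exact tensor_subset (I := N.comap (corner E)) (M := N.toSubmodule) N.isClosed' key

/-! ### Functoriality -/

section Map

variable {B : Type u} [NonUnitalCStarAlgebra B] (φ : A →⋆ₙₐ[ℂ] B)

variable (K) in
/-- The map `φ ⊗ id` on the algebraic tensor products. -/
noncomputable def algMap : A ⊗[ℂ] K →ₗ[ℂ] B ⊗[ℂ] K :=
  TensorProduct.map (φ : A →ₗ[ℂ] B) LinearMap.id

lemma algMap_tmul (a : A) (k : K) : algMap K φ (a ⊗ₜ k) = φ a ⊗ₜ k := rfl

lemma algMap_mul (x y : A ⊗[ℂ] K) : algMap K φ (x * y) = algMap K φ x * algMap K φ y := by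
  induction x with
  | zero => simp
  | add x x' hx hx' => rw [add_mul, map_add, map_add, add_mul, hx, hx']
  | tmul a k =>
    induction y with
    | zero => simp
    | add y y' hy hy' => rw [mul_add, map_add, map_add, mul_add, hy, hy']
    | tmul b l =>
      simp only [Algebra.TensorProduct.tmul_mul_tmul, algMap_tmul, map_mul]

lemma algMap_star (x : A ⊗[ℂ] K) : algMap K φ (star x) = star (algMap K φ x) := by
  induction x with
  | zero => simp
  | add x x' hx hx' => rw [star_add, map_add, map_add, star_add, hx, hx']
  | tmul a k => simp only [TensorProduct.star_tmul, algMap_tmul, map_star]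

/-- A C⋆-seminorm on `B ⊗ K` pulls back to one on `A ⊗ K`, so it is already counted in the supremum.
-/
lemma maxNorm_algMap_le (x : A ⊗[ℂ] K) : maxNorm (algMap K φ x) ≤ maxNorm x := by
  refine ciSup_le fun p => ?_
  let q : CStarSeminorm A K :=
    { p.toSeminorm.comp (algMap K φ) with
      mul_le' := fun x y => (congrArg p.toSeminorm (algMap_mul φ x y)).trans_le (p.mul_le' _ _)
      star_mul_self' := fun x => by
        refine Eq.trans ?_ (p.star_mul_self' (algMap K φ x))
        exact congrArg p.toSeminorm ((algMap_mul φ _ x).trans (by rw [algMap_star]))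
      tmul_le' := fun a k => (p.tmul_le' (φ a) k).trans
        (mul_le_mul_of_nonneg_right (NonUnitalStarAlgHom.norm_apply_le φ a) (norm_nonneg k)) }
  exact q.le_maxNorm x

/-- The linear map `φ ⊗ id`. -/
noncomputable def mapL : CStarTensor A K →L[ℂ] CStarTensor B K :=
  LinearMap.extendOfNorm (((ofAlg (A := B) (B := K)).toLinearMap ∘ₗ algMap K φ :
    A ⊗[ℂ] K →ₗ[ℂ] CStarTensor B K) : AlgTensor A K →ₗ[ℂ] CStarTensor B K)
    (ofAlg (A := A) (B := K)).toLinearMap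

lemma mapL_ofAlg (x : AlgTensor A K) :
    mapL φ (ofAlg x) = ofAlg (algMap K φ x : AlgTensor B K) := by
  refine LinearMap.extendOfNorm_eq (e := (ofAlg (A := A) (B := K)).toLinearMap)
    denseRange_ofAlg ⟨1, fun x => ?_⟩ x
  rw [one_mul]
  refine (norm_ofAlg (algMap K φ x : AlgTensor B K)).trans_le ?_
  exact (maxNorm_algMap_le φ x).trans_eq (norm_ofAlg x).symm

variable (K) in
/-- The ⋆-homomorphism `φ ⊗ id`. -/
noncomputable def map : CStarTensor A K →⋆ₙₐ[ℂ] CStarTensor B K where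
  toFun := mapL φ
  map_smul' := map_smul (mapL φ)
  map_zero' := map_zero (mapL φ)
  map_add' := map_add (mapL φ)
  map_mul' x y := by
    induction x using induction_on with
    | hp =>
      exact isClosed_eq ((mapL φ).continuous.comp (continuous_mul_const y))
        ((mapL φ).continuous.mul continuous_const)
    | ih x =>
      induction y using induction_on with
      | hp =>
        exact isClosed_eq ((mapL φ).continuous.comp (continuous_const_mul _))
          (continuous_const.mul (mapL φ).continuous)
      | ih y =>
        rw [← ofAlg_mul, mapL_ofAlg, mapL_ofAlg, mapL_ofAlg]
        exact (congrArg ofAlg (algMap_mul φ x y)).trans (ofAlg_mul (A := B) (B := K) _ _)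
  map_star' x := by
    induction x using induction_on with
    | hp =>
      exact isClosed_eq ((mapL φ).continuous.comp continuous_star)
        (continuous_star.comp (mapL φ).continuous)
    | ih x =>
      rw [← ofAlg_star, mapL_ofAlg, mapL_ofAlg]
      exact (congrArg ofAlg (algMap_star φ x)).trans (ofAlg_star (A := B) (B := K) _)

lemma map_tmul (a : A) (k : K) : map K φ (tmul a k) = tmul (φ a) k :=
  mapL_ofAlg φ (a ⊗ₜ[ℂ] k : A ⊗[ℂ] K)

lemma map_corner (a : A) : map K φ (corner E a) = corner E (φ a) := map_tmul φ a _

include E in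
-- Exactness from the ideal correspondence: the kernel is a closed ideal, so it is determined by its
-- trace on the corner, which is `ker φ`.
lemma mem_ker_map_iff {x : CStarTensor A K} :
    x ∈ ClosedIdeal.ker (map K φ) ↔ x ∈ (ClosedIdeal.ker φ).tensor K := by
  have : (ClosedIdeal.ker (map K φ)).comap (corner E) = ClosedIdeal.ker φ := by
    refine ClosedIdeal.ext_coe (Set.ext fun a => ?_)
    change map K φ (corner E a) = 0 ↔ φ a = 0
    rw [map_corner, map_eq_zero_iff _ (corner_injective E)]
  rw [eq_tensor_comap_corner E (ClosedIdeal.ker (map K φ)), this]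

lemma range_map : Set.range (map K φ) =
    closure (Submodule.span ℂ {t : CStarTensor B K | ∃ a : A, ∃ k : K, t = tmul (φ a) k} :
      Submodule ℂ (CStarTensor B K)) := by
  refine Set.Subset.antisymm ?_ (closure_minimal ?_ (isClosed_range_hom _))
  · rintro _ ⟨x, rfl⟩
    have hd := map_mem_closure (continuous_hom (map K φ)) (dense_span_tmul x)
      (t := (Submodule.span ℂ {t : CStarTensor B K | ∃ a : A, ∃ k : K, t = tmul (φ a) k} :
        Submodule ℂ (CStarTensor B K))) ?_
    · exact hd
    · intro y hy
      refine (Submodule.span_le (p := (Submodule.span ℂ {t : CStarTensor B K |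
        ∃ a : A, ∃ k : K, t = tmul (φ a) k}).comap
          (map K φ : CStarTensor A K →ₗ[ℂ] CStarTensor B K))).mpr ?_ hy
      rintro _ ⟨a, k, rfl⟩
      exact Submodule.subset_span ⟨a, k, map_tmul φ a k⟩
  · have : Submodule.span ℂ {t : CStarTensor B K | ∃ a : A, ∃ k : K, t = tmul (φ a) k} ≤
        LinearMap.range (map K φ : CStarTensor A K →ₗ[ℂ] CStarTensor B K) := by
      refine Submodule.span_le.mpr ?_
      rintro _ ⟨a, k, rfl⟩
      exact ⟨tmul a k, map_tmul φ a k⟩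
    exact this

lemma map_surjective (hφ : Function.Surjective φ) : Function.Surjective (map K φ) := by
  rw [← Set.range_eq_univ, range_map, ← (dense_span_tmul (A := B) (B := K)).closure_eq]
  congr 3
  ext t
  constructor
  · rintro ⟨a, k, rfl⟩
    exact ⟨φ a, k, rfl⟩
  · rintro ⟨b, k, rfl⟩
    obtain ⟨a, rfl⟩ := hφ b
    exact ⟨a, k, rfl⟩

end Map

include E in
/-- `a ⊗ e 0 0 ∈ I ⊗ K` if and only if `a ∈ I`. -/
lemma corner_mem_tensor_iff {I : ClosedIdeal A} {a : A} : corner E a ∈ I.tensor K ↔ a ∈ I := by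
  refine ⟨fun h => ?_, fun h => tmul_mem_tensor h _⟩
  have h1 : (I.tensor K : Set (CStarTensor A K)) ⊆ (ClosedIdeal.ker (map K I.projHom)).toSubmodule :=
    tensor_subset (ClosedIdeal.ker (map K I.projHom)).isClosed' fun a ha k => by
      change map K I.projHom (tmul a k) = 0
      rw [map_tmul, I.projHom_apply, I.proj_eq_zero_iff.mpr ha, zero_tmul]
  have h2 : map K I.projHom (corner E a) = 0 := h1 h
  rw [map_corner, map_eq_zero_iff _ (corner_injective E)] at h2
  exact I.proj_eq_zero_iff.mp h2

include E in
-- Reduces identities between ideals of `A ⊗ K` to a membership test on the corner.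
lemma eq_tensor_iff {N : ClosedIdeal (CStarTensor A K)} {I : ClosedIdeal A} :
    N = I.tensor K ↔ ∀ a, corner E a ∈ N ↔ a ∈ I := by
  constructor
  · rintro rfl a
    exact corner_mem_tensor_iff E
  · intro h
    rw [eq_tensor_comap_corner E N]
    congr 1
    exact ClosedIdeal.ext_coe (Set.ext h)

end CStarTensor

/-! ### The atomic ideal of the tensor product -/

namespace CStarTensor

variable {A : Type u} [NonUnitalCStarAlgebra A] {K : Type v} [NonUnitalCStarAlgebra K]
  (E : CompleteMatrixUnits K)

/-- Cutting `A ⊗ K` by `p ⊗ e 0 0` leaves only `p * A * p` tensored with `e 0 0`, so scalarity is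
the same condition on both sides. -/
lemma isMinimalProjection_corner_iff {p : A} :
    IsMinimalProjection (corner E p) ↔ IsMinimalProjection p := by
  have hinj := corner_injective (A := A) E
  constructor
  · intro h
    refine IsMinimalProjection.of_exists_smul ⟨?_, ?_⟩ ?_ fun a => ?_
    · exact hinj (by rw [map_mul, h.mul_self])
    · exact hinj (by rw [map_star, h.star_eq])
    · rintro rfl
      exact h.ne_zero (map_zero _)
    · obtain ⟨c, hc⟩ := h.exists_smul (corner E a)
      exact ⟨c, hinj (by rw [map_mul, map_mul, hc, map_smul])⟩
  · intro h
    refine IsMinimalProjection.of_exists_smul ⟨?_, ?_⟩ ?_ fun x => ?_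
    · change corner E p * corner E p = corner E p
      rw [← map_mul, h.mul_self]
    · change star (corner E p) = corner E p
      rw [← map_star, h.star_eq]
    · exact (map_ne_zero_iff _ hinj).mpr h.ne_zero
    · obtain ⟨b, hb⟩ := exists_eq_tmul_e E x p p 0 0 0 0
      have hb : corner E p * x * corner E p = corner E b := hb
      obtain ⟨c, hc⟩ := h.exists_smul b
      refine ⟨c, ?_⟩
      rw [← map_smul, ← hc, map_mul, map_mul, ← hb]
      have hpp : corner E p * corner E p = corner E p := by rw [← map_mul, h.mul_self]
      calc corner E p * x * corner E p
          = (corner E p * corner E p) * x * (corner E p * corner E p) := by rw [hpp]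
        _ = _ := by noncomm_ring

include E in
-- The nontrivial inclusion cuts a minimal `q` of `A ⊗ K` by `u ⊗ e 0 0`: the result is zero or a
-- nonzero multiple of a minimal projection, and it lies in the corner, so that projection comes
-- from a minimal projection of `A`.
lemma atomicIdeal_eq_tensor :
    atomicIdeal (CStarTensor A K) = (atomicIdeal A).tensor K := by
  rw [eq_tensor_iff E]
  intro a
  constructor
  · intro ha
    refine mem_of_forall_mul_mul_star_mem (M := (atomicIdeal A).toSubmodule)
      (atomicIdeal A).isClosed' fun u => ?_
    let Λ : CStarTensor A K →ₗ[ℂ] CStarTensor A K :=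
      LinearMap.mulRight ℂ (star (corner E u)) ∘ₗ LinearMap.mulLeft ℂ (corner E u)
    have hΛ : Continuous Λ := (continuous_mul_const (star (corner E u))).comp
      (continuous_const_mul (corner E u))
    set M := ((atomicIdeal A).tensor K).toSubmodule.comap Λ with hM
    have hMc : IsClosed (M : Set (CStarTensor A K)) := ((atomicIdeal A).tensor K).isClosed'.preimage hΛ
    have hle : atomSpan (CStarTensor A K) ≤ M := by
      refine Submodule.span_le.mpr fun q hq => ?_
      have hq : IsMinimalProjection q := hq
      change corner E u * q * star (corner E u) ∈ (atomicIdeal A).tensor K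
      have h1 : corner E u * q * star (corner E u) = (corner E u * q) * star (corner E u * q) := by
        rw [star_mul, hq.star_eq, mul_assoc, mul_assoc, ← mul_assoc q, hq.mul_self]
      by_cases h0 : corner E u * q = 0
      · rw [h0, zero_mul]
        exact zero_mem _
      obtain ⟨c, hc, q', hq', hcq⟩ := hq.exists_smul_mul_star
        (by rw [mul_assoc, hq.mul_self]) h0
      obtain ⟨b, hb⟩ := exists_eq_tmul_e E q u (star u) 0 0 0 0
      have hb : corner E u * q * corner E (star u) = corner E b := hb
      rw [map_star, h1, hcq] at hb
      have hq'' : q' = corner E (c⁻¹ • b) := by rw [map_smul, ← hb, inv_smul_smul₀ hc]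
      rw [hq'', isMinimalProjection_corner_iff] at hq'
      rw [h1, hcq, hq'']
      have h2 : corner E (c⁻¹ • b) ∈ (atomicIdeal A).tensor K :=
        tmul_mem_tensor hq'.mem_atomicIdeal _
      exact ((atomicIdeal A).tensor K).smul_mem' c h2
    have h1 : corner E a ∈ M := closure_minimal hle hMc ha
    have h2 : corner E (u * a * star u) ∈ (atomicIdeal A).tensor K := by
      rw [map_mul, map_mul, map_star]
      exact h1
    exact (corner_mem_tensor_iff E).mp h2
  · have key : (atomicIdeal A : Set A) ⊆ (atomicIdeal (CStarTensor A K)).comap (corner E) := by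
      refine closure_minimal ?_ ((atomicIdeal (CStarTensor A K)).comap (corner E)).isClosed'
      have : atomSpan A ≤ ((atomicIdeal (CStarTensor A K)).comap (corner E)).toSubmodule :=
        Submodule.span_le.mpr fun p hp =>
          ((isMinimalProjection_corner_iff E).mpr hp).mem_atomicIdeal
      exact this
    exact fun ha => key ha

/-! ### Quotients and the derived ideals -/

include E in
lemma mem_tensor_iff_map_projHom_eq_zero (I : ClosedIdeal A) (x : CStarTensor A K) :
    x ∈ I.tensor K ↔ map K I.projHom x = 0 := by
  have h : ClosedIdeal.ker I.projHom = I := ClosedIdeal.ext_coe (Set.ext fun a => I.proj_eq_zero_iff)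
  have := mem_ker_map_iff E I.projHom (x := x)
  rw [h] at this
  exact this.symm

include E in
-- The isomorphism `(A ⊗ K) / (I ⊗ K) ≅ (A / I) ⊗ K` preserves atomic ideals and takes the class of
-- `a ⊗ e 0 0` to `[a] ⊗ e 0 0`, so the corner test reduces to `A / I`.
lemma derived_tensor (I : ClosedIdeal A) : (I.tensor K).derived = I.derived.tensor K := by
  rw [eq_tensor_iff E]
  intro a
  rw [ClosedIdeal.mem_derived, ClosedIdeal.mem_derived,
    ← map_mem_atomicIdeal_iff ((I.tensor K).quotientEquiv (map K I.projHom)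
      (mem_tensor_iff_map_projHom_eq_zero E I) (map_surjective I.projHom I.projHom_surjective)),
    ClosedIdeal.quotientEquiv_proj, map_corner, atomicIdeal_eq_tensor E, corner_mem_tensor_iff E]
  rfl

lemma tensor_mono {I J : ClosedIdeal A} (h : (I : Set A) ⊆ J) :
    (I.tensor K : Set (CStarTensor A K)) ⊆ J.tensor K :=
  tensor_subset (M := (J.tensor K).toSubmodule) (J.tensor K).isClosed' fun _ ha k =>
    tmul_mem_tensor (h ha) k

include E in
lemma subset_of_tensor_subset {I J : ClosedIdeal A}
    (h : (I.tensor K : Set (CStarTensor A K)) ⊆ J.tensor K) : (I : Set A) ⊆ J := fun _ ha =>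
  (corner_mem_tensor_iff E).mp (h ((corner_mem_tensor_iff E).mpr ha))

include E in
lemma tensor_eq_univ {I : ClosedIdeal A} (h : (I : Set A) = Set.univ) :
    (I.tensor K : Set (CStarTensor A K)) = Set.univ := by
  have := eq_top_of_forall_tmul_e_mem E (M := (I.tensor K).toSubmodule) (I.tensor K).isClosed'
    fun a i j => tmul_mem_tensor (I := I) (h.symm ▸ Set.mem_univ a : a ∈ (I : Set A)) _
  exact congrArg SetLike.coe this

include E in
lemma zeroIdeal_tensor : (ClosedIdeal.zeroIdeal A).tensor K = ClosedIdeal.zeroIdeal (CStarTensor A K) :=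
  ((eq_tensor_iff E).mpr fun _ => map_eq_zero_iff _ (corner_injective E)).symm

include E in
-- `I ↦ I ⊗ K` is an order isomorphism onto the closed ideals of `A ⊗ K`, so it preserves suprema.
lemma closedSup_tensor {ι : Sort*} (F : ι → ClosedIdeal A) :
    (ClosedIdeal.closedSup F).tensor K = ClosedIdeal.closedSup fun i => (F i).tensor K := by
  refine ClosedIdeal.ext_coe (Set.Subset.antisymm ?_ ?_)
  · rw [eq_tensor_comap_corner E (ClosedIdeal.closedSup fun i => (F i).tensor K)]
    refine tensor_mono (ClosedIdeal.closedSup_subset F fun i a ha => ?_)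
    exact ClosedIdeal.subset_closedSup (fun i => (F i).tensor K) i
      ((corner_mem_tensor_iff E).mpr ha)
  · exact ClosedIdeal.closedSup_subset _ fun i => tensor_mono (ClosedIdeal.subset_closedSup F i)

/-! ### Subquotients -/

section Subquotient

variable (J : ClosedIdeal A)

/-- The inclusion of an ideal. -/
def _root_.ScatteredCStar.ClosedIdeal.incl : J →⋆ₙₐ[ℂ] A where
  toFun := Subtype.val
  map_smul' _ _ := rfl
  map_zero' := rfl
  map_add' _ _ := rfl
  map_mul' _ _ := rfl
  map_star' _ := rfl

lemma range_map_incl : Set.range (map K J.incl) = J.tensor K := by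
  rw [range_map]
  change _ = closure ((Submodule.span ℂ {t : CStarTensor A K | ∃ x ∈ J, ∃ k : K, t = tmul x k} :
    Submodule ℂ (CStarTensor A K)) : Set (CStarTensor A K))
  congr 3
  ext t
  constructor
  · rintro ⟨a, k, rfl⟩
    exact ⟨a, a.2, k, rfl⟩
  · rintro ⟨a, ha, k, rfl⟩
    exact ⟨⟨a, ha⟩, k, rfl⟩

include E in
-- The kernel is the zero ideal tensored with `K`; hence `J ⊗ K` formed intrinsically agrees with
-- the closed span inside `A ⊗ K`.
lemma map_incl_injective : Function.Injective (map K J.incl) := by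
  rw [injective_iff_map_eq_zero]
  intro x hx
  have hi : ∀ a : J, (a : A) = 0 ↔ a = 0 := fun a => ZeroMemClass.coe_eq_zero
  have h : ClosedIdeal.ker J.incl = ClosedIdeal.zeroIdeal J := ClosedIdeal.ext_coe (Set.ext hi)
  have := (mem_ker_map_iff E J.incl (x := x)).mp hx
  rw [h, zeroIdeal_tensor E] at this
  exact this

/-- The tensor product of an ideal with `K`, as an ideal of `A ⊗ K`. -/
noncomputable def tensorIdealEquiv : CStarTensor J K ≃⋆ₐ[ℂ] J.tensor K :=
  have hmem : ∀ x, map K J.incl x ∈ J.tensor K := fun x => by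
    have : map K J.incl x ∈ (J.tensor K : Set (CStarTensor A K)) :=
      (range_map_incl (K := K) J).subset ⟨x, rfl⟩
    exact this
  StarAlgEquiv.ofBijective
    ({ toFun := fun x => ⟨map K J.incl x, hmem x⟩
       map_smul' := fun c x => Subtype.ext (map_smul (map K J.incl) c x)
       map_zero' := Subtype.ext (map_zero (map K J.incl))
       map_add' := fun x y => Subtype.ext (map_add (map K J.incl) x y)
       map_mul' := fun x y => Subtype.ext (map_mul (map K J.incl) x y)
       map_star' := fun x => Subtype.ext (map_star (map K J.incl) x) } :
      CStarTensor J K →⋆ₙₐ[ℂ] J.tensor K)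
    ⟨fun x y h => map_incl_injective E J (congrArg Subtype.val h), fun y => by
      obtain ⟨x, hx⟩ : (y : CStarTensor A K) ∈ Set.range (map K J.incl) :=
        (range_map_incl (K := K) J).symm ▸ y.2
      exact ⟨x, Subtype.ext hx⟩⟩

include E in
lemma comap_map_incl (I : ClosedIdeal A) :
    (I.tensor K).comap (map K J.incl) = (I.restrict J).tensor K := by
  rw [eq_tensor_iff E]
  intro a
  rw [ClosedIdeal.mem_comap, map_corner, corner_mem_tensor_iff E]
  rfl

/-- `(J ⊗ K) / (I ⊗ K)` is isomorphic to `(J / I) ⊗ K`. -/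
noncomputable def subquotientEquiv (I : ClosedIdeal A) :
    (J.tensor K).Subquotient (I.tensor K) ≃⋆ₐ[ℂ] CStarTensor (J.Subquotient I) K :=
  ((I.tensor K).restrict (J.tensor K)).quotientEquiv
    ((map K (I.restrict J).projHom).comp
      ((tensorIdealEquiv E J).symm : J.tensor K →⋆ₙₐ[ℂ] CStarTensor J K))
    (fun y => by
      obtain ⟨x, rfl⟩ := (tensorIdealEquiv E J).surjective y
      have h1 : (map K (I.restrict J).projHom) ((tensorIdealEquiv E J).symm
          (tensorIdealEquiv E J x)) = map K (I.restrict J).projHom x :=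
        congrArg _ ((tensorIdealEquiv E J).symm_apply_apply x)
      refine Iff.trans ?_ (Eq.congr_left h1).symm
      rw [← mem_tensor_iff_map_projHom_eq_zero E, ← comap_map_incl E J I]
      rfl)
    ((map_surjective _ (I.restrict J).projHom_surjective).comp
      (tensorIdealEquiv E J).symm.surjective)

end Subquotient

end CStarTensor

/-! ### The Cantor–Bendixson sequence of the tensor product -/

open CStarTensor in
lemma IsCantorBendixsonSequence.tensor {A : Type u} [NonUnitalCStarAlgebra A] {K : Type}
    [NonUnitalCStarAlgebra K] (E : CompleteMatrixUnits K) {ht : Ordinal.{u}}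
    {I : Ordinal.{u} → ClosedIdeal A} (h : IsCantorBendixsonSequence A ht I) :
    IsCantorBendixsonSequence (CStarTensor A K) ht (fun α => (I α).tensor K) where
  zero := by
    have : I 0 = ClosedIdeal.zeroIdeal A := ClosedIdeal.ext_coe h.zero
    rw [this, zeroIdeal_tensor E]
    rfl
  height := tensor_eq_univ E h.height
  strictMono α β hαβ hβ :=
    ⟨tensor_mono (h.strictMono α β hαβ hβ).1,
      fun hs => (h.strictMono α β hαβ hβ).2 (subset_of_tensor_subset E hs)⟩
  limit β hβ hlim := by
    have hne : Nonempty (Set.Iio β) := ⟨⟨0, hlim.bot_lt⟩⟩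
    have hdir : ∀ α γ : Set.Iio β, ∃ δ : Set.Iio β, (I α : Set A) ⊆ I δ ∧ (I γ : Set A) ⊆ I δ := by
      intro α γ
      rcases le_total α γ with hle | hle
      · exact ⟨γ, h.mono hle (γ.2.le.trans hβ), subset_rfl⟩
      · exact ⟨α, subset_rfl, h.mono hle (α.2.le.trans hβ)⟩
    -- Continuity at a limit is recast as a closed supremum, the form in which it is preserved by
    -- tensoring.
    have h1 : I β = ClosedIdeal.closedSup fun α : Set.Iio β => I α.1 := by
      refine ClosedIdeal.ext_coe ?_
      rw [ClosedIdeal.coe_closedSup_of_directed _ hdir, h.limit β hβ hlim, Set.iUnion_subtype]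
      rfl
    rw [h1, closedSup_tensor E, ClosedIdeal.coe_closedSup_of_directed, Set.iUnion_subtype]
    · rfl
    · intro α γ
      obtain ⟨δ, h1, h2⟩ := hdir α γ
      exact ⟨δ, tensor_mono h1, tensor_mono h2⟩
  succ α hα := by
    refine (ClosedIdeal.coe_atomicPart_eq_image_iff (tensor_mono ?_)).mpr ?_
    · exact h.mono (by simp) (Order.add_one_le_of_lt hα)
    · rw [h.succ_eq_derived hα, derived_tensor E]

end ScatteredCStar

theorem mainTheorem7 {A : Type u} [NonUnitalCStarAlgebra A] (hA : IsScattered A) :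
    IsScattered (CStarTensor A KEllTwo) ∧
    (∃ (ht : Ordinal.{u}) (I : Ordinal.{u} → ClosedIdeal A), IsCantorBendixsonSequence A ht I) ∧
    ∀ (ht : Ordinal.{u}) (I : Ordinal.{u} → ClosedIdeal A), IsCantorBendixsonSequence A ht I →
      IsCantorBendixsonSequence (CStarTensor A KEllTwo) ht (fun α => (I α).tensor KEllTwo) ∧
      (∀ (ht' : Ordinal.{u}) (J : Ordinal.{u} → ClosedIdeal (CStarTensor A KEllTwo)),
        IsCantorBendixsonSequence (CStarTensor A KEllTwo) ht' J →
          ht' = ht ∧ ∀ α ≤ ht, J α = (I α).tensor KEllTwo) ∧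
      ∀ α < ht,
        Nonempty (((I (α + 1)).tensor KEllTwo).Subquotient ((I α).tensor KEllTwo) ≃⋆ₐ[ℂ]
          CStarTensor ((I (α + 1)).Subquotient (I α)) KEllTwo) := by
  have hCB := hA.noIntervalSpectrum.exists_isCantorBendixsonSequence
  have hs : IsScattered (CStarTensor A KEllTwo) := by
    obtain ⟨ht, I, h⟩ := hCB
    -- Subalgebras of `A ⊗ K` are never examined directly: possession of a Cantor–Bendixson sequence
    -- already gives scatteredness.
    exact (h.tensor KEllTwo.completeMatrixUnits).isScattered
  refine ⟨hs, hCB, ?_⟩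
  intro ht I h
  have hT := h.tensor KEllTwo.completeMatrixUnits
  refine ⟨hT, ?_, ?_⟩
  · exact fun ht' J hJ => hT.unique hJ
  · exact fun α _ => ⟨CStarTensor.subquotientEquiv KEllTwo.completeMatrixUnits (I (α + 1)) (I α)⟩
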